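/- Consider the symmetric two-user complex Gaussian interference channel with perfect output feedback. Let $g_d,g_c\in\mathbb{C}$ be the direct and the cross gain, and put $\mathsf{SNR}=|g_d|^2$, $\mathsf{INR}=|g_c|^2$. At times $i=1,\dots,N$, $$Y_{1i}=g_dX_{1i}+g_cX_{2i}+Z_{1i},\qquad Y_{2i}=g_cX_{1i}+g_dX_{2i}+Z_{2i},$$ where all $Z_{ki}$ are independent with law $\mathcal{CN}(0,1)$. The messages $W_1,W_2$ are independent of each other and of the noise, and $W_k$ is uniform on $\{1,\dots,M_k\}$. User $k$ sends $X_{ki}=f_k^i(W_k,Y_{k1},\dots,Y_{k(i-1)})$ subject to the average power constraint $\frac1N\sum_{i=1}^N E|X_{ki}|^2\le 1$, and receiver $k$ estimates $W_k$ from $Y_{k1},\dots,Y_{kN}$. A pair $(R_1,R_2)$ with $R_1,R_2\ge 0$ is achievable if for every block length $N$ there is such a code with $M_k\ge 2^{NR_k}$ ($k=1,2$), such that the probability that some receiver errs tends to $0$ as $N\to\infty$. The capacity region $\mathcal{R}$ is the closure of the set of achievable pairs, and $C_{\mathsf{sym}}=\sup\{R:(R,R)\in\mathcal{R}\}$. Let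 $$\overline{C}_{\mathsf{sym}}=\frac12\sup_{0\le\rho\le1}\left[\log_2\left(1+\frac{(1-\rho^2)\mathsf{SNR}}{1+(1-\rho^2)\mathsf{INR}}\right)+\log_2\left(1+\mathsf{SNR}+\mathsf{INR}+2\rho\sqrt{\mathsf{SNR}\cdot\mathsf{INR}}\right)\right].$$ Then for all $g_d,g_c\in\mathbb{C}$ (hence for all values of $\mathsf{SNR},\mathsf{INR}\ge0$), for every $R$ with $0\le R\le\overline{C}_{\mathsf{sym}}-1.7075$ the pair $(R,R)$ is achievable. Moreover $C_{\mathsf{sym}}$ is finite and $$\overline{C}_{\mathsf{sym}}-1.7075\le C_{\mathsf{sym}}\le\overline{C}_{\mathsf{sym}}.$$ -/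

import Mathlib

open MeasureTheory ProbabilityTheory Filter Topology Set

noncomputable section

namespace GaussianIFC

/-- The circularly symmetric complex Gaussian law `CN(0,1)`: independent real and imaginary
parts, each centred Gaussian of variance `1/2`. -/
def stdComplexGaussian : Measure ℂ :=
  ((gaussianReal 0 (1 / 2)).prod (gaussianReal 0 (1 / 2))).map Complex.measurableEquivRealProd.symm

/-- The other one of the two users. -/
def other (k : Fin 2) : Fin 2 := 1 - k

/-- A feedback code of block length `N` for two users, user `k` having `M k` messages.
At time `i`, the input of user `k` is a (measurable) function of the own message and of the outputs
of the own receiver at the times before `i`.  Receiver `k` estimates the message `k` from its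
whole output sequence. -/
structure FeedbackCode (N : ℕ) (M : Fin 2 → ℕ) where
  enc : (k : Fin 2) → (i : Fin N) → Fin (M k) → (Fin i → ℂ) → ℂ
  measurable_enc : ∀ k i w, Measurable (enc k i w)
  dec : (k : Fin 2) → (Fin N → ℂ) → Fin (M k)
  measurable_dec : ∀ k, Measurable (dec k)

namespace FeedbackCode

variable {N : ℕ} {M : Fin 2 → ℕ}

/-- The outputs of both receivers at time `i`, when the messages are `w` and the noise is `z`
(`z k i` is the noise at receiver `k` at time `i`); `gd` is the direct gain, `gc` the cross gain. -/
def output (c : FeedbackCode N M) (gd gc : ℂ) (w : (k : Fin 2) → Fin (M k))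
    (z : Fin 2 → Fin N → ℂ) (i : Fin N) : Fin 2 → ℂ := fun k =>
  gd * c.enc k i (w k) (fun j => output c gd gc w z ⟨j, j.isLt.trans i.isLt⟩ k)
    + gc * c.enc (other k) i (w (other k))
        (fun j => output c gd gc w z ⟨j, j.isLt.trans i.isLt⟩ (other k))
    + z k i
termination_by i.val
decreasing_by all_goals exact j.isLt

/-- The channel input of user `k` at time `i`. -/
def input (c : FeedbackCode N M) (gd gc : ℂ) (w : (k : Fin 2) → Fin (M k))
    (z : Fin 2 → Fin N → ℂ) (k : Fin 2) (i : Fin N) : ℂ :=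
  c.enc k i (w k) (fun j => output c gd gc w z ⟨j, j.isLt.trans i.isLt⟩ k)

/-- Joint law of messages and noise: the messages are independent and uniform, the noise variables
are independent of them and i.i.d. `CN(0,1)` over users and times. -/
def law (N : ℕ) (M : Fin 2 → ℕ) :
    Measure (((k : Fin 2) → Fin (M k)) × (Fin 2 → Fin N → ℂ)) :=
  (uniformOn Set.univ).prod (Measure.pi fun _ => Measure.pi fun _ => stdComplexGaussian)

/-- Probability that at least one of the receivers errs. -/
def errorProb (c : FeedbackCode N M) (gd gc : ℂ) : ENNReal :=
  law N M {p | ∃ k, c.dec k (fun i => c.output gd gc p.1 p.2 i k) ≠ p.1 k}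

/-- The average power constraint `(1/N) ∑ᵢ E|X_{ki}|² ≤ 1` for both users. -/
def PowerConstraint (c : FeedbackCode N M) (gd gc : ℂ) : Prop :=
  ∀ k, ∑ i, ∫⁻ p, ‖c.input gd gc p.1 p.2 k i‖ₑ ^ 2 ∂(law N M) ≤ N

end FeedbackCode

/-- The rate pair `R` (in bits per channel use) is achievable: there are codes of all block lengths
`N` with at least `2 ^ (N * R k)` messages for user `k`, satisfying the power constraint, whose
error probabilities tend to zero. -/
def Achievable (gd gc : ℂ) (R : Fin 2 → ℝ) : Prop :=
  (∀ k, 0 ≤ R k) ∧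
  ∃ (M : ℕ → Fin 2 → ℕ) (c : (N : ℕ) → FeedbackCode N (M N)),
    (∀ (N : ℕ) (k : Fin 2), (2 : ℝ) ^ ((N : ℝ) * R k) ≤ (M N k : ℝ)) ∧
    (∀ N, (c N).PowerConstraint gd gc) ∧
    Tendsto (fun N => (c N).errorProb gd gc) atTop (𝓝 0)

/-- The capacity region: the closure of the set of achievable rate pairs. -/
def capacityRegion (gd gc : ℂ) : Set (Fin 2 → ℝ) :=
  closure {R | Achievable gd gc R}

/-- The rates `R` such that `(R, R)` is in the capacity region. -/
def symRates (gd gc : ℂ) : Set ℝ := {R | (fun _ => R) ∈ capacityRegion gd gc}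

/-- The symmetric feedback capacity. -/
def symCapacity (gd gc : ℂ) : ℝ := sSup (symRates gd gc)

/-- The function of `ρ` whose supremum over `[0, 1]` is twice the outer bound. -/
def outerFun (SNR INR ρ : ℝ) : ℝ :=
  Real.logb 2 (1 + (1 - ρ ^ 2) * SNR / (1 + (1 - ρ ^ 2) * INR))
    + Real.logb 2 (1 + SNR + INR + 2 * ρ * √(SNR * INR))

/-- The outer bound on the symmetric capacity. -/
def outerBound (SNR INR : ℝ) : ℝ := 1 / 2 * sSup (outerFun SNR INR '' Icc 0 1)

/-- The supremum in `outerBound` is a finite one. -/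
theorem bddAbove_outerFun {SNR INR : ℝ} (hS : 0 ≤ SNR) (hI : 0 ≤ INR) :
    BddAbove (outerFun SNR INR '' Icc 0 1) := by
  refine ⟨Real.logb 2 (1 + SNR) + Real.logb 2 (1 + SNR + INR + 2 * √(SNR * INR)), ?_⟩
  rintro _ ⟨ρ, ⟨h0, h1⟩, rfl⟩
  have hρ : 0 ≤ 1 - ρ ^ 2 := by nlinarith
  have hq := Real.sqrt_nonneg (SNR * INR)
  have hb : (1 - ρ ^ 2) * SNR / (1 + (1 - ρ ^ 2) * INR) ≤ SNR := by
    rw [div_le_iff₀ (by positivity)]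
    nlinarith [mul_nonneg (mul_nonneg hρ hI) hS, mul_nonneg (sq_nonneg ρ) hS]
  unfold outerFun
  refine add_le_add ?_ ?_
  · exact Real.logb_le_logb_of_le (by norm_num) (by positivity) (by linarith)
  · exact Real.logb_le_logb_of_le (by norm_num) (by positivity) (by nlinarith)

end GaussianIFC

end

/-! Upper bound. Fix a code, and compare the true law of the outputs with an auxiliary law under
which receiver 0 sees i.i.d. Gaussian noise of variance `V`, while receiver 1, given message 0 and
the outputs of receiver 0, sees a Gaussian of variance `v` around a linear estimate. Under the
auxiliary law the outputs carry no information about message 1, and those of receiver 0 none about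
message 0, so both decoders are right with probability exactly `1 / (M 0 * M 1)`. Data processing
(`FeedbackCode.prob_correct_mul_log_le`) then bounds the sum rate by the mean log-likelihood ratio.
Because feedback is causal, this mean involves only second moments of the inputs. With the linear
MMSE coefficients for the time-averaged correlation `ρ` it is at most `N * (log V + log v)`, which
is `outerFun` at `‖ρ‖` (`FeedbackCode.prob_correct_mul_log_le_outerFun`).

Lower bound. The scheme uses two slots. In the first one every user superposes a common and a
private codeword, of powers `A` and `B`. Through feedback each transmitter decodes the common
message of the other user. In the second slot it sends that message in Alamouti form, together with
a fresh private codeword. Combining the two slots, each receiver sees either common codeword with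
gain `SNR + INR` and free of the other one. It removes both and decodes its private messages,
treating the private signal of the other user as noise. Codebooks are random Gaussian, and all
decoders are threshold tests on linear forms in ten independent Gaussian variables per letter. A
wrong codeword rarely passes by Markov's inequality (`measure_score_ge_le`), and the right one
passes by Chebyshev's (`exists_measure_energy_le`, `sum_score_ge`). `Scheme.dec_code_eq` reduces the
whole protocol to tests on error-free statistics, so errors never have to be followed through the
slots.

The gap. Making the private interference arrive at power about 2, or using private messages only
when `INR` is small, puts the two-slot rate within a factor `53/5 < 2 ^ 3.415` inside the logarithm
(`exists_power_split`), and `3.415 = 2 * 1.7075`. -/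

/-! ### Product measures: densities, currying, triangular changes of variables. -/

section ProductMeasures

open scoped ENNReal

variable {ι : Type*} {E : Type*} [MeasurableSpace E]

theorem lmarginal_prod_eq_prod_lintegral [DecidableEq ι] (μ : ι → Measure E)
    [∀ i, SigmaFinite (μ i)] (f : ι → E → ℝ≥0∞) (hf : ∀ i, Measurable (f i)) (s : Finset ι) :
    (∫⋯∫⁻_s, (fun x => ∏ i ∈ s, f i (x i)) ∂μ) = fun _ => ∏ i ∈ s, ∫⁻ x, f i x ∂(μ i) := by
  induction s using Finset.induction_on with
  | empty => simp
  | insert i s hi ih =>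
    have hm : Measurable fun x : ι → E => ∏ j ∈ s, f j (x j) := by fun_prop
    have hm' : Measurable fun x : ι → E => ∏ j ∈ insert i s, f j (x j) := by fun_prop
    rw [lmarginal_insert' _ hm' hi]
    have key : (∫⋯∫⁻_{i}, (fun x : ι → E => ∏ j ∈ insert i s, f j (x j)) ∂μ)
        = fun x => (∫⁻ t, f i t ∂(μ i)) * ∏ j ∈ s, f j (x j) := by
      funext x
      rw [lmarginal_singleton, ← lintegral_mul_const _ (hf i)]
      refine lintegral_congr fun t => ?_
      rw [Finset.prod_insert hi, Function.update_self]
      congr 1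
      refine Finset.prod_congr rfl fun j hj => ?_
      rw [Function.update_of_ne (by rintro rfl; exact hi hj)]
    have e : (fun x : ι → E => ∫⁻ t, (fun x : ι → E => ∏ j ∈ insert i s, f j (x j))
        (Function.update x i t) ∂(μ i)) = fun x => (∫⁻ t, f i t ∂(μ i)) * ∏ j ∈ s, f j (x j) := by
      rw [← key]; funext x; rw [lmarginal_singleton]
    rw [e, Finset.prod_insert hi]
    funext x
    have ih' := congrFun ih x
    simp only [lmarginal] at ih' ⊢
    rw [lintegral_const_mul, ih']
    exact hm.comp measurable_updateFinset

variable [Fintype ι]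

/-- Tonelli's theorem for a product of functions of the separate coordinates. -/
theorem lintegral_pi_prod (μ : ι → Measure E) [∀ i, SigmaFinite (μ i)] (f : ι → E → ℝ≥0∞)
    (hf : ∀ i, Measurable (f i)) :
    ∫⁻ x, ∏ i, f i (x i) ∂(Measure.pi μ) = ∏ i, ∫⁻ x, f i x ∂(μ i) := by
  classical
  by_cases h : Nonempty (ι → E)
  · obtain ⟨x⟩ := h
    rw [lintegral_eq_lmarginal_univ x, lmarginal_prod_eq_prod_lintegral μ f hf]
  · have hE : IsEmpty E ∧ Nonempty ι := by
      rw [not_nonempty_iff, isEmpty_pi] at h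
      exact ⟨h.choose_spec, ⟨h.choose⟩⟩
    obtain ⟨_, ⟨i⟩⟩ := hE
    rw [not_nonempty_iff] at h
    rw [lintegral_of_isEmpty, eq_comm, Finset.prod_eq_zero (Finset.mem_univ i)]
    exact lintegral_of_isEmpty _ _

theorem pi_withDensity (μ : ι → Measure E) [∀ i, SigmaFinite (μ i)] (f : ι → E → ℝ≥0∞)
    (hf : ∀ i, Measurable (f i)) [∀ i, SigmaFinite ((μ i).withDensity (f i))] :
    Measure.pi (fun i => (μ i).withDensity (f i))
      = (Measure.pi μ).withDensity (fun x => ∏ i, f i (x i)) := by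
  refine (Measure.pi_eq fun s hs => ?_)
  rw [withDensity_apply _ (MeasurableSet.univ_pi hs), ← lintegral_indicator (MeasurableSet.univ_pi hs)]
  have : ∀ x : ι → E, (Set.univ.pi s).indicator (fun x => ∏ i, f i (x i)) x
      = ∏ i, (s i).indicator (f i) (x i) := by
    intro x
    by_cases hx : x ∈ Set.univ.pi s
    · rw [Set.indicator_of_mem hx]
      exact Finset.prod_congr rfl fun i _ => by rw [Set.indicator_of_mem (hx i (Set.mem_univ i))]
    · rw [Set.indicator_of_notMem hx]
      simp only [Set.mem_univ_pi, not_forall] at hx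
      obtain ⟨i, hi⟩ := hx
      exact (Finset.prod_eq_zero (Finset.mem_univ i) (Set.indicator_of_notMem hi _)).symm
  simp_rw [this]
  rw [lintegral_pi_prod μ _ fun i => (hf i).indicator (hs i)]
  refine Finset.prod_congr rfl fun i _ => ?_
  rw [withDensity_apply _ (hs i), lintegral_indicator (hs i)]

theorem measurePreserving_curry {κ : Type*} [Fintype κ] (μ : Measure E) [SigmaFinite μ] :
    MeasurePreserving (fun (x : ι × κ → E) i k => x (i, k)) (Measure.pi fun _ => μ)
      (Measure.pi fun _ => Measure.pi fun _ => μ) := by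
  refine MeasurePreserving.symm (MeasurableEquiv.curry ι κ E).symm ⟨(MeasurableEquiv.curry ι κ E).symm.measurable, ?_⟩
  refine (Measure.pi_eq fun s hs => ?_).symm
  rw [MeasurableEquiv.map_apply]
  have : (MeasurableEquiv.curry ι κ E).symm ⁻¹' (Set.univ.pi s)
      = Set.univ.pi fun i => Set.univ.pi fun k => s (i, k) := by
    ext x
    simp only [Set.mem_preimage, Set.mem_univ_pi, Prod.forall]
    rfl
  rw [this, Measure.pi_pi]
  simp_rw [Measure.pi_pi]
  rw [Fintype.prod_prod_type]

/-- A shear in one coordinate preserves a product of translation invariant measures. -/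
theorem lintegral_pi_shear [DecidableEq ι] [AddCommGroup E] [MeasurableAdd₂ E] (μ : Measure E)
    [SigmaFinite μ] [μ.IsAddRightInvariant] (j : ι) (s : (ι → E) → E) (hs : Measurable s)
    (hj : ∀ x t, s (Function.update x j t) = s x) (F : (ι → E) → ℝ≥0∞) (hF : Measurable F) :
    ∫⁻ x, F (Function.update x j (x j + s x)) ∂(Measure.pi fun _ => μ)
      = ∫⁻ x, F x ∂(Measure.pi fun _ => μ) := by
  have hu : Measurable fun x : ι → E => Function.update x j (x j + s x) := by
    rw [measurable_pi_iff]
    intro i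
    by_cases h : i = j
    · subst h; simp only [Function.update_self]; fun_prop
    · simp only [Function.update_of_ne h]; fun_prop
  -- Once the other coordinates are frozen, the shift is a constant by `hj`, and translation
  -- invariance in coordinate `j` applies.
  refine lintegral_eq_of_lmarginal_eq {j} (hF.comp hu) hF ?_
  funext x
  rw [lmarginal_singleton, lmarginal_singleton]
  simp only [Function.update_self, Function.update_idem, hj]
  exact lintegral_add_right_eq_self (fun t => F (Function.update x j t)) (s x)

/-- A triangular perturbation of the identity preserves a product of translation invariant
measures. -/
theorem lintegral_pi_triangular [AddCommGroup E] [MeasurableAdd₂ E] (μ : Measure E)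
    [SigmaFinite μ] [μ.IsAddRightInvariant] (r : ι → ℕ) (hr : Function.Injective r)
    (s : ι → (ι → E) → E) (hs : ∀ i, Measurable (s i))
    (hdep : ∀ i x y, (∀ j, r j < r i → x j = y j) → s i x = s i y)
    (F : (ι → E) → ℝ≥0∞) (hF : Measurable F) :
    ∫⁻ x, F (fun i => x i + s i x) ∂(Measure.pi fun _ => μ)
      = ∫⁻ x, F x ∂(Measure.pi fun _ => μ) := by
  classical
  -- The shifts are switched on one at a time in the order of `r`. Each stage is a shear in a single
  -- coordinate `j`, and neither `s j` nor the shifts already switched on depend on that coordinate.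
  have key : ∀ m : ℕ, ∫⁻ x, F (fun i => if r i < m then x i + s i x else x i)
      ∂(Measure.pi fun _ => μ) = ∫⁻ x, F x ∂(Measure.pi fun _ => μ) := by
    intro m
    induction m with
    | zero => simp
    | succ m ih =>
      by_cases h : ∃ j, r j = m
      · obtain ⟨j, rfl⟩ := h
        rw [← ih]
        have hG : Measurable fun x : ι → E => F (fun i => if r i < r j then x i + s i x else x i) := by
          refine hF.comp (measurable_pi_lambda _ fun i => ?_)
          split_ifs
          · exact (measurable_pi_apply i).add (hs i)
          · exact measurable_pi_apply i
        have hjd : ∀ i, r i ≤ r j → ∀ (x : ι → E) t, s i (Function.update x j t) = s i x := by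
          intro i hi x t
          refine hdep i _ _ fun k hk => Function.update_of_ne ?_ _ _
          rintro rfl; omega
        rw [← lintegral_pi_shear μ j (s j) (hs j) (hjd j le_rfl) _ hG]
        refine lintegral_congr fun x => congrArg F (funext fun i => ?_)
        by_cases hi : i = j
        · subst hi; simp
        · have hne : r i ≠ r j := fun h => hi (hr h)
          rw [Function.update_of_ne hi]
          by_cases hlt : r i < r j
          · rw [if_pos (by omega), if_pos hlt, hjd i hlt.le]
          · rw [if_neg (by omega), if_neg hlt]
      · rw [← ih]
        refine lintegral_congr fun x => congrArg F (funext fun i => ?_)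
        have : r i ≠ m := fun h' => h ⟨i, h'⟩
        by_cases hlt : r i < m
        · rw [if_pos hlt, if_pos (by omega)]
        · rw [if_neg hlt, if_neg (by omega)]
  obtain ⟨m, hm⟩ : ∃ m, ∀ i, r i < m :=
    ⟨Finset.univ.sup r + 1, fun i => Nat.lt_succ_of_le (Finset.le_sup (Finset.mem_univ i))⟩
  rw [← key m]
  simp only [hm, if_true]

end ProductMeasures

namespace GaussianIFC

open scoped ENNReal

/-! ### The law `CN(0,1)`: density, symmetries, moments. -/

section ComplexGaussian

/-- The density of the centred circularly symmetric complex Gaussian law of variance `v`. -/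
noncomputable def gaussianDensity (v : ℝ) (z : ℂ) : ℝ≥0∞ :=
  ENNReal.ofReal ((Real.pi * v)⁻¹ * Real.exp (-(‖z‖ ^ 2 / v)))

@[fun_prop]
theorem measurable_gaussianDensity (v : ℝ) : Measurable (gaussianDensity v) := by
  unfold gaussianDensity; fun_prop

theorem lintegral_gaussianDensity {v : ℝ} (hv : 0 < v) : ∫⁻ z, gaussianDensity v z = 1 := by
  have h := GaussianFourier.integral_rexp_neg_mul_sq_norm (V := ℂ) (b := v⁻¹) (by positivity)
  have hne : ∫ z : ℂ, Real.exp (-v⁻¹ * ‖z‖ ^ 2) ≠ 0 := by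
    rw [h]; positivity
  -- A non-integrable function has integral 0 by convention, so a nonzero value proves
  -- integrability.
  have hi : Integrable (fun z : ℂ => Real.exp (-v⁻¹ * ‖z‖ ^ 2)) := by
    by_contra hc
    exact hne (integral_undef hc)
  unfold gaussianDensity
  have e : ∀ z : ℂ, (Real.pi * v)⁻¹ * Real.exp (-(‖z‖ ^ 2 / v))
      = (Real.pi * v)⁻¹ * Real.exp (-v⁻¹ * ‖z‖ ^ 2) := by
    intro z; congr 2; ring
  simp_rw [e]
  rw [← ofReal_integral_eq_lintegral_ofReal (hi.const_mul _)
    (Eventually.of_forall fun z => by positivity), integral_const_mul, h]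
  rw [Complex.finrank_real_complex]
  norm_num
  field_simp

theorem lintegral_gaussianDensity_sub {v : ℝ} (hv : 0 < v) (m : ℂ) :
    ∫⁻ z, gaussianDensity v (z - m) = 1 := by
  rw [lintegral_sub_right_eq_self (gaussianDensity v) m, lintegral_gaussianDensity hv]

theorem stdComplexGaussian_eq_withDensity :
    stdComplexGaussian = volume.withDensity (gaussianDensity 1) := by
  unfold stdComplexGaussian
  have h2 : (1 / 2 : NNReal) ≠ 0 := by norm_num
  rw [gaussianReal_of_var_ne_zero _ h2, prod_withDensity (measurable_gaussianPDF _ _) (measurable_gaussianPDF _ _)]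
  ext s hs
  rw [Measure.map_apply (MeasurableEquiv.measurable _) hs, withDensity_apply _ hs, withDensity_apply _
    (MeasurableEquiv.measurable _ hs)]
  rw [← (Complex.volume_preserving_equiv_real_prod.symm).setLIntegral_comp_preimage hs (by fun_prop)]
  refine lintegral_congr fun p => ?_
  unfold gaussianDensity gaussianPDF gaussianPDFReal
  rw [← ENNReal.ofReal_mul (by positivity)]
  congr 1
  rw [Complex.measurableEquivRealProd_symm_apply, Complex.sq_norm, Complex.normSq_mk]
  have : √(2 * Real.pi * ((1 / 2 : NNReal) : ℝ)) = √Real.pi := by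
    congr 1; push_cast; ring
  rw [this]
  have h3 := Real.mul_self_sqrt Real.pi_pos.le
  rw [mul_mul_mul_comm, ← Real.exp_add, ← mul_inv, h3]
  congr 2
  · ring
  · push_cast; ring

instance : IsProbabilityMeasure stdComplexGaussian := by
  unfold stdComplexGaussian
  exact Measure.isProbabilityMeasure_map (MeasurableEquiv.measurable _).aemeasurable

/-- The density depends on the norm only, and isometries preserve Lebesgue measure. Negation yields
the orthogonality of noise and inputs in the converse; conjugation is needed for the second slot of
the scheme. -/
theorem measurePreserving_isometry_stdComplexGaussian (e : ℂ ≃ₗᵢ[ℝ] ℂ) :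
    MeasurePreserving e stdComplexGaussian stdComplexGaussian := by
  refine ⟨e.continuous.measurable, ?_⟩
  rw [stdComplexGaussian_eq_withDensity]
  ext s hs
  rw [Measure.map_apply e.continuous.measurable hs, withDensity_apply _ hs, withDensity_apply _
    (e.continuous.measurable hs)]
  rw [← e.measurePreserving.setLIntegral_comp_preimage hs (by fun_prop)]
  refine lintegral_congr fun z => ?_
  simp [gaussianDensity]

theorem measurePreserving_neg_stdComplexGaussian :
    MeasurePreserving (fun z : ℂ => -z) stdComplexGaussian stdComplexGaussian :=
  measurePreserving_isometry_stdComplexGaussian (LinearIsometryEquiv.neg ℝ)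

theorem measurePreserving_conj_stdComplexGaussian :
    MeasurePreserving (fun z : ℂ => (starRingEnd ℂ) z) stdComplexGaussian stdComplexGaussian :=
  measurePreserving_isometry_stdComplexGaussian Complex.conjLIE

theorem memLp_stdComplexGaussian (p : ℝ≥0∞) (hp : p ≠ ∞) :
    MemLp (fun z : ℂ => z) p stdComplexGaussian := by
  unfold stdComplexGaussian
  rw [memLp_map_measure_iff (by fun_prop) (by fun_prop)]
  have h1 : MemLp (fun q : ℝ × ℝ => q.1) p ((gaussianReal 0 (1 / 2)).prod (gaussianReal 0 (1 / 2))) :=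
    (memLp_id_gaussianReal' (μ := 0) (v := 1 / 2) p hp).comp_measurePreserving measurePreserving_fst
  have h2 : MemLp (fun q : ℝ × ℝ => q.2) p ((gaussianReal 0 (1 / 2)).prod (gaussianReal 0 (1 / 2))) :=
    (memLp_id_gaussianReal' (μ := 0) (v := 1 / 2) p hp).comp_measurePreserving measurePreserving_snd
  refine MemLp.of_le (h1.norm.add h2.norm) (by fun_prop) (Eventually.of_forall fun q => ?_)
  simp only [Function.comp_apply, Complex.measurableEquivRealProd_symm_apply, Pi.add_apply]
  refine (Complex.norm_le_abs_re_add_abs_im _).trans ?_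
  exact le_abs_self _

theorem integral_stdComplexGaussian : ∫ z, z ∂stdComplexGaussian = 0 := by
  have h := measurePreserving_neg_stdComplexGaussian.integral_comp'
    (f := MeasurableEquiv.neg ℂ) (fun z : ℂ => z)
  simp only [MeasurableEquiv.neg_apply] at h
  rw [integral_neg] at h
  exact self_eq_neg.mp h.symm

theorem integral_norm_sq_stdComplexGaussian : ∫ z, ‖z‖ ^ 2 ∂stdComplexGaussian = 1 := by
  unfold stdComplexGaussian
  rw [integral_map_equiv]
  have hv : ∫ x, x ^ 2 ∂(gaussianReal 0 (1 / 2)) = 1 / 2 := by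
    have h := variance_id_gaussianReal (μ := 0) (v := 1 / 2)
    rw [variance_of_integral_eq_zero aemeasurable_id (by simp)] at h
    simpa using h
  have hi : Integrable (fun x : ℝ => x ^ 2) (gaussianReal 0 (1 / 2)) :=
    (memLp_id_gaussianReal' (μ := 0) (v := 1 / 2) 2 (by simp)).integrable_sq
  have e : ∀ q : ℝ × ℝ, ‖Complex.measurableEquivRealProd.symm q‖ ^ 2 = q.1 ^ 2 + q.2 ^ 2 := by
    intro q
    rw [Complex.measurableEquivRealProd_symm_apply, Complex.sq_norm, Complex.normSq_mk]
    ring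
  simp_rw [e]
  rw [integral_add (hi.comp_fst _) (hi.comp_snd _)]
  rw [integral_fun_fst (fun x : ℝ => x ^ 2), integral_fun_snd (fun x : ℝ => x ^ 2), hv]
  norm_num

end ComplexGaussian

/-- The law of the noise: all components independent, of law `CN(0,1)`. -/
noncomputable abbrev noiseLaw (N : ℕ) : Measure (Fin 2 → Fin N → ℂ) :=
  Measure.pi fun _ => Measure.pi fun _ => stdComplexGaussian

/-! ### Causality and measurability of the feedback channel. -/

namespace FeedbackCode

variable {N : ℕ} {M : Fin 2 → ℕ}

theorem output_eq (c : FeedbackCode N M) (gd gc : ℂ) (w : (k : Fin 2) → Fin (M k))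
    (z : Fin 2 → Fin N → ℂ) (i : Fin N) (k : Fin 2) :
    c.output gd gc w z i k
      = gd * c.input gd gc w z k i + gc * c.input gd gc w z (other k) i + z k i := by
  rw [output]; rfl

theorem output_congr (c : FeedbackCode N M) (gd gc : ℂ) (w : (k : Fin 2) → Fin (M k))
    (z z' : Fin 2 → Fin N → ℂ) : ∀ (n : ℕ) (i : Fin N), i.val = n →
      (∀ k (j : Fin N), j ≤ i → z k j = z' k j) →
      ∀ k, c.output gd gc w z i k = c.output gd gc w z' i k := by
  intro n
  induction n using Nat.strong_induction_on with
  | _ n ih =>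
    intro i hi h k
    have key : ∀ (k : Fin 2), (fun j : Fin i => c.output gd gc w z ⟨j, j.isLt.trans i.isLt⟩ k)
        = fun j : Fin i => c.output gd gc w z' ⟨j, j.isLt.trans i.isLt⟩ k := by
      intro k
      funext j
      refine ih j (by have := j.isLt; omega) _ rfl (fun k l hl => h k l (hl.trans ?_)) k
      exact Fin.le_def.mpr j.isLt.le
    rw [output_eq, output_eq]
    unfold input
    rw [key, key, h k i le_rfl]

/-- Strict causality: inputs see only noise of earlier times. This makes the map from noise to
outputs triangular, and the current noise independent of the current inputs. -/
theorem input_congr (c : FeedbackCode N M) (gd gc : ℂ) (w : (k : Fin 2) → Fin (M k))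
    (z z' : Fin 2 → Fin N → ℂ) (i : Fin N)
    (h : ∀ k (j : Fin N), j < i → z k j = z' k j) (k : Fin 2) :
    c.input gd gc w z k i = c.input gd gc w z' k i := by
  unfold input
  congr 1
  funext j
  refine output_congr c gd gc w z z' j _ rfl (fun k l hl => h k l (lt_of_le_of_lt hl ?_)) k
  exact Fin.lt_def.mpr j.isLt

theorem measurable_output_right (c : FeedbackCode N M) (gd gc : ℂ)
    (w : (k : Fin 2) → Fin (M k)) : ∀ (n : ℕ) (i : Fin N), i.val = n → ∀ k,
      Measurable fun z => c.output gd gc w z i k := by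
  intro n
  induction n using Nat.strong_induction_on with
  | _ n ih =>
    intro i hi k
    have key : ∀ k : Fin 2, Measurable fun z => c.input gd gc w z k i := by
      intro k
      refine (c.measurable_enc k i (w k)).comp (measurable_pi_lambda _ fun j => ?_)
      exact ih j (by have := j.isLt; omega) _ rfl k
    simp_rw [output_eq]
    have := key k
    have := key (other k)
    fun_prop

@[fun_prop]
theorem measurable_output (c : FeedbackCode N M) (gd gc : ℂ) (i : Fin N) (k : Fin 2) :
    Measurable fun p : ((k : Fin 2) → Fin (M k)) × (Fin 2 → Fin N → ℂ) =>
      c.output gd gc p.1 p.2 i k :=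
  measurable_from_prod_countable_right fun w => measurable_output_right c gd gc w _ i rfl k

theorem measurable_input_right (c : FeedbackCode N M) (gd gc : ℂ)
    (w : (k : Fin 2) → Fin (M k)) (k : Fin 2) (i : Fin N) :
    Measurable fun z => c.input gd gc w z k i :=
  (c.measurable_enc k i (w k)).comp
    (measurable_pi_lambda _ fun _ => measurable_output_right c gd gc w _ _ rfl k)

@[fun_prop]
theorem measurable_input (c : FeedbackCode N M) (gd gc : ℂ) (k : Fin 2) (i : Fin N) :
    Measurable fun p : ((k : Fin 2) → Fin (M k)) × (Fin 2 → Fin N → ℂ) =>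
      c.input gd gc p.1 p.2 k i :=
  measurable_from_prod_countable_right fun w => measurable_input_right c gd gc w k i

/-- The map from the noise to the outputs preserves Lebesgue measure. -/
theorem lintegral_comp_output (c : FeedbackCode N M) (gd gc : ℂ) (w : (k : Fin 2) → Fin (M k))
    (F : (Fin 2 → Fin N → ℂ) → ℝ≥0∞) (hF : Measurable F) :
    ∫⁻ z : Fin 2 → Fin N → ℂ, F (fun k i => c.output gd gc w z i k) = ∫⁻ y, F y := by
  have hcur := measurePreserving_curry (ι := Fin 2) (κ := Fin N) (volume : Measure ℂ)
  have hout : Measurable fun z : Fin 2 → Fin N → ℂ => fun k i => c.output gd gc w z i k :=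
    measurable_pi_lambda _ fun k => measurable_pi_lambda _ fun i =>
      measurable_output_right c gd gc w _ i rfl k
  have h1 := hcur.lintegral_comp hF
  have h2 := hcur.lintegral_comp (hF.comp hout)
  refine h2.symm.trans (Eq.trans ?_ h1)
  have hFc : Measurable fun x : Fin 2 × Fin N → ℂ => F fun k i => x (k, i) :=
    hF.comp hcur.measurable
  -- The rank `2 * time + user` is an injective order that refines time, and an output is its own
  -- noise plus a function of noise of smaller rank.
  rw [← lintegral_pi_triangular (volume : Measure ℂ) (fun p : Fin 2 × Fin N => 2 * p.2.val + p.1.val)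
    ?_ (fun p x => gd * c.input gd gc w (fun k i => x (k, i)) p.1 p.2
      + gc * c.input gd gc w (fun k i => x (k, i)) (other p.1) p.2) ?_ ?_ _ hFc]
  · refine lintegral_congr fun x => ?_
    simp only [Function.comp_apply, output_eq]
    congr 1
    funext k i
    ring
  · rintro ⟨k, i⟩ ⟨k', i'⟩ h
    have h' : 2 * i.val + k.val = 2 * i'.val + k'.val := h
    have := k.isLt
    have := k'.isLt
    ext <;> simp only <;> omega
  · intro p
    have hm := hcur.measurable
    have h1 := (measurable_input_right c gd gc w p.1 p.2).comp hm
    have h2 := (measurable_input_right c gd gc w (other p.1) p.2).comp hm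
    exact (h1.const_mul gd).add (h2.const_mul gc)
  · rintro ⟨k, i⟩ x y h
    have : ∀ k, c.input gd gc w (fun k i => x (k, i)) k i
        = c.input gd gc w (fun k i => y (k, i)) k i := by
      refine input_congr c gd gc w _ _ i fun k' j hj => h (k', j) ?_
      have := k'.isLt
      have := Fin.lt_def.mp hj
      show 2 * j.val + k'.val < 2 * i.val + k.val
      omega
    simp only [this]

end FeedbackCode

theorem lintegral_uniformOn_univ {α : Type*} [Fintype α] [MeasurableSpace α]
    [MeasurableSingletonClass α] (f : α → ℝ≥0∞) :
    ∫⁻ a, f a ∂(uniformOn (Set.univ : Set α)) = (Fintype.card α : ℝ≥0∞)⁻¹ * ∑ a, f a := by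
  rw [uniformOn, ProbabilityTheory.cond, lintegral_smul_measure, Measure.restrict_univ, lintegral_count,
    tsum_fintype]
  simp

theorem noiseLaw_eq_withDensity (N : ℕ) :
    noiseLaw N = volume.withDensity (fun z => ∏ k, ∏ i, gaussianDensity 1 (z k i)) := by
  have h1 : Measure.pi (fun _ : Fin N => stdComplexGaussian)
      = volume.withDensity (fun z : Fin N → ℂ => ∏ i, gaussianDensity 1 (z i)) := by
    have : SigmaFinite ((volume : Measure ℂ).withDensity (gaussianDensity 1)) := by
      rw [← stdComplexGaussian_eq_withDensity]; infer_instance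
    rw [stdComplexGaussian_eq_withDensity]
    exact pi_withDensity (fun _ : Fin N => (volume : Measure ℂ)) _ fun _ => by fun_prop
  have : SigmaFinite ((volume : Measure (Fin N → ℂ)).withDensity
      (fun z : Fin N → ℂ => ∏ i, gaussianDensity 1 (z i))) := by
    rw [← h1]; infer_instance
  rw [noiseLaw, h1]
  exact pi_withDensity (fun _ : Fin 2 => (volume : Measure (Fin N → ℂ))) _ fun _ => by fun_prop

/-! ### Converse: change of measure and data processing. -/

namespace FeedbackCode

variable {N : ℕ} {M : Fin 2 → ℕ}

/-- The input of user `k` at time `i` when its outputs are `y`. -/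
def inputOf (c : FeedbackCode N M) (k : Fin 2) (w : Fin (M k)) (y : Fin N → ℂ) (i : Fin N) : ℂ :=
  c.enc k i w fun j => y ⟨j, j.isLt.trans i.isLt⟩

@[fun_prop]
theorem measurable_inputOf (c : FeedbackCode N M) (k : Fin 2) (w : Fin (M k)) (i : Fin N) :
    Measurable fun y => c.inputOf k w y i :=
  (c.measurable_enc k i w).comp (measurable_pi_lambda _ fun _ => measurable_pi_apply _)

/-- The density of an auxiliary output law: independent outputs of variance `V` at receiver `0`;
given these and message `0`, outputs of variance `v` at receiver `1`, centred at the linear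
estimate with coefficients `α`, `β`. -/
noncomputable def auxDensity (c : FeedbackCode N M) (V v : ℝ) (α β : ℂ) (w : Fin (M 0))
    (y : Fin 2 → Fin N → ℂ) : ℝ≥0∞ :=
  (∏ i, gaussianDensity V (y 0 i)) *
    ∏ i, gaussianDensity v (y 1 i - (α * c.inputOf 0 w (y 0) i + β * y 0 i))

theorem measurable_auxDensity (c : FeedbackCode N M) (V v : ℝ) (α β : ℂ) (w : Fin (M 0)) :
    Measurable (c.auxDensity V v α β w) := by
  have : ∀ i, Measurable fun y : Fin 2 → Fin N → ℂ => c.inputOf 0 w (y 0) i := fun i =>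
    (c.measurable_inputOf 0 w i).comp (measurable_pi_apply 0)
  unfold auxDensity
  fun_prop

/-- Given `y 0`, the density of `y 1` is a product of shifted Gaussian densities and integrates to
1. What is left does not involve `w`: under the auxiliary law, receiver 0 learns nothing about its
message. -/
theorem lintegral_auxDensity (c : FeedbackCode N M) {V v : ℝ} (hv : 0 < v)
    (α β : ℂ) (w : Fin (M 0)) (g : (Fin N → ℂ) → ℝ≥0∞) (hg : Measurable g) :
    ∫⁻ y, g (y 0) * c.auxDensity V v α β w y
      = ∫⁻ y : Fin N → ℂ, g y * ∏ i, gaussianDensity V (y i) := by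
  have h := (volume_preserving_piFinTwo (fun _ : Fin 2 => Fin N → ℂ)).symm
  have hm : Measurable fun y : Fin 2 → Fin N → ℂ => g (y 0) * c.auxDensity V v α β w y :=
    (hg.comp (measurable_pi_apply 0)).mul (c.measurable_auxDensity V v α β w)
  rw [← h.lintegral_comp hm]
  have hm' := hm.comp h.measurable
  rw [Measure.volume_eq_prod]
  refine (lintegral_prod _ hm'.aemeasurable).trans (lintegral_congr fun y => ?_)
  simp only [Function.comp_apply]
  have e : ∀ y' : Fin N → ℂ, g ((MeasurableEquiv.piFinTwo fun _ : Fin 2 => Fin N → ℂ).symm (y, y') 0) *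
      c.auxDensity V v α β w ((MeasurableEquiv.piFinTwo fun _ => Fin N → ℂ).symm (y, y'))
      = (g y * ∏ i, gaussianDensity V (y i)) *
        ∏ i, gaussianDensity v (y' i - (α * c.inputOf 0 w y i + β * y i)) := by
    intro y'
    rw [mul_assoc]
    rfl
  simp_rw [e]
  rw [lintegral_const_mul _ (by fun_prop)]
  have := lintegral_pi_prod (fun _ : Fin N => (volume : Measure ℂ))
    (fun i t => gaussianDensity v (t - (α * c.inputOf 0 w y i + β * y i))) (fun i => by fun_prop)
  rw [volume_pi, this]
  simp [lintegral_gaussianDensity_sub hv]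

/-- The log-likelihood ratio of the true law and the auxiliary law. -/
noncomputable def logRatio (c : FeedbackCode N M) (gd gc : ℂ) (V v : ℝ) (α β : ℂ)
    (p : ((k : Fin 2) → Fin (M k)) × (Fin 2 → Fin N → ℂ)) : ℝ :=
  ∑ i, ((Real.log V + ‖c.output gd gc p.1 p.2 i 0‖ ^ 2 / V - ‖p.2 0 i‖ ^ 2) +
    (Real.log v + ‖c.output gd gc p.1 p.2 i 1 - (α * c.input gd gc p.1 p.2 0 i
      + β * c.output gd gc p.1 p.2 i 0)‖ ^ 2 / v - ‖p.2 1 i‖ ^ 2))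

theorem measurable_logRatio (c : FeedbackCode N M) (gd gc : ℂ) (V v : ℝ) (α β : ℂ) :
    Measurable (c.logRatio gd gc V v α β) := by
  unfold logRatio
  fun_prop

/-- The exponent is the logarithm of the ratio of two Gaussian densities. The identity serves the
output letters of the converse and also the scores of the decoding tests. -/
theorem gaussianDensity_one_mul_exp {V : ℝ} (hV : 0 < V) (z y : ℂ) :
    gaussianDensity 1 z * ENNReal.ofReal (Real.exp (-(Real.log V + ‖y‖ ^ 2 / V - ‖z‖ ^ 2)))
      = gaussianDensity V y := by
  unfold gaussianDensity
  rw [← ENNReal.ofReal_mul (by positivity), mul_assoc, ← Real.exp_add]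
  congr 1
  have : -(‖z‖ ^ 2 / 1) + -(Real.log V + ‖y‖ ^ 2 / V - ‖z‖ ^ 2) = -(‖y‖ ^ 2 / V) - Real.log V := by
    ring
  rw [this, Real.exp_sub, Real.exp_log hV]
  field_simp

theorem prod_density_mul_exp_logRatio (c : FeedbackCode N M) (gd gc : ℂ) {V v : ℝ} (hV : 0 < V)
    (hv : 0 < v) (α β : ℂ) (w : (k : Fin 2) → Fin (M k)) (z : Fin 2 → Fin N → ℂ) :
    (∏ k, ∏ i, gaussianDensity 1 (z k i)) *
      ENNReal.ofReal (Real.exp (-c.logRatio gd gc V v α β (w, z)))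
      = c.auxDensity V v α β (w 0) (fun k i => c.output gd gc w z i k) := by
  unfold logRatio auxDensity
  rw [Finset.sum_add_distrib, neg_add, Real.exp_add, ← Finset.sum_neg_distrib,
    ← Finset.sum_neg_distrib, Real.exp_sum, Real.exp_sum, ENNReal.ofReal_mul (by positivity),
    ENNReal.ofReal_prod_of_nonneg (fun _ _ => (Real.exp_pos _).le),
    ENNReal.ofReal_prod_of_nonneg (fun _ _ => (Real.exp_pos _).le), Fin.prod_univ_two,
    mul_mul_mul_comm, ← Finset.prod_mul_distrib, ← Finset.prod_mul_distrib]
  congr 1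
  · exact Finset.prod_congr rfl fun i _ => gaussianDensity_one_mul_exp hV _ _
  · exact Finset.prod_congr rfl fun i _ => gaussianDensity_one_mul_exp hv _ _

/-- Change of measure to the auxiliary law. -/
theorem lintegral_mul_exp_logRatio (c : FeedbackCode N M) (gd gc : ℂ) {V v : ℝ} (hV : 0 < V)
    (hv : 0 < v) (α β : ℂ) (w : (k : Fin 2) → Fin (M k)) (F : (Fin 2 → Fin N → ℂ) → ℝ≥0∞)
    (hF : Measurable F) :
    ∫⁻ z, F (fun k i => c.output gd gc w z i k) *
        ENNReal.ofReal (Real.exp (-c.logRatio gd gc V v α β (w, z))) ∂(noiseLaw N)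
      = ∫⁻ y, F y * c.auxDensity V v α β (w 0) y := by
  have hout : Measurable fun z : Fin 2 → Fin N → ℂ => fun k i => c.output gd gc w z i k :=
    measurable_pi_lambda _ fun k => measurable_pi_lambda _ fun i =>
      measurable_output_right c gd gc w _ i rfl k
  have hL : Measurable fun z => c.logRatio gd gc V v α β (w, z) :=
    (c.measurable_logRatio gd gc V v α β).comp measurable_prodMk_left
  have hG : Measurable fun z => F (fun k i => c.output gd gc w z i k) *
      ENNReal.ofReal (Real.exp (-c.logRatio gd gc V v α β (w, z))) :=
    (hF.comp hout).mul (by fun_prop)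
  rw [noiseLaw_eq_withDensity, lintegral_withDensity_eq_lintegral_mul _ (by fun_prop) hG,
    ← c.lintegral_comp_output gd gc w (fun y => F y * c.auxDensity V v α β (w 0) y)
      (hF.mul (c.measurable_auxDensity V v α β (w 0)))]
  refine lintegral_congr fun z => ?_
  simp only [Pi.mul_apply, ← c.prod_density_mul_exp_logRatio gd gc hV hv]
  ring

/-- The event that both receivers decode correctly. -/
def correctSet (c : FeedbackCode N M) (gd gc : ℂ) :
    Set (((k : Fin 2) → Fin (M k)) × (Fin 2 → Fin N → ℂ)) :=
  {p | ∀ k, c.dec k (fun i => c.output gd gc p.1 p.2 i k) = p.1 k}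

theorem measurableSet_correctSet (c : FeedbackCode N M) (gd gc : ℂ) :
    MeasurableSet (c.correctSet gd gc) := by
  have : c.correctSet gd gc
      = ⋂ k, {p | c.dec k (fun i => c.output gd gc p.1 p.2 i k) = p.1 k} := by
    ext; simp [correctSet]
  rw [this]
  refine MeasurableSet.iInter fun k => measurableSet_eq_fun ?_ (by fun_prop)
  exact (c.measurable_dec k).comp (by fun_prop)

theorem isProbabilityMeasure_law (N : ℕ) {M : Fin 2 → ℕ} (hM : ∀ k, 0 < M k) :
    IsProbabilityMeasure (law N M) := by
  have : ∀ k, Nonempty (Fin (M k)) := fun k => ⟨⟨0, hM k⟩⟩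
  unfold law
  infer_instance

theorem lintegral_law (f : ((k : Fin 2) → Fin (M k)) × (Fin 2 → Fin N → ℂ) → ℝ≥0∞)
    (hf : Measurable f) :
    ∫⁻ p, f p ∂(law N M)
      = ((M 0 : ℝ≥0∞) * M 1)⁻¹ * ∑ w, ∫⁻ z, f (w, z) ∂(noiseLaw N) := by
  unfold law
  rw [lintegral_prod _ hf.aemeasurable, lintegral_uniformOn_univ]
  simp [Fin.prod_univ_two]

-- After the change of measure, the constant 1 contributes the total mass of the auxiliary law. The
-- other term contributes `M 0 * M 1` times the auxiliary probability of correct decoding, which is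
-- again 1: summing over `w 1` uses that the density ignores `w 1`, and then summing over `w 0` uses
-- that the marginal of `y 0` ignores `w 0`.
open Classical in
theorem lintegral_exp_neg_logRatio_le (c : FeedbackCode N M) (gd gc : ℂ) {V v : ℝ} (hV : 0 < V)
    (hv : 0 < v) (α β : ℂ) (hM : ∀ k, 0 < M k) :
    ∫⁻ p, (1 + (M 0 : ℝ≥0∞) * M 1 * (c.correctSet gd gc).indicator 1 p) *
      ENNReal.ofReal (Real.exp (-c.logRatio gd gc V v α β p)) ∂(law N M) = 2 := by
  have hL := c.measurable_logRatio gd gc V v α β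
  have hI : Measurable ((c.correctSet gd gc).indicator (1 : (((k : Fin 2) → Fin (M k)) × (Fin 2 → Fin N → ℂ)) → ℝ≥0∞)) :=
    measurable_one.indicator (c.measurableSet_correctSet gd gc)
  rw [lintegral_law _ (by fun_prop)]
  set K : ℝ≥0∞ := (M 0 : ℝ≥0∞) * M 1 with hK
  have hK0 : K ≠ 0 := by
    have := hM 0; have := hM 1
    simp only [hK, ne_eq, mul_eq_zero, Nat.cast_eq_zero]; omega
  have hKt : K ≠ ∞ := by rw [hK]; exact ENNReal.mul_ne_top (by simp) (by simp)
  let A : (k : Fin 2) → Fin (M k) → (Fin N → ℂ) → ℝ≥0∞ := fun k w y => if c.dec k y = w then 1 else 0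
  have hA : ∀ k w, Measurable (A k w) := fun k w =>
    Measurable.ite ((c.measurable_dec k) (measurableSet_singleton w)) measurable_const measurable_const
  have hA' : ∀ (k : Fin 2) (w : Fin (M k)), Measurable fun y : Fin 2 → Fin N → ℂ => A k w (y k) :=
    fun k w => (hA k w).comp (measurable_pi_apply k)
  have hsum : ∀ k y, ∑ w, A k w y = 1 := fun k y => by simp [A]
  have h1 : ∀ w, ∫⁻ z, (1 + K * (c.correctSet gd gc).indicator 1 (w, z)) *
      ENNReal.ofReal (Real.exp (-c.logRatio gd gc V v α β (w, z))) ∂(noiseLaw N)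
      = ∫⁻ y, (1 + K * (A 0 (w 0) (y 0) * A 1 (w 1) (y 1))) * c.auxDensity V v α β (w 0) y := by
    intro w
    have hF : Measurable fun y : Fin 2 → Fin N → ℂ => 1 + K * (A 0 (w 0) (y 0) * A 1 (w 1) (y 1)) :=
      (((hA' 0 (w 0)).mul (hA' 1 (w 1))).const_mul K).const_add 1
    rw [← c.lintegral_mul_exp_logRatio gd gc hV hv α β w _ hF]
    refine lintegral_congr fun z => ?_
    congr 3
    simp only [correctSet, Set.indicator_apply, Set.mem_ofPred_eq, Fin.forall_fin_two, A]
    by_cases h0 : c.dec 0 (fun i => c.output gd gc w z i 0) = w 0 <;>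
      by_cases h1 : c.dec 1 (fun i => c.output gd gc w z i 1) = w 1 <;> simp [h0, h1]
  simp_rw [h1]
  have hq := fun w => c.measurable_auxDensity V v α β w
  have hAq : ∀ w0 w1, Measurable fun y : Fin 2 → Fin N → ℂ =>
      A 0 w0 (y 0) * A 1 w1 (y 1) * c.auxDensity V v α β w0 y := fun w0 w1 =>
    ((hA' 0 w0).mul (hA' 1 w1)).mul (hq _)
  have hone : ∫⁻ y : Fin N → ℂ, ∏ i, gaussianDensity V (y i) = 1 := by
    have := lintegral_pi_prod (fun _ : Fin N => (volume : Measure ℂ))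
      (fun i t => gaussianDensity V t) (fun i => by fun_prop)
    rw [volume_pi, this]
    simp [lintegral_gaussianDensity hV]
  have h2 : ∀ w : (k : Fin 2) → Fin (M k),
      ∫⁻ y, (1 + K * (A 0 (w 0) (y 0) * A 1 (w 1) (y 1))) * c.auxDensity V v α β (w 0) y
      = 1 + K * ∫⁻ y, (A 0 (w 0) (y 0) * A 1 (w 1) (y 1)) * c.auxDensity V v α β (w 0) y := by
    intro w
    simp_rw [add_mul, one_mul, mul_assoc K]
    rw [lintegral_add_left (hq _), lintegral_const_mul _ (hAq _ _)]
    have := c.lintegral_auxDensity (V := V) hv α β (w 0) 1 measurable_one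
    simp only [Pi.one_apply, one_mul] at this
    rw [this, hone]
  simp_rw [h2]
  rw [Finset.sum_add_distrib, ← Finset.mul_sum]
  have h3 : ∑ w : (k : Fin 2) → Fin (M k),
      ∫⁻ y, (A 0 (w 0) (y 0) * A 1 (w 1) (y 1)) * c.auxDensity V v α β (w 0) y = 1 := by
    rw [← (piFinTwoEquiv fun k => Fin (M k)).symm.sum_comp, Fintype.sum_prod_type]
    have : ∀ w0 : Fin (M 0), ∑ w1 : Fin (M 1), ∫⁻ y, (A 0 w0 (y 0) * A 1 w1 (y 1)) *
        c.auxDensity V v α β w0 y = ∫⁻ y : Fin N → ℂ, A 0 w0 y * ∏ i, gaussianDensity V (y i) := by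
      intro w0
      rw [← lintegral_finsetSum _ fun w1 _ => hAq w0 w1,
        ← c.lintegral_auxDensity (V := V) hv α β w0 _ (hA 0 w0)]
      refine lintegral_congr fun y => ?_
      rw [← Finset.sum_mul, ← Finset.mul_sum, hsum, mul_one]
    refine (Finset.sum_congr rfl fun w0 _ => this w0).trans ?_
    have hg : Measurable fun y : Fin N → ℂ => ∏ i, gaussianDensity V (y i) := by fun_prop
    have hAg : ∀ w0, Measurable fun y : Fin N → ℂ => A 0 w0 y * ∏ i, gaussianDensity V (y i) :=
      fun w0 => (hA 0 w0).mul hg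
    rw [← lintegral_finsetSum _ fun w0 _ => hAg w0, ← hone]
    refine lintegral_congr fun y => ?_
    rw [← Finset.sum_mul, hsum, one_mul]
  rw [h3, mul_one]
  have hc : (∑ _w : (k : Fin 2) → Fin (M k), (1 : ℝ≥0∞)) = K := by
    simp [Fin.prod_univ_two, hK]
  rw [hc, ← two_mul, mul_comm 2 K, ← mul_assoc, ENNReal.inv_mul_cancel hK0 hKt, one_mul]

/-- The data processing inequality for the event of correct decoding. -/
theorem prob_correct_mul_log_le (c : FeedbackCode N M) (gd gc : ℂ) {V v : ℝ} (hV : 0 < V)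
    (hv : 0 < v) (α β : ℂ) (hM : ∀ k, 0 < M k)
    (hint : Integrable (c.logRatio gd gc V v α β) (law N M)) :
    (law N M).real (c.correctSet gd gc) * Real.log ((M 0 : ℝ) * M 1)
      ≤ ∫ p, c.logRatio gd gc V v α β p ∂(law N M) + Real.log 2 := by
  have := isProbabilityMeasure_law N hM
  have hA := c.measurableSet_correctSet gd gc
  have hL := c.measurable_logRatio gd gc V v α β
  set A := c.correctSet gd gc
  set L := c.logRatio gd gc V v α β
  set K : ℝ := (M 0 : ℝ) * M 1 with hK
  have hK1 : 1 ≤ K := by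
    have h0 : (1 : ℝ) ≤ M 0 := by exact_mod_cast hM 0
    have h1 : (1 : ℝ) ≤ M 1 := by exact_mod_cast hM 1
    nlinarith
  -- The summand 1 keeps the logarithm of this weight finite where decoding fails. It doubles the
  -- total mass, and this is the source of the term `log 2`.
  set g : (((k : Fin 2) → Fin (M k)) × (Fin 2 → Fin N → ℂ)) → ℝ := fun p => (1 + K * A.indicator 1 p) * Real.exp (-L p) with hg
  have hind : Measurable (A.indicator (1 : (((k : Fin 2) → Fin (M k)) × (Fin 2 → Fin N → ℂ)) → ℝ)) := measurable_one.indicator hA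
  have hind0 : ∀ p, 0 ≤ A.indicator (1 : (((k : Fin 2) → Fin (M k)) × (Fin 2 → Fin N → ℂ)) → ℝ) p := fun p =>
    Set.indicator_nonneg (fun _ _ => zero_le_one) p
  have hg0 : ∀ p, 0 ≤ g p := fun p => by
    have := hind0 p
    positivity
  have hgm : Measurable g := by fun_prop
  have hgl : ∫⁻ p, ENNReal.ofReal (g p) ∂(law N M) = 2 := by
    rw [← c.lintegral_exp_neg_logRatio_le gd gc hV hv α β hM]
    refine lintegral_congr fun p => ?_
    have := hind0 p
    rw [hg, ENNReal.ofReal_mul (by positivity), ENNReal.ofReal_add zero_le_one (by positivity),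
      ENNReal.ofReal_mul (by positivity)]
    congr 3
    · simp
    · rw [hK, ENNReal.ofReal_mul (by positivity)]; simp
    · by_cases hp : p ∈ A <;> simp [hp, A]
  have hgi : Integrable g (law N M) :=
    ⟨hgm.aestronglyMeasurable, by
      rw [hasFiniteIntegral_iff_ofReal (Eventually.of_forall hg0), hgl]; simp⟩
  have hgI : ∫ p, g p ∂(law N M) = 2 := by
    rw [integral_eq_lintegral_of_nonneg_ae (Eventually.of_forall hg0) hgm.aestronglyMeasurable, hgl]
    simp
  -- This is `log x ≤ x - 1` at `x = g p / 2`, whose mean is 1.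
  have hpt : ∀ p, A.indicator (fun _ => Real.log K) p - L p ≤ g p / 2 - 1 + Real.log 2 := by
    intro p
    have h1 : A.indicator (fun _ => Real.log K) p ≤ Real.log (1 + K * A.indicator 1 p) := by
      by_cases hp : p ∈ A
      · simp only [hp, Set.indicator_of_mem, Pi.one_apply, mul_one]
        exact Real.log_le_log (by linarith) (by linarith)
      · simp [hp]
    have h0 : 0 < 1 + K * A.indicator (1 : (((k : Fin 2) → Fin (M k)) × (Fin 2 → Fin N → ℂ)) → ℝ) p := by
      have := hind0 p; positivity
    have h2 : Real.log (g p / 2) ≤ g p / 2 - 1 := Real.log_le_sub_one_of_pos (by positivity)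
    have h3 : Real.log (g p / 2) = Real.log (1 + K * A.indicator 1 p) - L p - Real.log 2 := by
      rw [hg]
      rw [Real.log_div (by positivity) (by norm_num), Real.log_mul h0.ne' (Real.exp_pos _).ne',
        Real.log_exp]
      ring
    linarith
  have hint1 : Integrable (A.indicator fun _ => Real.log K) (law N M) :=
    (integrable_const _).indicator hA
  have hmono := integral_mono (hint1.sub hint) (((hgi.div_const 2).sub (integrable_const 1)).add
    (integrable_const (Real.log 2))) hpt
  simp only [Pi.sub_apply, Pi.add_apply] at hmono
  rw [integral_sub hint1 hint, integral_indicator_const _ hA] at hmono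
  have e : ∫ p, (g p / 2 - 1 + Real.log 2) ∂(law N M) = Real.log 2 := by
    have hi : Integrable (fun p => g p / 2 - 1) (law N M) := (hgi.div_const 2).sub (integrable_const 1)
    rw [integral_add hi (integrable_const _),
      integral_sub (hgi.div_const 2) (integrable_const 1), integral_div, hgI]
    simp
  rw [e, smul_eq_mul] at hmono
  linarith

end FeedbackCode

/-! ### Converse: second moments under the true law. -/

namespace FeedbackCode

variable {N : ℕ} {M : Fin 2 → ℕ}

/-- Changing the sign of one noise component. -/
def flip (k : Fin 2) (i : Fin N) (p : ((k : Fin 2) → Fin (M k)) × (Fin 2 → Fin N → ℂ)) :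
    ((k : Fin 2) → Fin (M k)) × (Fin 2 → Fin N → ℂ) :=
  (p.1, fun k' i' => if k' = k ∧ i' = i then -p.2 k' i' else p.2 k' i')

theorem measurePreserving_flip (hM : ∀ k, 0 < M k) (k : Fin 2) (i : Fin N) :
    MeasurePreserving (flip k i) (law N M) (law N M) := by
  have : ∀ k, Nonempty (Fin (M k)) := fun k => ⟨⟨0, hM k⟩⟩
  refine (MeasurePreserving.id _).prod (measurePreserving_pi _ _ (f := fun k' (z : Fin N → ℂ) i' =>
    if k' = k ∧ i' = i then -z i' else z i') fun k' => ?_)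
  refine measurePreserving_pi _ _ (f := fun i' (z : ℂ) => if k' = k ∧ i' = i then -z else z)
    fun i' => ?_
  by_cases h : k' = k ∧ i' = i
  · simp only [h]
    exact measurePreserving_neg_stdComplexGaussian
  · simp only [h, if_false]
    exact MeasurePreserving.id _

theorem input_flip (c : FeedbackCode N M) (gd gc : ℂ) (k k' : Fin 2) (i : Fin N)
    (p : ((k : Fin 2) → Fin (M k)) × (Fin 2 → Fin N → ℂ)) :
    c.input gd gc (flip k i p).1 (flip k i p).2 k' i = c.input gd gc p.1 p.2 k' i := by
  refine input_congr c gd gc p.1 _ _ i (fun l j hj => ?_) k'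
  simp [flip, hj.ne]

theorem measurePreserving_noise (hM : ∀ k, 0 < M k) (k : Fin 2) (i : Fin N) :
    MeasurePreserving (fun p : ((k : Fin 2) → Fin (M k)) × (Fin 2 → Fin N → ℂ) => p.2 k i)
      (law N M) stdComplexGaussian := by
  have : ∀ k, Nonempty (Fin (M k)) := fun k => ⟨⟨0, hM k⟩⟩
  exact (measurePreserving_eval (fun _ : Fin N => stdComplexGaussian) i).comp
    ((measurePreserving_eval (fun _ : Fin 2 => Measure.pi fun _ : Fin N => stdComplexGaussian) k).comp
      measurePreserving_snd)

theorem memLp_noise (hM : ∀ k, 0 < M k) (k : Fin 2) (i : Fin N) :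
    MemLp (fun p : ((k : Fin 2) → Fin (M k)) × (Fin 2 → Fin N → ℂ) => p.2 k i) 2 (law N M) :=
  (memLp_stdComplexGaussian 2 (by simp)).comp_measurePreserving (measurePreserving_noise hM k i)

theorem integral_norm_sq_noise (hM : ∀ k, 0 < M k) (k : Fin 2) (i : Fin N) :
    ∫ p, ‖p.2 k i‖ ^ 2 ∂(law N M) = 1 := by
  have h := measurePreserving_noise hM k i
  rw [← integral_norm_sq_stdComplexGaussian, ← h.map_eq, integral_map h.measurable.aemeasurable]
  exact (by fun_prop : Measurable fun z : ℂ => ‖z‖ ^ 2).aestronglyMeasurable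

/-- A noise component is orthogonal to whatever does not depend on its sign. -/
theorem integral_norm_sq_add_noise (hM : ∀ k, 0 < M k) (k : Fin 2) (i : Fin N)
    {A : ((k : Fin 2) → Fin (M k)) × (Fin 2 → Fin N → ℂ) → ℂ} (hA : MemLp A 2 (law N M))
    (hAm : Measurable A) (hAf : ∀ p, A (flip k i p) = A p) (ζ : ℂ) :
    ∫ p, ‖A p + ζ * p.2 k i‖ ^ 2 ∂(law N M) = ∫ p, ‖A p‖ ^ 2 ∂(law N M) + ‖ζ‖ ^ 2 := by
  have hZ := memLp_noise (M := M) hM k i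
  have hf := measurePreserving_flip (M := M) hM k i
  -- Flipping the sign of the noise preserves the law, so the sum and the difference have equal
  -- second moments, and the parallelogram law gives their common value.
  have h1 : ∫ p, ‖A p - ζ * p.2 k i‖ ^ 2 ∂(law N M) = ∫ p, ‖A p + ζ * p.2 k i‖ ^ 2 ∂(law N M) := by
    have hm : AEStronglyMeasurable (fun p => ‖A p + ζ * p.2 k i‖ ^ 2) (law N M) := by
      refine Measurable.aestronglyMeasurable ?_
      fun_prop
    conv_rhs => rw [← hf.map_eq]
    rw [integral_map hf.measurable.aemeasurable (by rwa [hf.map_eq])]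
    refine integral_congr_ae (Eventually.of_forall fun p => ?_)
    simp only [hAf]
    simp [flip, sub_eq_add_neg]
  have hi1 : Integrable (fun p => ‖A p + ζ * p.2 k i‖ ^ 2) (law N M) :=
    (hA.add (hZ.const_mul ζ)).integrable_norm_pow (by norm_num)
  have hi2 : Integrable (fun p => ‖A p - ζ * p.2 k i‖ ^ 2) (law N M) :=
    (hA.sub (hZ.const_mul ζ)).integrable_norm_pow (by norm_num)
  have hiA : Integrable (fun p => ‖A p‖ ^ 2) (law N M) := hA.integrable_norm_pow (by norm_num)
  have hiZ : Integrable (fun p : ((k : Fin 2) → Fin (M k)) × (Fin 2 → Fin N → ℂ) => ‖p.2 k i‖ ^ 2)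
      (law N M) := hZ.integrable_norm_pow (by norm_num)
  have h2 : ∫ p, ‖A p + ζ * p.2 k i‖ ^ 2 ∂(law N M) + ∫ p, ‖A p - ζ * p.2 k i‖ ^ 2 ∂(law N M)
      = 2 * (∫ p, ‖A p‖ ^ 2 ∂(law N M) + ‖ζ‖ ^ 2 * ∫ p, ‖p.2 k i‖ ^ 2 ∂(law N M)) := by
    rw [← integral_add hi1 hi2, ← integral_const_mul, ← integral_add hiA (hiZ.const_mul _),
      ← integral_const_mul]
    refine integral_congr_ae (Eventually.of_forall fun p => ?_)
    have := parallelogram_law_with_norm ℝ (A p) (ζ * p.2 k i)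
    rw [norm_mul] at this
    simp only
    nlinarith
  rw [integral_norm_sq_noise hM] at h2
  linarith

theorem memLp_input (c : FeedbackCode N M) (gd gc : ℂ) (hP : c.PowerConstraint gd gc)
    (k : Fin 2) (i : Fin N) :
    MemLp (fun p : ((k : Fin 2) → Fin (M k)) × (Fin 2 → Fin N → ℂ) => c.input gd gc p.1 p.2 k i)
      2 (law N M) := by
  refine ⟨(c.measurable_input gd gc k i).aestronglyMeasurable, ?_⟩
  rw [eLpNorm_lt_top_iff_lintegral_rpow_enorm_lt_top (by norm_num) (by norm_num)]
  have h := (Finset.single_le_sum (fun _ _ => zero_le) (Finset.mem_univ i)).trans (hP k)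
  simp only [ENNReal.toReal_ofNat, ENNReal.rpow_ofNat]
  exact h.trans_lt (by simp)

theorem sum_integral_norm_sq_input_le (c : FeedbackCode N M) (gd gc : ℂ)
    (hP : c.PowerConstraint gd gc) (k : Fin 2) :
    ∑ i, ∫ p, ‖c.input gd gc p.1 p.2 k i‖ ^ 2 ∂(law N M) ≤ N := by
  have h := hP k
  have e : ∀ i, ∫⁻ p, ‖c.input gd gc p.1 p.2 k i‖ₑ ^ 2 ∂(law N M)
      = ENNReal.ofReal (∫ p, ‖c.input gd gc p.1 p.2 k i‖ ^ 2 ∂(law N M)) := by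
    intro i
    rw [ofReal_integral_eq_lintegral_ofReal
      ((c.memLp_input gd gc hP k i).integrable_norm_pow (by norm_num))
      (Eventually.of_forall fun p => by positivity)]
    refine lintegral_congr fun p => ?_
    rw [ENNReal.ofReal_pow (norm_nonneg _), ofReal_norm]
  simp_rw [e] at h
  rw [← ENNReal.ofReal_sum_of_nonneg (fun i _ => integral_nonneg fun p => by positivity)] at h
  rw [← ENNReal.ofReal_natCast] at h
  exact (ENNReal.ofReal_le_ofReal_iff (by positivity)).mp h

theorem integral_norm_sq_comb {Ω : Type*} [MeasurableSpace Ω] {μ : Measure Ω} {X Y : Ω → ℂ}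
    (hX : MemLp X 2 μ) (hY : MemLp Y 2 μ) (α β : ℂ) :
    ∫ p, ‖α * X p + β * Y p‖ ^ 2 ∂μ = ‖α‖ ^ 2 * ∫ p, ‖X p‖ ^ 2 ∂μ + ‖β‖ ^ 2 * ∫ p, ‖Y p‖ ^ 2 ∂μ
      + 2 * (α * (starRingEnd ℂ) β * ∫ p, X p * (starRingEnd ℂ) (Y p) ∂μ).re := by
  have hi : Integrable (fun p => X p * (starRingEnd ℂ) (Y p)) μ := by
    have := hX.integrable_mul (q := 2) (hY.star)
    exact this
  rw [← integral_const_mul, ← integral_const_mul, ← integral_const_mul]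
  have h1 := (hX.integrable_norm_pow (by norm_num : (2:ℕ) ≠ 0)).const_mul (‖α‖ ^ 2)
  have h2 := (hY.integrable_norm_pow (by norm_num : (2:ℕ) ≠ 0)).const_mul (‖β‖ ^ 2)
  have h3 := hi.const_mul (α * (starRingEnd ℂ) β)
  have e : (∫ p, α * (starRingEnd ℂ) β * (X p * (starRingEnd ℂ) (Y p)) ∂μ).re
      = ∫ p, (α * (starRingEnd ℂ) β * (X p * (starRingEnd ℂ) (Y p))).re ∂μ :=
    (integral_re h3).symm
  have h12 : Integrable (fun p => ‖α‖ ^ 2 * ‖X p‖ ^ 2 + ‖β‖ ^ 2 * ‖Y p‖ ^ 2) μ := h1.add h2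
  have h3' : Integrable (fun p => 2 * (α * (starRingEnd ℂ) β * (X p * (starRingEnd ℂ) (Y p))).re) μ :=
    h3.re.const_mul 2
  rw [e, ← integral_const_mul, ← integral_add h1 h2, ← integral_add h12 h3']
  refine integral_congr_ae (Eventually.of_forall fun p => ?_)
  simp only [← Complex.normSq_eq_norm_sq, Complex.normSq_add, map_mul]
  congr 3
  ring

end FeedbackCode

namespace FeedbackCode

variable {N : ℕ} {M : Fin 2 → ℕ}

theorem memLp_output (c : FeedbackCode N M) (gd gc : ℂ) (hM : ∀ k, 0 < M k)
    (hP : c.PowerConstraint gd gc) (k : Fin 2) (i : Fin N) :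
    MemLp (fun p : ((k : Fin 2) → Fin (M k)) × (Fin 2 → Fin N → ℂ) => c.output gd gc p.1 p.2 i k)
      2 (law N M) := by
  simp_rw [output_eq]
  exact (((c.memLp_input gd gc hP k i).const_mul gd).add
    ((c.memLp_input gd gc hP (other k) i).const_mul gc)).add (memLp_noise hM k i)

theorem memLp_residual (c : FeedbackCode N M) (gd gc α β : ℂ) (hM : ∀ k, 0 < M k)
    (hP : c.PowerConstraint gd gc) (i : Fin N) :
    MemLp (fun p : ((k : Fin 2) → Fin (M k)) × (Fin 2 → Fin N → ℂ) =>
      c.output gd gc p.1 p.2 i 1 - (α * c.input gd gc p.1 p.2 0 i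
      + β * c.output gd gc p.1 p.2 i 0)) 2 (law N M) :=
  (c.memLp_output gd gc hM hP 1 i).sub (((c.memLp_input gd gc hP 0 i).const_mul α).add
    ((c.memLp_output gd gc hM hP 0 i).const_mul β))

theorem integrable_likelihood {Ω : Type*} [MeasurableSpace Ω] {μ : Measure Ω} [IsFiniteMeasure μ]
    {Y Z : Ω → ℂ} (hY : MemLp Y 2 μ) (hZ : MemLp Z 2 μ) (V : ℝ) :
    Integrable (fun p => Real.log V + ‖Y p‖ ^ 2 / V - ‖Z p‖ ^ 2) μ :=
  ((integrable_const _).add ((hY.integrable_norm_pow (by norm_num : (2:ℕ) ≠ 0)).div_const V)).sub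
    (hZ.integrable_norm_pow (by norm_num : (2:ℕ) ≠ 0))

theorem integral_likelihood {Ω : Type*} [MeasurableSpace Ω] {μ : Measure Ω} [IsProbabilityMeasure μ]
    {Y Z : Ω → ℂ} (hY : MemLp Y 2 μ) (hZ : MemLp Z 2 μ) (V : ℝ) :
    ∫ p, (Real.log V + ‖Y p‖ ^ 2 / V - ‖Z p‖ ^ 2) ∂μ
      = Real.log V + (∫ p, ‖Y p‖ ^ 2 ∂μ) / V - ∫ p, ‖Z p‖ ^ 2 ∂μ := by
  have h1 : Integrable (fun p => Real.log V + ‖Y p‖ ^ 2 / V) μ :=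
    (integrable_const _).add ((hY.integrable_norm_pow (by norm_num : (2:ℕ) ≠ 0)).div_const V)
  rw [integral_sub h1 (hZ.integrable_norm_pow (by norm_num : (2:ℕ) ≠ 0)),
    integral_add (integrable_const _) ((hY.integrable_norm_pow (by norm_num : (2:ℕ) ≠ 0)).div_const V),
    integral_div]
  simp

theorem integrable_logRatio (c : FeedbackCode N M) (gd gc : ℂ) (V v : ℝ) (α β : ℂ)
    (hM : ∀ k, 0 < M k) (hP : c.PowerConstraint gd gc) :
    Integrable (c.logRatio gd gc V v α β) (law N M) := by
  have := isProbabilityMeasure_law N hM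
  exact integrable_finsetSum _ fun i _ =>
    (integrable_likelihood (c.memLp_output gd gc hM hP 0 i) (memLp_noise hM 0 i) V).add
    (integrable_likelihood (c.memLp_residual gd gc α β hM hP i) (memLp_noise hM 1 i) v)

/-- The noise at time `i` is orthogonal to the inputs at time `i`. In the residual, receiver 0's
noise enters with coefficient `-β` and receiver 1's with coefficient 1, whence the terms `‖β‖ ^ 2 +
1`. -/
theorem integral_logRatio (c : FeedbackCode N M) (gd gc : ℂ) (V v : ℝ) (α β : ℂ)
    (hM : ∀ k, 0 < M k) (hP : c.PowerConstraint gd gc) :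
    ∫ p, c.logRatio gd gc V v α β p ∂(law N M) = ∑ i, (
      (Real.log V + (∫ p, ‖gd * c.input gd gc p.1 p.2 0 i + gc * c.input gd gc p.1 p.2 1 i‖ ^ 2
        ∂(law N M) + 1) / V - 1) +
      (Real.log v + (∫ p, ‖(gc - α - β * gd) * c.input gd gc p.1 p.2 0 i
        + (gd - β * gc) * c.input gd gc p.1 p.2 1 i‖ ^ 2 ∂(law N M) + ‖β‖ ^ 2 + 1) / v - 1)) := by
  have := isProbabilityMeasure_law N hM
  have e : ∫ p, c.logRatio gd gc V v α β p ∂(law N M) = ∑ i, ∫ p,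
    ((Real.log V + ‖c.output gd gc p.1 p.2 i 0‖ ^ 2 / V - ‖p.2 0 i‖ ^ 2) +
    (Real.log v + ‖c.output gd gc p.1 p.2 i 1 - (α * c.input gd gc p.1 p.2 0 i
      + β * c.output gd gc p.1 p.2 i 0)‖ ^ 2 / v - ‖p.2 1 i‖ ^ 2)) ∂(law N M) :=
    integral_finsetSum _ fun i _ =>
    (integrable_likelihood (c.memLp_output gd gc hM hP 0 i) (memLp_noise hM 0 i) V).add
    (integrable_likelihood (c.memLp_residual gd gc α β hM hP i) (memLp_noise hM 1 i) v)
  rw [e]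
  refine Finset.sum_congr rfl fun i _ => ?_
  rw [integral_add
    (integrable_likelihood (c.memLp_output gd gc hM hP 0 i) (memLp_noise hM 0 i) V)
    (integrable_likelihood (c.memLp_residual gd gc α β hM hP i) (memLp_noise hM 1 i) v),
    integral_likelihood (c.memLp_output gd gc hM hP 0 i) (memLp_noise hM 0 i) V,
    integral_likelihood (c.memLp_residual gd gc α β hM hP i) (memLp_noise hM 1 i) v,
    integral_norm_sq_noise hM, integral_norm_sq_noise hM]
  have h0 := c.memLp_input gd gc hP 0 i
  have h1 := c.memLp_input gd gc hP 1 i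
  have o0 : other 0 = 1 := rfl
  have o1 : other 1 = 0 := rfl
  have e1 : ∫ p, ‖c.output gd gc p.1 p.2 i 0‖ ^ 2 ∂(law N M)
      = ∫ p, ‖gd * c.input gd gc p.1 p.2 0 i + gc * c.input gd gc p.1 p.2 1 i‖ ^ 2 ∂(law N M) + 1 := by
    have := integral_norm_sq_add_noise (M := M) hM 0 i ((h0.const_mul gd).add (h1.const_mul gc))
      (by fun_prop) (fun p => by simp only [Pi.add_apply, input_flip]) 1
    simpa only [output_eq, o0, one_mul, norm_one, one_pow, Pi.add_apply] using this
  have e2 : ∫ p, ‖c.output gd gc p.1 p.2 i 1 - (α * c.input gd gc p.1 p.2 0 i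
      + β * c.output gd gc p.1 p.2 i 0)‖ ^ 2 ∂(law N M)
      = ∫ p, ‖(gc - α - β * gd) * c.input gd gc p.1 p.2 0 i
        + (gd - β * gc) * c.input gd gc p.1 p.2 1 i‖ ^ 2 ∂(law N M) + ‖β‖ ^ 2 + 1 := by
    have hA := (h0.const_mul (gc - α - β * gd)).add (h1.const_mul (gd - β * gc))
    have h2 := integral_norm_sq_add_noise (M := M) hM 0 i hA
      (by fun_prop) (fun p => by simp only [Pi.add_apply, input_flip]) (-β)
    have h3 := integral_norm_sq_add_noise (M := M) hM 1 i (hA.add ((memLp_noise hM 0 i).const_mul (-β)))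
      (by fun_prop) (fun p => by simp only [Pi.add_apply, input_flip]; simp [flip]) 1
    simp only [Pi.add_apply, norm_neg, one_mul, norm_one, one_pow] at h2 h3
    rw [h2] at h3
    rw [← h3]
    refine integral_congr_ae (Eventually.of_forall fun p => ?_)
    simp only [output_eq, o0, o1]
    congr 2
    ring
  rw [e1, e2]

/-- The sum-rate bound for a single code. -/
theorem prob_correct_mul_log_le_outerFun (c : FeedbackCode N M) (gd gc : ℂ) (hN : 0 < N)
    (hM : ∀ k, 0 < M k) (hP : c.PowerConstraint gd gc) :
    ∃ r ∈ Icc (0 : ℝ) 1, (law N M).real (c.correctSet gd gc) * Real.log ((M 0 : ℝ) * M 1)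
      ≤ N * (Real.log 2 * outerFun (‖gd‖ ^ 2) (‖gc‖ ^ 2) r) + Real.log 2 := by
  have := isProbabilityMeasure_law N hM
  have hN' : (0 : ℝ) < N := by exact_mod_cast hN
  set P0 := (∑ i, ∫ p, ‖c.input gd gc p.1 p.2 0 i‖ ^ 2 ∂(law N M)) / N with hP0
  set P1 := (∑ i, ∫ p, ‖c.input gd gc p.1 p.2 1 i‖ ^ 2 ∂(law N M)) / N with hP1
  -- The correlation of the two inputs, averaged over time. Only averages matter, since `V`, `v`,
  -- `α`, `β` are the same at all times.
  set ρ : ℂ := (∑ i, ∫ p, c.input gd gc p.1 p.2 0 i *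
    (starRingEnd ℂ) (c.input gd gc p.1 p.2 1 i) ∂(law N M)) / (N : ℂ) with hρ
  have hP0' : P0 ≤ 1 := (div_le_one hN').mpr (c.sum_integral_norm_sq_input_le gd gc hP 0)
  have hP1' : P1 ≤ 1 := (div_le_one hN').mpr (c.sum_integral_norm_sq_input_le gd gc hP 1)
  have hm : ∀ α β : ℂ, ∑ i, ∫ p, ‖α * c.input gd gc p.1 p.2 0 i + β * c.input gd gc p.1 p.2 1 i‖ ^ 2
      ∂(law N M) = N * (‖α‖ ^ 2 * P0 + ‖β‖ ^ 2 * P1 + 2 * (α * (starRingEnd ℂ) β * ρ).re) := by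
    intro α β
    have e : ∀ i, _ := fun i => integral_norm_sq_comb (c.memLp_input gd gc hP 0 i)
      (c.memLp_input gd gc hP 1 i) α β
    simp_rw [e]
    rw [Finset.sum_add_distrib, Finset.sum_add_distrib, ← Finset.mul_sum, ← Finset.mul_sum,
      ← Finset.mul_sum, ← Complex.re_sum, ← Finset.mul_sum]
    have h0 : (∑ i, ∫ p, ‖c.input gd gc p.1 p.2 0 i‖ ^ 2 ∂(law N M)) = N * P0 := by
      rw [hP0]; field_simp
    have h1 : (∑ i, ∫ p, ‖c.input gd gc p.1 p.2 1 i‖ ^ 2 ∂(law N M)) = N * P1 := by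
      rw [hP1]; field_simp
    have h2 : (∑ i, ∫ p, c.input gd gc p.1 p.2 0 i *
        (starRingEnd ℂ) (c.input gd gc p.1 p.2 1 i) ∂(law N M)) = ((N : ℝ) : ℂ) * ρ := by
      rw [hρ]
      have : (N : ℂ) ≠ 0 := by exact_mod_cast hN.ne'
      push_cast
      field_simp
    rw [h0, h1, h2, mul_left_comm (α * _), Complex.re_ofReal_mul]
    ring
  have hm0 : ∀ α β : ℂ, 0 ≤ ‖α‖ ^ 2 * P0 + ‖β‖ ^ 2 * P1 + 2 * (α * (starRingEnd ℂ) β * ρ).re := by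
    intro α β
    have h : 0 ≤ (N : ℝ) * _ := (hm α β) ▸ Finset.sum_nonneg fun i _ =>
      integral_nonneg fun p => by positivity
    exact nonneg_of_mul_nonneg_right h hN'
  set r := ‖ρ‖ with hr
  have hr0 : 0 ≤ r := norm_nonneg _
  have hcross : ((starRingEnd ℂ) ρ * ρ).re = r ^ 2 := by
    rw [mul_comm, Complex.mul_conj, Complex.ofReal_re, Complex.normSq_eq_norm_sq]
  -- The left-hand side is the average power of the innovation `X₁ - conj ρ * X₀`. The power
  -- constraints bound it by `1 - r ^ 2`, and its nonnegativity forces `r ≤ 1`.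
  have hq2 : r ^ 2 * P0 + P1 - 2 * r ^ 2 ≤ 1 - r ^ 2 := by nlinarith [sq_nonneg r]
  have hq1 : 0 ≤ r ^ 2 * P0 + P1 - 2 * r ^ 2 := by
    have := hm0 (-(starRingEnd ℂ) ρ) 1
    simp only [norm_neg, RCLike.norm_conj, norm_one, map_one, mul_one, neg_mul, Complex.neg_re,
      hcross] at this
    rw [← hr] at this
    linarith
  set q := 1 - r ^ 2 with hq
  have hq0 : 0 ≤ q := by linarith
  refine ⟨r, ⟨hr0, by nlinarith⟩, ?_⟩
  set S := ‖gd‖ ^ 2 with hS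
  set I := ‖gc‖ ^ 2 with hI
  have hS0 : 0 ≤ S := by positivity
  have hI0 : 0 ≤ I := by positivity
  set den := 1 + q * I with hden
  have hden0 : 0 < den := by positivity
  -- The linear MMSE coefficient for estimating an innovation of variance `q` from `gc` times it
  -- plus unit noise.
  set b : ℂ := (starRingEnd ℂ) gc * ((q / den : ℝ) : ℂ) with hb
  have hsqrt : √(S * I) = ‖gd‖ * ‖gc‖ := by
    rw [hS, hI, ← mul_pow, Real.sqrt_sq (by positivity)]
  set V := 1 + S + I + 2 * r * √(S * I) with hV
  set v := 1 + q * S / den with hv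
  have hV0 : 0 < V := by positivity
  have hv0 : 0 < v := by positivity
  set β := gd * b with hβ
  set α := gc + gd * (starRingEnd ℂ) ρ - gd * b * gd - gd * b * gc * (starRingEnd ℂ) ρ with hα
  have hbc : 1 - b * gc = ((1 / den : ℝ) : ℂ) := by
    have : b * gc = ((I * (q / den) : ℝ) : ℂ) := by
      rw [hb, mul_right_comm, mul_comm _ gc, Complex.mul_conj, Complex.normSq_eq_norm_sq, ← hI]
      push_cast; ring
    rw [this, ← Complex.ofReal_one, ← Complex.ofReal_sub]
    congr 1
    field_simp
    rw [hden]; ring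
  have hα1 : gc - α - β * gd = (gd * ((1 / den : ℝ) : ℂ)) * (-(starRingEnd ℂ) ρ) := by
    rw [← hbc, hα, hβ]; ring
  have hβ1 : gd - β * gc = (gd * ((1 / den : ℝ) : ℂ)) * 1 := by
    rw [← hbc, hβ]; ring
  have hgd : ‖gd * ((1 / den : ℝ) : ℂ)‖ ^ 2 = S / den ^ 2 := by
    rw [norm_mul, mul_pow, Complex.norm_real, Real.norm_of_nonneg (by positivity)]
    rw [← hS]; ring_nf
  have hβn : ‖β‖ ^ 2 = S * I * q ^ 2 / den ^ 2 := by
    rw [hβ, hb, norm_mul, norm_mul, Complex.norm_real, Real.norm_of_nonneg (by positivity),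
      RCLike.norm_conj, mul_pow, mul_pow, ← hS, ← hI]
    ring_nf
  have hm1 : ∑ i, ∫ p, ‖gd * c.input gd gc p.1 p.2 0 i + gc * c.input gd gc p.1 p.2 1 i‖ ^ 2
      ∂(law N M) ≤ N * (V - 1) := by
    rw [hm]
    gcongr
    have h1 : (gd * (starRingEnd ℂ) gc * ρ).re ≤ ‖gd‖ * ‖gc‖ * r := by
      refine (Complex.re_le_norm _).trans ?_
      rw [norm_mul, norm_mul, RCLike.norm_conj]
    rw [hV, hsqrt]
    nlinarith
  have hm2 : ∑ i, ∫ p, ‖(gc - α - β * gd) * c.input gd gc p.1 p.2 0 i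
      + (gd - β * gc) * c.input gd gc p.1 p.2 1 i‖ ^ 2 ∂(law N M) ≤ N * (S / den ^ 2 * q) := by
    rw [hα1, hβ1]
    simp_rw [mul_assoc (gd * ((1 / den : ℝ) : ℂ)), ← mul_add, norm_mul (gd * ((1 / den : ℝ) : ℂ)),
      mul_pow, hgd, integral_const_mul]
    rw [← Finset.mul_sum, hm, mul_left_comm]
    gcongr
    simp only [norm_neg, RCLike.norm_conj, norm_one, map_one, mul_one, neg_mul, Complex.neg_re,
      hcross]
    rw [← hr]
    linarith
  have hbound : ∫ p, c.logRatio gd gc V v α β p ∂(law N M) ≤ N * (Real.log V + Real.log v) := by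
    rw [c.integral_logRatio gd gc V v α β hM hP]
    rw [Finset.sum_add_distrib, Finset.sum_sub_distrib, Finset.sum_sub_distrib,
      Finset.sum_add_distrib, Finset.sum_add_distrib, ← Finset.sum_div, ← Finset.sum_div,
      Finset.sum_add_distrib, Finset.sum_add_distrib, Finset.sum_add_distrib]
    simp only [Finset.sum_const, Finset.card_univ, Fintype.card_fin, nsmul_eq_mul, mul_one]
    have k1 : (∑ i, ∫ p, ‖gd * c.input gd gc p.1 p.2 0 i + gc * c.input gd gc p.1 p.2 1 i‖ ^ 2
      ∂(law N M) + N) / V ≤ N := by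
      rw [div_le_iff₀ hV0]; linarith
    have k2 : (∑ i, ∫ p, ‖(gc - α - β * gd) * c.input gd gc p.1 p.2 0 i
      + (gd - β * gc) * c.input gd gc p.1 p.2 1 i‖ ^ 2 ∂(law N M) + N * ‖β‖ ^ 2 + N) / v ≤ N := by
      rw [div_le_iff₀ hv0, hβn]
      have : v = 1 + S / den ^ 2 * q + S * I * q ^ 2 / den ^ 2 := by
        rw [hv]
        field_simp
        rw [hden]; ring
      rw [this]
      linarith
    linarith
  have hfun : Real.log 2 * outerFun S I r = Real.log V + Real.log v := by
    have h2 : Real.log 2 ≠ 0 := (Real.log_pos (by norm_num)).ne'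
    unfold outerFun Real.logb
    rw [mul_add, mul_div_cancel₀ _ h2, mul_div_cancel₀ _ h2, ← hq, ← hden, ← hV, ← hv]
    ring
  have := c.prob_correct_mul_log_le gd gc hV0 hv0 α β hM (c.integrable_logRatio gd gc V v α β hM hP)
  rw [hfun]
  linarith

end FeedbackCode

/-! ### Converse: passage to the limit and to the closure. -/

theorem FeedbackCode.prob_correct_eq {N : ℕ} {M : Fin 2 → ℕ} (c : FeedbackCode N M) (gd gc : ℂ)
    (hM : ∀ k, 0 < M k) :
    (law N M).real (c.correctSet gd gc) = 1 - (c.errorProb gd gc).toReal := by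
  have := isProbabilityMeasure_law N hM
  have h : {p | ∃ k, c.dec k (fun i => c.output gd gc p.1 p.2 i k) ≠ p.1 k}
      = (c.correctSet gd gc)ᶜ := by
    ext p; simp only [correctSet, Set.mem_ofPred_eq, Set.mem_compl_iff, not_forall, ne_eq]
  unfold errorProb
  rw [h]
  have := probReal_compl_eq_one_sub (μ := law N M) (c.measurableSet_correctSet gd gc)
  rw [measureReal_def] at this
  rw [this]; ring

/-- Dividing the bound for a single code by `N * log 2` turns its term `log 2` into `1 / N`. Both
this and the error probability vanish in the limit. -/
theorem Achievable.sum_le {gd gc : ℂ} {R : Fin 2 → ℝ} (h : Achievable gd gc R) :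
    R 0 + R 1 ≤ 2 * outerBound (‖gd‖ ^ 2) (‖gc‖ ^ 2) := by
  obtain ⟨hR, M, c, hMR, hP, hlim⟩ := h
  have hM : ∀ N k, 0 < M N k := fun N k => by
    have : (0 : ℝ) < M N k := lt_of_lt_of_le (by positivity) (hMR N k)
    exact_mod_cast this
  set e : ℕ → ℝ := fun N => ((c N).errorProb gd gc).toReal with he
  have he0 : Tendsto e atTop (𝓝 0) := by
    have := (ENNReal.tendsto_toReal (a := 0) (by simp)).comp hlim
    rwa [ENNReal.toReal_zero] at this
  set B := 2 * outerBound (‖gd‖ ^ 2) (‖gc‖ ^ 2) with hB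
  have hl2 : 0 < Real.log 2 := Real.log_pos (by norm_num)
  have key : ∀ N : ℕ, 0 < N → (1 - e N) * (R 0 + R 1) ≤ B + 1 / N := by
    intro N hN
    obtain ⟨r, hr, hle⟩ := (c N).prob_correct_mul_log_le_outerFun gd gc hN (hM N) (hP N)
    rw [FeedbackCode.prob_correct_eq _ _ _ (hM N)] at hle
    have h1 : 0 ≤ 1 - e N := by
      rw [he, ← FeedbackCode.prob_correct_eq _ _ _ (hM N)]; exact measureReal_nonneg
    have hN' : (0 : ℝ) < N := by exact_mod_cast hN
    have h2 : outerFun (‖gd‖ ^ 2) (‖gc‖ ^ 2) r ≤ B := by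
      have := le_csSup (bddAbove_outerFun (sq_nonneg ‖gd‖) (sq_nonneg ‖gc‖)) (mem_image_of_mem _ hr)
      rw [hB, outerBound]; linarith
    have hk : ∀ k, N * R k * Real.log 2 ≤ Real.log (M N k) := by
      intro k
      have := Real.log_le_log (by positivity) (hMR N k)
      rwa [Real.log_rpow (by norm_num)] at this
    have h3 : N * (R 0 + R 1) * Real.log 2 ≤ Real.log ((M N 0 : ℝ) * M N 1) := by
      rw [Real.log_mul (by exact_mod_cast (hM N 0).ne') (by exact_mod_cast (hM N 1).ne')]
      linarith [hk 0, hk 1]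
    have h4 := (mul_le_mul_of_nonneg_left h3 h1).trans hle
    have h5 : (N * Real.log 2) * ((1 - e N) * (R 0 + R 1)) ≤ (N * Real.log 2) * (B + 1 / N) := by
      have : (N * Real.log 2) * (B + 1 / N) = N * (Real.log 2 * B) + Real.log 2 := by field_simp
      rw [this]
      have := mul_le_mul_of_nonneg_left h2 (by positivity : 0 ≤ N * Real.log 2)
      linarith
    exact le_of_mul_le_mul_left h5 (by positivity)
  have t1 : Tendsto (fun N => (1 - e N) * (R 0 + R 1)) atTop (𝓝 ((1 - 0) * (R 0 + R 1))) :=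
    (he0.const_sub 1).mul_const _
  have t2 : Tendsto (fun N : ℕ => B + 1 / (N : ℝ)) atTop (𝓝 (B + 0)) :=
    tendsto_one_div_atTop_nhds_zero_nat.const_add B
  have := le_of_tendsto_of_tendsto t1 t2 ((eventually_gt_atTop 0).mono key)
  simpa using this

theorem le_outerBound_of_mem_symRates {gd gc : ℂ} {R : ℝ} (h : R ∈ symRates gd gc) :
    R ≤ outerBound (‖gd‖ ^ 2) (‖gc‖ ^ 2) := by
  have hc : IsClosed {R : Fin 2 → ℝ | R 0 + R 1 ≤ 2 * outerBound (‖gd‖ ^ 2) (‖gc‖ ^ 2)} :=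
    isClosed_le (by fun_prop) (by fun_prop)
  have : R + R ≤ 2 * outerBound (‖gd‖ ^ 2) (‖gc‖ ^ 2) :=
    closure_minimal (fun _ hR => Achievable.sum_le hR) hc h
  linarith

/-! ### The two-slot scheme as a deterministic code. -/

/-- The sign of a user in the Alamouti scheme. -/
def sgn (k : Fin 2) : ℂ := if k = 0 then 1 else -1

theorem sgn_mul_self (k : Fin 2) : sgn k * sgn k = 1 := by
  unfold sgn; split_ifs <;> norm_num

theorem sgn_other (k : Fin 2) : sgn (other k) = -sgn k := by
  fin_cases k <;> simp [sgn, other]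

theorem other_other (k : Fin 2) : other (other k) = k := by
  fin_cases k <;> simp [other]

theorem other_ne (k : Fin 2) : other k ≠ k := by
  fin_cases k <;> simp [other]

/-- A codeword, replaced by zero if its energy is too large. -/
noncomputable def clamp {n : ℕ} (x : Fin n → ℂ) : Fin n → ℂ :=
  if ∑ j, ‖x j‖ ^ 2 ≤ n then x else 0

theorem sum_clamp_le {n : ℕ} (x : Fin n → ℂ) : ∑ j, ‖clamp x j‖ ^ 2 ≤ n := by
  unfold clamp
  split_ifs with h
  · exact h
  · simp

theorem clamp_of_le {n : ℕ} {x : Fin n → ℂ} (h : ∑ j, ‖x j‖ ^ 2 ≤ n) : clamp x = x := if_pos h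

/-- The kind of message that a test decodes: tests `0` (transmitter), `1` and `2` (receiver) decode
common messages, tests `3` and `4` decode the private messages of the two slots. -/
def testKind (T : Fin 5) : Fin 3 := ![0, 0, 0, 1, 2] T

/-- The data of a two-slot scheme with block length `n` in each slot. Every user has a common
message (kind `0`) and a private message for each slot (kinds `1` and `2`). -/
structure Scheme (n : ℕ) (L : Fin 3 → ℕ) where
  gd : ℂ
  gc : ℂ
  a : ℂ
  b : ℂ
  cb : Fin 2 → (t : Fin 3) → Fin (L t) → Fin n → ℂ
  decide : Fin 2 → (T : Fin 5) → (Fin n → ℂ) → Fin (L (testKind T))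
  measurable_decide : ∀ k T, Measurable (decide k T)

namespace Scheme

variable {n : ℕ} {L : Fin 3 → ℕ} (s : Scheme n L)

/-- The codeword of user `k` in the first slot. -/
def word₁ (k : Fin 2) (w : (t : Fin 3) → Fin (L t)) (j : Fin n) : ℂ :=
  s.a * s.cb k 0 (w 0) j + s.b * s.cb k 1 (w 1) j

/-- The complex conjugate of the codeword of user `k` in the second slot; `m` is the common message
of the other user. -/
def word₂ (k : Fin 2) (w : (t : Fin 3) → Fin (L t)) (m : Fin (L 0)) (j : Fin n) : ℂ :=
  sgn k * s.a * s.cb (other k) 0 m j + s.b * s.cb k 2 (w 2) j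

/-- The common message of the other user as decoded by transmitter `k`. -/
noncomputable def relay (k : Fin 2) (w : (t : Fin 3) → Fin (L t)) (y : Fin n → ℂ) : Fin (L 0) :=
  s.decide k 0 fun j => y j - s.gd * clamp (s.word₁ k w) j

/-- The inputs of user `k` when the outputs in the first slot are `y`. -/
noncomputable def send (k : Fin 2) (w : (t : Fin 3) → Fin (L t)) (y : Fin n → ℂ) (i : ℕ) : ℂ :=
  if h : i < n then clamp (s.word₁ k w) ⟨i, h⟩
  else if h : i - n < n then (starRingEnd ℂ) (clamp (s.word₂ k w (s.relay k w y)) ⟨i - n, h⟩)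
  else 0

theorem measurable_relay (k : Fin 2) (w : (t : Fin 3) → Fin (L t)) : Measurable (s.relay k w) :=
  (s.measurable_decide k 0).comp (measurable_pi_lambda _ fun j =>
    (measurable_pi_apply j).sub_const _)

theorem measurable_send (k : Fin 2) (w : (t : Fin 3) → Fin (L t)) (i : ℕ) :
    Measurable fun y => s.send k w y i := by
  unfold send
  split_ifs with h1 h2
  · exact measurable_const
  · exact (measurable_of_countable fun m =>
      (starRingEnd ℂ) (clamp (s.word₂ k w m) ⟨i - n, h2⟩)).comp (s.measurable_relay k w)
  · exact measurable_const

/-- The messages decoded by receiver `k` from the outputs `y₁` and the conjugate outputs `y₂` of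
the two slots. -/
noncomputable def receive (k : Fin 2) (y₁ y₂ : Fin n → ℂ) : (t : Fin 3) → Fin (L t) :=
  -- Alamouti combining: the coefficient vectors of the two common codewords across the two slots
  -- are orthogonal, so each of these combinations keeps one of them, with gain `‖gd‖ ^ 2 + ‖gc‖ ^
  -- 2`, and cancels the other.
  let u : Fin (L 0) := s.decide k 1 fun j =>
    (starRingEnd ℂ) s.gd * y₁ j - s.gc * sgn k * y₂ j
  let u' : Fin (L 0) := s.decide k 2 fun j =>
    (starRingEnd ℂ) s.gc * y₁ j + s.gd * sgn k * y₂ j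
  fun t => match t with
  | 0 => u
  | 1 => s.decide k 3 fun j =>
      y₁ j - s.gd * s.a * s.cb k 0 u j - s.gc * s.a * s.cb (other k) 0 u' j
  | 2 => s.decide k 4 fun j =>
      y₂ j - (starRingEnd ℂ) s.gd * sgn k * s.a * s.cb (other k) 0 u' j
        - (starRingEnd ℂ) s.gc * sgn (other k) * s.a * s.cb k 0 u j

theorem measurable_receive (k : Fin 2) :
    Measurable fun y : (Fin n → ℂ) × (Fin n → ℂ) => s.receive k y.1 y.2 := by
  have hu : Measurable fun y : (Fin n → ℂ) × (Fin n → ℂ) => (s.decide k 1 fun j =>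
      (starRingEnd ℂ) s.gd * y.1 j - s.gc * sgn k * y.2 j : Fin (L 0)) :=
    (s.measurable_decide k 1).comp (by fun_prop)
  have hu' : Measurable fun y : (Fin n → ℂ) × (Fin n → ℂ) => (s.decide k 2 fun j =>
      (starRingEnd ℂ) s.gc * y.1 j + s.gd * sgn k * y.2 j : Fin (L 0)) :=
    (s.measurable_decide k 2).comp (by fun_prop)
  have hc : ∀ (l : Fin 2) (j : Fin n), Measurable fun m : Fin (L 0) => s.cb l 0 m j :=
    fun l j => measurable_of_countable _
  have hcu := fun l j => (hc l j).comp hu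
  have hcu' := fun l j => (hc l j).comp hu'
  refine measurable_pi_lambda _ fun t => ?_
  match t with
  | 0 => exact hu
  | 1 =>
    refine (s.measurable_decide k 3).comp (measurable_pi_lambda _ fun j => ?_)
    exact ((((measurable_pi_apply j).comp measurable_fst)).sub ((hcu k j).const_mul _)).sub
      ((hcu' (other k) j).const_mul _)
  | 2 =>
    refine (s.measurable_decide k 4).comp (measurable_pi_lambda _ fun j => ?_)
    exact ((((measurable_pi_apply j).comp measurable_snd)).sub ((hcu' (other k) j).const_mul _)).sub
      ((hcu k j).const_mul _)

/-- The feedback code of a scheme. -/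
noncomputable def code {N : ℕ} (hN : 2 * n ≤ N) : FeedbackCode N (fun _ => ∏ t, L t) where
  -- The value 0 for unavailable outputs is harmless: `send` ignores them in the first slot, and in
  -- the second slot all first-slot outputs are available.
  enc k i m y := s.send k (finPiFinEquiv.symm m) (fun j => if h : (j : ℕ) < i then y ⟨j, h⟩ else 0) i
  measurable_enc k i m := by
    refine (s.measurable_send k _ i).comp (measurable_pi_lambda _ fun j => ?_)
    split_ifs
    · exact measurable_pi_apply _
    · exact measurable_const
  dec k y := finPiFinEquiv (s.receive k (fun j => y ⟨j, by omega⟩)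
    fun j => (starRingEnd ℂ) (y ⟨n + j, by omega⟩))
  measurable_dec k := by
    refine (measurable_of_countable _).comp ((s.measurable_receive k).comp (Measurable.prodMk ?_ ?_))
    · exact measurable_pi_lambda _ fun j => measurable_pi_apply _
    · exact measurable_pi_lambda _ fun j =>
        Complex.continuous_conj.measurable.comp (measurable_pi_apply _)

variable {N : ℕ} (hN : 2 * n ≤ N) (w : Fin 2 → Fin (∏ t, L t)) (z : Fin 2 → Fin N → ℂ)

/-- The outputs of the first slot. -/
noncomputable def slotOutput (k : Fin 2) (j : Fin n) : ℂ :=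
  (s.code hN).output s.gd s.gc w z ⟨j, by omega⟩ k

theorem input_code (k : Fin 2) (i : Fin N) : (s.code hN).input s.gd s.gc w z k i
    = s.send k (finPiFinEquiv.symm (w k)) (s.slotOutput hN w z k) i := by
  unfold FeedbackCode.input
  change s.send k (finPiFinEquiv.symm (w k)) _ i = _
  by_cases h : (i : ℕ) < n
  · unfold send; rw [dif_pos h, dif_pos h]
  · congr 1
    funext j
    rw [dif_pos (by omega)]
    rfl

/-- Clamping caps the energy of each slot at `n`, and the remaining `N - 2 * n` uses are silent. The
bound holds for every realisation, so the power constraint does not depend on successful relaying.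
-/
theorem sum_send_le {N : ℕ} (hN : 2 * n ≤ N) (k : Fin 2) (v : (t : Fin 3) → Fin (L t)) (y : Fin n → ℂ) :
    ∑ i : Fin N, ‖s.send k v y i‖ ^ 2 ≤ N := by
  rw [Fin.sum_univ_eq_sum_range (fun i => ‖s.send k v y i‖ ^ 2) N]
  obtain ⟨e, rfl⟩ := Nat.exists_eq_add_of_le hN
  rw [two_mul, Finset.sum_range_add, Finset.sum_range_add]
  have h1 : ∑ i ∈ Finset.range n, ‖s.send k v y i‖ ^ 2 ≤ n := by
    rw [← Fin.sum_univ_eq_sum_range (fun i => ‖s.send k v y i‖ ^ 2) n]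
    refine le_trans (le_of_eq (Finset.sum_congr rfl fun j _ => ?_)) (sum_clamp_le (s.word₁ k v))
    unfold send; rw [dif_pos j.isLt]
  have h2 : ∑ i ∈ Finset.range n, ‖s.send k v y (n + i)‖ ^ 2 ≤ n := by
    rw [← Fin.sum_univ_eq_sum_range (fun i => ‖s.send k v y (n + i)‖ ^ 2) n]
    refine le_trans (le_of_eq (Finset.sum_congr rfl fun j _ => ?_))
      (sum_clamp_le (s.word₂ k v (s.relay k v y)))
    unfold send
    rw [dif_neg (by omega), dif_pos (by omega), RCLike.norm_conj]
    congr 3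
    ext; simp
  have h3 : ∑ i ∈ Finset.range e, ‖s.send k v y (n + n + i)‖ ^ 2 = 0 := by
    refine Finset.sum_eq_zero fun i _ => ?_
    unfold send
    rw [dif_neg (by omega), dif_neg (by omega)]
    simp
  push_cast
  have : (0 : ℝ) ≤ e := by positivity
  linarith

theorem powerConstraint_code (hL : ∀ t, 0 < L t) : (s.code hN).PowerConstraint s.gd s.gc := by
  have := FeedbackCode.isProbabilityMeasure_law N (M := fun _ => ∏ t, L t)
    fun _ => Finset.prod_pos fun t _ => hL t
  intro k
  rw [← lintegral_finsetSum _ fun i _ => ((s.code hN).measurable_input s.gd s.gc k i).enorm.pow_const 2]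
  have h : ∀ p : (Fin 2 → Fin (∏ t, L t)) × (Fin 2 → Fin N → ℂ),
      ∑ i, ‖(s.code hN).input s.gd s.gc p.1 p.2 k i‖ₑ ^ 2 ≤ N := by
    intro p
    have h := s.sum_send_le hN k (finPiFinEquiv.symm (p.1 k)) (s.slotOutput hN p.1 p.2 k)
    have h' := ENNReal.ofReal_le_ofReal h
    rw [ENNReal.ofReal_sum_of_nonneg (fun _ _ => by positivity), ENNReal.ofReal_natCast] at h'
    refine le_trans (le_of_eq (Finset.sum_congr rfl fun i _ => ?_)) h'
    rw [input_code, ENNReal.ofReal_pow (norm_nonneg _), ofReal_norm]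
  refine (lintegral_mono h).trans ?_
  simp

/-- The outputs of the first slot when no codeword is clamped. -/
def cleanOutput₁ (v : Fin 2 → (t : Fin 3) → Fin (L t)) (z₁ : Fin 2 → Fin n → ℂ) (k : Fin 2)
    (j : Fin n) : ℂ :=
  s.gd * s.word₁ k (v k) j + s.gc * s.word₁ (other k) (v (other k)) j + z₁ k j

/-- The conjugate outputs of the second slot when no codeword is clamped and the transmitters
decode correctly. -/
def cleanOutput₂ (v : Fin 2 → (t : Fin 3) → Fin (L t)) (z₂ : Fin 2 → Fin n → ℂ) (k : Fin 2)
    (j : Fin n) : ℂ :=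
  (starRingEnd ℂ) s.gd * s.word₂ k (v k) (v (other k) 0) j
    + (starRingEnd ℂ) s.gc * s.word₂ (other k) (v (other k)) (v k 0) j + z₂ k j

/-- The sequence to which test `T` of user `k` is applied, as long as there are no errors. -/
def statistic (v : Fin 2 → (t : Fin 3) → Fin (L t)) (z₁ z₂ : Fin 2 → Fin n → ℂ) (k : Fin 2)
    (T : Fin 5) (j : Fin n) : ℂ :=
  match T with
  | 0 => s.cleanOutput₁ v z₁ k j - s.gd * s.word₁ k (v k) j
  | 1 => (starRingEnd ℂ) s.gd * s.cleanOutput₁ v z₁ k j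
      - s.gc * sgn k * s.cleanOutput₂ v z₂ k j
  | 2 => (starRingEnd ℂ) s.gc * s.cleanOutput₁ v z₁ k j
      + s.gd * sgn k * s.cleanOutput₂ v z₂ k j
  | 3 => s.cleanOutput₁ v z₁ k j - s.gd * s.a * s.cb k 0 (v k 0) j
      - s.gc * s.a * s.cb (other k) 0 (v (other k) 0) j
  | 4 => s.cleanOutput₂ v z₂ k j - (starRingEnd ℂ) s.gd * sgn k * s.a * s.cb (other k) 0 (v (other k) 0) j
      - (starRingEnd ℂ) s.gc * sgn (other k) * s.a * s.cb k 0 (v k 0) j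

/-- The user whose message is decoded in test `T` of user `k`. -/
def testUser (k : Fin 2) (T : Fin 5) : Fin 2 := if T = 0 ∨ T = 2 then other k else k

/-- If no codeword is clamped and all tests succeed on the error-free statistics, then both
receivers decode correctly. -/
theorem dec_code_eq (v : Fin 2 → (t : Fin 3) → Fin (L t)) (hv : ∀ k, w k = finPiFinEquiv (v k))
    (z₁ z₂ : Fin 2 → Fin n → ℂ) (hz₁ : ∀ k (j : Fin n), z₁ k j = z k ⟨j, by omega⟩)
    (hz₂ : ∀ k (j : Fin n), z₂ k j = (starRingEnd ℂ) (z k ⟨n + j, by omega⟩))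
    (h₁ : ∀ k, ∑ j, ‖s.word₁ k (v k) j‖ ^ 2 ≤ n)
    (h₂ : ∀ k, ∑ j, ‖s.word₂ k (v k) (v (other k) 0) j‖ ^ 2 ≤ n)
    (ht : ∀ k T, s.decide k T (s.statistic v z₁ z₂ k T) = v (testUser k T) (testKind T)) (k : Fin 2) :
    (s.code hN).dec k (fun i => (s.code hN).output s.gd s.gc w z i k) = w k := by
  have hsymm : ∀ k, finPiFinEquiv.symm (w k) = v k := fun k => by rw [hv, Equiv.symm_apply_apply]
  have out1 : ∀ k, s.slotOutput hN w z k = s.cleanOutput₁ v z₁ k := by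
    intro k
    funext j
    unfold slotOutput cleanOutput₁
    rw [FeedbackCode.output_eq, input_code, input_code, hz₁, hsymm, hsymm]
    unfold send
    rw [dif_pos j.isLt, dif_pos j.isLt, clamp_of_le (h₁ _), clamp_of_le (h₁ _)]
  have hrelay : ∀ k, s.relay k (v k) (s.slotOutput hN w z k) = v (other k) 0 := by
    intro k
    unfold relay
    rw [out1, clamp_of_le (h₁ k)]
    exact ht k 0
  have in2 : ∀ k (j : Fin n), (s.code hN).input s.gd s.gc w z k ⟨n + j, by omega⟩
      = (starRingEnd ℂ) (s.word₂ k (v k) (v (other k) 0) j) := by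
    intro k j
    rw [input_code, hsymm]
    unfold send
    rw [dif_neg (by simp), dif_pos (by simp), hrelay, clamp_of_le (h₂ k)]
    congr 3
    simp
  have out2 : ∀ k (j : Fin n), (starRingEnd ℂ) ((s.code hN).output s.gd s.gc w z ⟨n + j, by omega⟩ k)
      = s.cleanOutput₂ v z₂ k j := by
    intro k j
    rw [FeedbackCode.output_eq, in2, in2]
    unfold cleanOutput₂
    rw [hz₂, map_add, map_add, map_mul, map_mul, Complex.conj_conj, Complex.conj_conj, other_other]
  change finPiFinEquiv (s.receive k (s.slotOutput hN w z k) fun j =>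
    (starRingEnd ℂ) ((s.code hN).output s.gd s.gc w z ⟨n + j, by omega⟩ k)) = w k
  rw [hv, EmbeddingLike.apply_eq_iff_eq, out1]
  simp_rw [out2]
  have hu : (s.decide k 1 fun j => (starRingEnd ℂ) s.gd * s.cleanOutput₁ v z₁ k j
      - s.gc * sgn k * s.cleanOutput₂ v z₂ k j) = v k 0 := ht k 1
  have hu' : (s.decide k 2 fun j => (starRingEnd ℂ) s.gc * s.cleanOutput₁ v z₁ k j
      + s.gd * sgn k * s.cleanOutput₂ v z₂ k j) = v (other k) 0 := ht k 2
  funext t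
  match t with
  | 0 => exact hu
  | 1 =>
    simp only [receive]
    rw [hu, hu']
    exact ht k 3
  | 2 =>
    simp only [receive]
    rw [hu, hu']
    exact ht k 4

end Scheme

/-! ### Coordinates of a product measure. -/

section Coordinates

variable {ι : Type*} [Fintype ι] {E : Type*} [MeasurableSpace E] (γ : Measure E)
  [IsProbabilityMeasure γ]

theorem measurePreserving_comp_injective {κ : Type*} [Fintype κ] {e : κ → ι}
    (he : Function.Injective e) :
    MeasurePreserving (fun (x : ι → E) k => x (e k)) (Measure.pi fun _ => γ)
      (Measure.pi fun _ => γ) := by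
  have h : iIndepFun (fun (i : ι) (x : ι → E) => x i) (Measure.pi fun _ => γ) :=
    iIndepFun_pi (X := fun _ => id) fun _ => aemeasurable_id
  have h' := (iIndepFun_iff_map_fun_eq_pi_map
    fun k => (measurable_pi_apply (e k)).aemeasurable).mp (h.precomp he)
  refine ⟨by fun_prop, h'.trans ?_⟩
  congr
  funext k
  exact (measurePreserving_eval (fun _ : ι => γ) (e k)).map_eq

theorem indepFun_comp_of_disjoint {κ κ' : Type*} [Fintype κ] [Fintype κ'] (e : κ → ι) (e' : κ' → ι)
    (he : ∀ k k', e k ≠ e' k') :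
    IndepFun (fun (x : ι → E) k => x (e k)) (fun (x : ι → E) k => x (e' k))
      (Measure.pi fun _ => γ) := by
  classical
  have h : iIndepFun (fun (i : ι) (x : ι → E) => x i) (Measure.pi fun _ => γ) :=
    iIndepFun_pi (X := fun _ => id) fun _ => aemeasurable_id
  have hd : Disjoint (Finset.univ.image e) (Finset.univ.image e') := by
    rw [Finset.disjoint_left]
    simp only [Finset.mem_image, Finset.mem_univ, true_and, not_exists]
    rintro _ ⟨k, rfl⟩ k' hk
    exact he k k' hk.symm
  have h2 := h.indepFun_finset _ _ hd fun i => measurable_pi_apply i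
  exact h2.comp
    (φ := fun (x : {i // i ∈ Finset.univ.image e} → E) k => x ⟨e k, by simp⟩)
    (ψ := fun (x : {i // i ∈ Finset.univ.image e'} → E) k => x ⟨e' k, by simp⟩)
    (by fun_prop) (by fun_prop)

end Coordinates

/-! ### Wrong codewords: an exponential Markov bound. -/

section FalseAlarm

/-- The information density of `u` and `y` for a Gaussian backward channel with mean `μ * y` and
variance `v`. -/
noncomputable def score (μ : ℂ) (v : ℝ) (u y : ℂ) : ℝ :=
  -(Real.log v + ‖u - μ * y‖ ^ 2 / v - ‖u‖ ^ 2)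

@[fun_prop]
theorem Measurable.score {Ω : Type*} [MeasurableSpace Ω] {f g : Ω → ℂ} (hf : Measurable f)
    (hg : Measurable g) (μ : ℂ) (v : ℝ) : Measurable fun ω => score μ v (f ω) (g ω) := by
  unfold GaussianIFC.score
  fun_prop

/-- The exponential of the score is the ratio of a shifted Gaussian density of variance `v` to the
standard one. -/
theorem lintegral_exp_score (μ : ℂ) {v : ℝ} (hv : 0 < v) (y : ℂ) :
    ∫⁻ u, ENNReal.ofReal (Real.exp (score μ v u y)) ∂stdComplexGaussian = 1 := by
  rw [stdComplexGaussian_eq_withDensity, lintegral_withDensity_eq_lintegral_mul _ (by fun_prop)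
    (by fun_prop), ← lintegral_gaussianDensity_sub hv (μ * y)]
  refine lintegral_congr fun u => ?_
  exact FeedbackCode.gaussianDensity_one_mul_exp hv u (u - μ * y)

/-- A codeword that is independent of the statistic passes the test with small probability. -/
theorem measure_score_ge_le {Ω : Type*} [MeasurableSpace Ω] {P : Measure Ω} [IsProbabilityMeasure P]
    {n : ℕ} {U Y : Ω → Fin n → ℂ}
    (hU : MeasurePreserving U P (Measure.pi fun _ => stdComplexGaussian)) (hY : Measurable Y)
    (hUY : IndepFun U Y P) (μ : ℂ) {v : ℝ} (hv : 0 < v) (θ : ℝ) :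
    P {ω | θ ≤ ∑ j, score μ v (U ω j) (Y ω j)} ≤ ENNReal.ofReal (Real.exp (-θ)) := by
  have hprod := (indepFun_iff_map_prod_eq_prod_map_map hU.measurable.aemeasurable
    hY.aemeasurable).mp hUY
  have : IsProbabilityMeasure (P.map Y) := Measure.isProbabilityMeasure_map hY.aemeasurable
  have hF : Measurable fun p : (Fin n → ℂ) × (Fin n → ℂ) =>
      ENNReal.ofReal (Real.exp (∑ j, score μ v (p.1 j) (p.2 j))) := by fun_prop
  -- For fixed `Y` the integral over the letters of `U` factorises into integrals equal to 1,
  -- whatever the law of `Y` is.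
  have hone : ∫⁻ ω, ENNReal.ofReal (Real.exp (∑ j, score μ v (U ω j) (Y ω j))) ∂P = 1 := by
    rw [← lintegral_map (f := fun p : (Fin n → ℂ) × (Fin n → ℂ) =>
      ENNReal.ofReal (Real.exp (∑ j, score μ v (p.1 j) (p.2 j)))) hF (hU.measurable.prodMk hY), hprod,
      hU.map_eq, lintegral_prod_symm' _ hF]
    have : ∀ y : Fin n → ℂ, ∫⁻ u : Fin n → ℂ, ENNReal.ofReal (Real.exp (∑ j, score μ v (u j) (y j)))
        ∂(Measure.pi fun _ => stdComplexGaussian) = 1 := by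
      intro y
      simp_rw [Real.exp_sum, ENNReal.ofReal_prod_of_nonneg (fun _ _ => (Real.exp_pos _).le)]
      rw [lintegral_pi_prod (fun _ : Fin n => stdComplexGaussian)
        (fun j u => ENNReal.ofReal (Real.exp (score μ v u (y j)))) (fun j => by fun_prop)]
      simp [lintegral_exp_score μ hv]
    simp [this]
  have hm : Measurable fun ω => ENNReal.ofReal (Real.exp (∑ j, score μ v (U ω j) (Y ω j))) := by
    have := hU.measurable
    fun_prop
  have hmk := mul_meas_ge_le_lintegral₀ hm.aemeasurable (μ := P) (ENNReal.ofReal (Real.exp θ))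
  rw [hone] at hmk
  have hset : {ω | θ ≤ ∑ j, score μ v (U ω j) (Y ω j)} = {ω | ENNReal.ofReal (Real.exp θ) ≤
      ENNReal.ofReal (Real.exp (∑ j, score μ v (U ω j) (Y ω j)))} := by
    ext ω
    simp only [Set.mem_ofPred_eq]
    rw [ENNReal.ofReal_le_ofReal_iff (Real.exp_pos _).le, Real.exp_le_exp]
  rw [hset, Real.exp_neg, ENNReal.ofReal_inv_of_pos (Real.exp_pos _), ← one_div]
  rw [ENNReal.le_div_iff_mul_le (Or.inl (by simp [Real.exp_pos])) (Or.inl (by simp)), mul_comm]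
  exact hmk

end FalseAlarm

/-! ### Energies of Gaussian linear forms: Chebyshev's inequality. -/

section LargeNumbers

theorem _root_.MeasureTheory.MeasurePreserving.integral_comp_of_aestronglyMeasurable
    {α β G : Type*} [MeasurableSpace α] [MeasurableSpace β] [NormedAddCommGroup G] [NormedSpace ℝ G]
    {μ : Measure α} {ν : Measure β} {f : α → β} (hf : MeasurePreserving f μ ν) {g : β → G}
    (hg : AEStronglyMeasurable g ν) : ∫ x, g (f x) ∂μ = ∫ y, g y ∂ν := by
  rw [← hf.map_eq] at hg ⊢
  exact (integral_map hf.measurable.aemeasurable hg).symm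

variable {κ : Type*} [Fintype κ]

theorem integral_mul_conj_pi (i j : κ) [DecidableEq κ] :
    ∫ x : κ → ℂ, x i * (starRingEnd ℂ) (x j) ∂(Measure.pi fun _ => stdComplexGaussian)
      = if i = j then 1 else 0 := by
  have hev := fun i : κ => measurePreserving_eval (fun _ : κ => stdComplexGaussian) i
  split_ifs with h
  · subst h
    have : ∀ x : κ → ℂ, x i * (starRingEnd ℂ) (x i) = ((‖x i‖ ^ 2 : ℝ) : ℂ) := fun x => by
      rw [Complex.mul_conj, Complex.normSq_eq_norm_sq]
    simp_rw [this]
    rw [integral_complex_ofReal, ← Complex.ofReal_one, ← integral_norm_sq_stdComplexGaussian]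
    congr 1
    exact (hev i).integral_comp_of_aestronglyMeasurable (g := fun z => ‖z‖ ^ 2)
      (by fun_prop : Measurable fun z : ℂ => ‖z‖ ^ 2).aestronglyMeasurable
  · have hI : iIndepFun (fun (i : κ) (x : κ → ℂ) => x i) (Measure.pi fun _ => stdComplexGaussian) :=
      iIndepFun_pi (X := fun _ => id) fun _ => aemeasurable_id
    have h2 := (hI.indepFun h).comp measurable_id Complex.continuous_conj.measurable
    have h3 := h2.integral_mul_eq_mul_integral (measurable_pi_apply i).aestronglyMeasurable
      (Complex.continuous_conj.measurable.comp (measurable_pi_apply j)).aestronglyMeasurable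
    have h0 : ∫ x : κ → ℂ, x i ∂(Measure.pi fun _ => stdComplexGaussian) = 0 := by
      rw [← integral_stdComplexGaussian]
      exact (hev i).integral_comp_of_aestronglyMeasurable (g := fun z => z)
        measurable_id.aestronglyMeasurable
    simp only [Function.comp_def, id] at h3
    rw [h0, zero_mul] at h3
    exact h3

theorem memLp_linear_pi (a : κ → ℂ) (p : ℝ≥0∞) (hp : p ≠ ∞) :
    MemLp (fun x : κ → ℂ => ∑ i, a i * x i) p (Measure.pi fun _ => stdComplexGaussian) :=
  memLp_finsetSum _ fun i _ => ((memLp_stdComplexGaussian p hp).comp_measurePreserving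
    (measurePreserving_eval (fun _ : κ => stdComplexGaussian) i)).const_mul (a i)

theorem integral_norm_sq_linear_pi (a : κ → ℂ) :
    ∫ x : κ → ℂ, ‖∑ i, a i * x i‖ ^ 2 ∂(Measure.pi fun _ => stdComplexGaussian)
      = ∑ i, ‖a i‖ ^ 2 := by
  classical
  have hev := fun i : κ => (memLp_stdComplexGaussian 2 (by simp)).comp_measurePreserving
    (measurePreserving_eval (fun _ : κ => stdComplexGaussian) i)
  have hint : ∀ i j : κ, Integrable (fun x : κ → ℂ => x i * (starRingEnd ℂ) (x j))
      (Measure.pi fun _ => stdComplexGaussian) := fun i j =>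
    (hev i).integrable_mul (q := 2) ((hev j).star)
  have e : ∀ x : κ → ℂ, ((‖∑ i, a i * x i‖ ^ 2 : ℝ) : ℂ)
      = ∑ i, ∑ j, (a i * (starRingEnd ℂ) (a j)) * (x i * (starRingEnd ℂ) (x j)) := by
    intro x
    rw [← Complex.normSq_eq_norm_sq, ← Complex.mul_conj, map_sum, Finset.sum_mul_sum]
    refine Finset.sum_congr rfl fun i _ => Finset.sum_congr rfl fun j _ => ?_
    rw [map_mul]; ring
  rw [← Complex.ofReal_inj, ← integral_complex_ofReal]
  simp_rw [e]
  rw [integral_finsetSum _ fun i _ => integrable_finsetSum _ fun j _ => (hint i j).const_mul _]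
  simp_rw [integral_finsetSum _ fun j _ => (hint _ j).const_mul _, integral_const_mul,
    integral_mul_conj_pi]
  simp [Complex.mul_conj, Complex.normSq_eq_norm_sq]

/-- The weak law of large numbers for the energy of a linear form. -/
theorem exists_measure_energy_le (a : κ → ℂ) {ε : ℝ} (hε : 0 < ε) : ∃ C : ℝ, 0 ≤ C ∧
    ∀ n : ℕ, 0 < n → (Measure.pi fun _ : Fin n => Measure.pi fun _ : κ => stdComplexGaussian)
      {x | ε * n ≤ |∑ j, ‖∑ i, a i * x j i‖ ^ 2 - n * ∑ i, ‖a i‖ ^ 2|}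
      ≤ ENNReal.ofReal (C / n) := by
  set f : (κ → ℂ) → ℝ := fun x => ‖∑ i, a i * x i‖ ^ 2 with hf
  set P : Measure (κ → ℂ) := Measure.pi fun _ => stdComplexGaussian
  have hfm : Measurable f := by fun_prop
  -- Chebyshev's inequality for energies needs fourth moments of the linear form.
  have hf2 : MemLp f 2 P := by
    have h4 := (memLp_linear_pi a 4 (by simp)).norm
    have : MemLp (fun x : κ → ℂ => ‖∑ i, a i * x i‖ * ‖∑ i, a i * x i‖) 2 P := by
      have : ENNReal.HolderTriple 4 4 2 := ⟨by
        rw [← two_mul, show (4 : ℝ≥0∞) = 2 * 2 by norm_num,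
          ENNReal.mul_inv (by simp) (by simp), ← mul_assoc, ENNReal.mul_inv_cancel (by simp) (by simp),
          one_mul]⟩
      exact h4.mul' (p := 4) (q := 4) h4
    simpa only [hf, pow_two] using this
  refine ⟨Var[f; P] / ε ^ 2, by have := variance_nonneg f P; positivity, fun n hn => ?_⟩
  have hn' : (0 : ℝ) < n := by exact_mod_cast hn
  set Q := Measure.pi fun _ : Fin n => P
  have hev := fun j : Fin n => measurePreserving_eval (fun _ : Fin n => P) j
  have hX : ∀ j : Fin n, MemLp (fun x : Fin n → κ → ℂ => f (x j)) 2 Q := fun j =>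
    hf2.comp_measurePreserving (hev j)
  have hind : iIndepFun (fun (j : Fin n) (x : Fin n → κ → ℂ) => f (x j)) Q :=
    iIndepFun_pi (X := fun _ => f) fun _ => hfm.aemeasurable
  have hS : MemLp (∑ j : Fin n, fun x : Fin n → κ → ℂ => f (x j)) 2 Q :=
    memLp_finsetSum' _ fun j _ => hX j
  have hE : ∫ x, (∑ j : Fin n, fun x : Fin n → κ → ℂ => f (x j)) x ∂Q = n * ∑ i, ‖a i‖ ^ 2 := by
    simp only [Finset.sum_apply]
    rw [integral_finsetSum _ fun j _ => (hX j).integrable (by norm_num)]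
    have : ∀ j : Fin n, ∫ x : Fin n → κ → ℂ, f (x j) ∂Q = ∑ i, ‖a i‖ ^ 2 := fun j => by
      rw [← integral_norm_sq_linear_pi a]
      exact (hev j).integral_comp_of_aestronglyMeasurable hfm.aestronglyMeasurable
    simp [this]
  have hV : Var[∑ j : Fin n, fun x : Fin n → κ → ℂ => f (x j); Q] = n * Var[f; P] := by
    rw [IndepFun.variance_sum (fun j _ => hX j) fun i _ j _ hij => hind.indepFun hij]
    have : ∀ j : Fin n, Var[fun x : Fin n → κ → ℂ => f (x j); Q] = Var[f; P] := fun j => by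
      have h := variance_map (X := f) (Y := Function.eval j) (μ := Q)
        (by rw [(hev j).map_eq]; exact hfm.aemeasurable) (hev j).measurable.aemeasurable
      rw [(hev j).map_eq] at h
      exact h.symm
    simp [this]
  have h := meas_ge_le_variance_div_sq hS (c := ε * n) (by positivity)
  rw [hV, hE] at h
  simp only [Finset.sum_apply] at h
  convert h using 2
  field_simp

theorem exists_measure_energy_le_of_finite {F : Set (κ → ℂ)} (hF : F.Finite) {ε : ℝ} (hε : 0 < ε) :
    ∃ C : ℝ, 0 ≤ C ∧ ∀ n : ℕ, 0 < n →
      (Measure.pi fun _ : Fin n => Measure.pi fun _ : κ => stdComplexGaussian)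
      {x | ∃ a ∈ F, ε * n ≤ |∑ j, ‖∑ i, a i * x j i‖ ^ 2 - n * ∑ i, ‖a i‖ ^ 2|}
      ≤ ENNReal.ofReal (C / n) := by
  choose C hC0 hC using fun a : κ → ℂ => exists_measure_energy_le a hε
  refine ⟨∑ a ∈ hF.toFinset, C a, Finset.sum_nonneg fun a _ => hC0 a, fun n hn => ?_⟩
  have hset : {x : Fin n → κ → ℂ | ∃ a ∈ F, ε * n ≤ |∑ j, ‖∑ i, a i * x j i‖ ^ 2 - n * ∑ i, ‖a i‖ ^ 2|}
      = ⋃ a ∈ hF.toFinset, {x | ε * n ≤ |∑ j, ‖∑ i, a i * x j i‖ ^ 2 - n * ∑ i, ‖a i‖ ^ 2|} := by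
    ext x; simp
  rw [hset, Finset.sum_div, ENNReal.ofReal_sum_of_nonneg fun a _ => by have := hC0 a; positivity]
  exact (measure_biUnion_finset_le _ _).trans (Finset.sum_le_sum fun a _ => hC a n hn)

end LargeNumbers

/-! ### The test statistics as linear forms in ten variables. -/

section LinearTests

/-- The coefficients of a linear form in ten variables, five of them belonging to each user:
`p` for user `k`, `q` for the other one. -/
def pairCoeff (k : Fin 2) (p q : Fin 5 → ℂ) (i : Fin 2 × Fin 5) : ℂ := if i.1 = k then p i.2 else q i.2

theorem sum_eq_add_other {A : Type*} [AddCommMonoid A] (f : Fin 2 → A) (k : Fin 2) :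
    ∑ l, f l = f k + f (other k) := by
  fin_cases k
  · simp [Fin.sum_univ_two, other]
  · simp [Fin.sum_univ_two, other, add_comm]

theorem sum_pairCoeff_mul (k : Fin 2) (p q : Fin 5 → ℂ) (x : Fin 2 × Fin 5 → ℂ) :
    ∑ i, pairCoeff k p q i * x i = ∑ t, p t * x (k, t) + ∑ t, q t * x (other k, t) := by
  rw [Fintype.sum_prod_type, sum_eq_add_other _ k]
  simp [pairCoeff, other_ne]

theorem sum_norm_sq_pairCoeff (k : Fin 2) (p q : Fin 5 → ℂ) :
    ∑ i, ‖pairCoeff k p q i‖ ^ 2 = ∑ t, ‖p t‖ ^ 2 + ∑ t, ‖q t‖ ^ 2 := by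
  rw [Fintype.sum_prod_type, sum_eq_add_other _ k]
  simp [pairCoeff, other_ne]

/-- The coefficients of the statistic of test `T` of user `k`. The variables of a user are the
letters of its common and of its two private codewords, and the noise in the two slots. -/
def testCoeff (gd gc a b : ℂ) (k : Fin 2) (T : Fin 5) : Fin 2 × Fin 5 → ℂ :=
  match T with
  | 0 => pairCoeff k ![0, 0, 0, 1, 0] ![gc * a, gc * b, 0, 0, 0]
  | 1 => pairCoeff k
      ![((starRingEnd ℂ) gd * gd + (starRingEnd ℂ) gc * gc) * a, (starRingEnd ℂ) gd * gd * b,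
        -(gc * sgn k * (starRingEnd ℂ) gd * b), (starRingEnd ℂ) gd, -(gc * sgn k)]
      ![0, (starRingEnd ℂ) gd * gc * b, -(gc * sgn k * (starRingEnd ℂ) gc * b), 0, 0]
  | 2 => pairCoeff k
      ![0, (starRingEnd ℂ) gc * gd * b, gd * sgn k * (starRingEnd ℂ) gd * b, (starRingEnd ℂ) gc,
        gd * sgn k]
      ![((starRingEnd ℂ) gd * gd + (starRingEnd ℂ) gc * gc) * a, (starRingEnd ℂ) gc * gc * b,
        gd * sgn k * (starRingEnd ℂ) gc * b, 0, 0]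
  | 3 => pairCoeff k ![0, gd * b, 0, 1, 0] ![0, gc * b, 0, 0, 0]
  | 4 => pairCoeff k ![0, 0, (starRingEnd ℂ) gd * b, 0, 1] ![0, 0, (starRingEnd ℂ) gc * b, 0, 0]

def wordCoeff₁ (a b : ℂ) (k : Fin 2) : Fin 2 × Fin 5 → ℂ := pairCoeff k ![a, b, 0, 0, 0] 0

def wordCoeff₂ (a b : ℂ) (k : Fin 2) : Fin 2 × Fin 5 → ℂ :=
  pairCoeff k ![0, 0, b, 0, 0] ![sgn k * a, 0, 0, 0, 0]

/-- The variable that carries the codeword decoded in test `T` of user `k`. -/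
def testIdx (k : Fin 2) (T : Fin 5) : Fin 2 × Fin 5 :=
  (Scheme.testUser k T, (testKind T).castLE (by norm_num))

theorem norm_sgn (k : Fin 2) : ‖sgn k‖ = 1 := by
  unfold sgn; split_ifs <;> simp

theorem sum_norm_sq_wordCoeff₁ (a b : ℂ) (k : Fin 2) :
    ∑ i, ‖wordCoeff₁ a b k i‖ ^ 2 = ‖a‖ ^ 2 + ‖b‖ ^ 2 := by
  simp [wordCoeff₁, sum_norm_sq_pairCoeff, Fin.sum_univ_five]

theorem sum_norm_sq_wordCoeff₂ (a b : ℂ) (k : Fin 2) :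
    ∑ i, ‖wordCoeff₂ a b k i‖ ^ 2 = ‖a‖ ^ 2 + ‖b‖ ^ 2 := by
  simp [wordCoeff₂, sum_norm_sq_pairCoeff, Fin.sum_univ_five, norm_sgn]
  ring

variable {n : ℕ} {L : Fin 3 → ℕ}

/-- In tests 1 and 2 this contains the Alamouti cancellation: after `sgn k * sgn k = 1`, the
unwanted common codeword drops out and the wanted one adds up coherently. -/
theorem Scheme.statistic_eq (s : Scheme n L) (v : Fin 2 → (t : Fin 3) → Fin (L t))
    (z₁ z₂ : Fin 2 → Fin n → ℂ) (k : Fin 2) (T : Fin 5) (j : Fin n) (x : Fin 2 × Fin 5 → ℂ)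
    (h0 : ∀ l, x (l, 0) = s.cb l 0 (v l 0) j) (h1 : ∀ l, x (l, 1) = s.cb l 1 (v l 1) j)
    (h2 : ∀ l, x (l, 2) = s.cb l 2 (v l 2) j) (h3 : ∀ l, x (l, 3) = z₁ l j)
    (h4 : ∀ l, x (l, 4) = z₂ l j) :
    s.statistic v z₁ z₂ k T j = ∑ i, testCoeff s.gd s.gc s.a s.b k T i * x i := by
  have hs := sgn_mul_self k
  match T with
  | 0 =>
    simp [statistic, cleanOutput₁, word₁, testCoeff, sum_pairCoeff_mul, Fin.sum_univ_five, h0, h1, h3]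
    ring
  | 1 =>
    simp [statistic, cleanOutput₁, cleanOutput₂, word₁, word₂, testCoeff, sum_pairCoeff_mul,
      Fin.sum_univ_five, h0, h1, h2, h3, h4, sgn_other, other_other]
    linear_combination (s.gc * (starRingEnd ℂ) s.gc * s.a * s.cb k 0 (v k 0) j
      - s.gc * (starRingEnd ℂ) s.gd * s.a * s.cb (other k) 0 (v (other k) 0) j) * hs
  | 2 =>
    simp [statistic, cleanOutput₁, cleanOutput₂, word₁, word₂, testCoeff, sum_pairCoeff_mul,
      Fin.sum_univ_five, h0, h1, h2, h3, h4, sgn_other, other_other]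
    linear_combination (s.gd * (starRingEnd ℂ) s.gd * s.a * s.cb (other k) 0 (v (other k) 0) j
      - s.gd * (starRingEnd ℂ) s.gc * s.a * s.cb k 0 (v k 0) j) * hs
  | 3 =>
    simp [statistic, cleanOutput₁, word₁, testCoeff, sum_pairCoeff_mul, Fin.sum_univ_five, h1, h3]
    ring
  | 4 =>
    simp [statistic, cleanOutput₂, word₂, testCoeff, sum_pairCoeff_mul, Fin.sum_univ_five, h2, h4,
      sgn_other, other_other]
    ring

theorem Scheme.word₁_eq (s : Scheme n L) (v : Fin 2 → (t : Fin 3) → Fin (L t))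
    (k : Fin 2) (j : Fin n) (x : Fin 2 × Fin 5 → ℂ)
    (h0 : ∀ l, x (l, 0) = s.cb l 0 (v l 0) j) (h1 : ∀ l, x (l, 1) = s.cb l 1 (v l 1) j) :
    s.word₁ k (v k) j = ∑ i, wordCoeff₁ s.a s.b k i * x i := by
  simp [word₁, wordCoeff₁, sum_pairCoeff_mul, Fin.sum_univ_five, h0, h1]

theorem Scheme.word₂_eq (s : Scheme n L) (v : Fin 2 → (t : Fin 3) → Fin (L t))
    (k : Fin 2) (j : Fin n) (x : Fin 2 × Fin 5 → ℂ)
    (h0 : ∀ l, x (l, 0) = s.cb l 0 (v l 0) j) (h2 : ∀ l, x (l, 2) = s.cb l 2 (v l 2) j) :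
    s.word₂ k (v k) (v (other k) 0) j = ∑ i, wordCoeff₂ s.a s.b k i * x i := by
  simp [word₂, wordCoeff₂, sum_pairCoeff_mul, Fin.sum_univ_five, h0, h2]
  ring

end LinearTests

/-! ### Linear estimation of a codeword letter. -/

section LinearEstimation

variable {κ : Type*} [Fintype κ]

/-- The power of a linear form in independent standard variables. -/
noncomputable def power (c : κ → ℂ) : ℝ := ∑ i, ‖c i‖ ^ 2

/-- The coefficient of the linear estimate of the variable `u` from the linear form `c`. -/
noncomputable def estCoeff (c : κ → ℂ) (u : κ) : ℂ := (starRingEnd ℂ) (c u) / power c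

/-- The error variance of the linear estimate of the variable `u` from the linear form `c`. -/
noncomputable def estVar (c : κ → ℂ) (u : κ) : ℝ := (power c - ‖c u‖ ^ 2) / power c

/-- The quantity `power c - ‖c u‖ ^ 2` is the power of interference plus noise seen by a test for
`u`. Its positivity is what keeps the error variance, a denominator of the score, away from 0. -/
theorem power_pos {c : κ → ℂ} {u : κ} (h : 0 < power c - ‖c u‖ ^ 2) : 0 < power c := by
  have : 0 ≤ ‖c u‖ ^ 2 := by positivity
  linarith

theorem estVar_pos {c : κ → ℂ} {u : κ} (h : 0 < power c - ‖c u‖ ^ 2) : 0 < estVar c u :=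
  div_pos h (power_pos h)

variable [DecidableEq κ]

/-- The error of the linear estimate, as a linear form. -/
noncomputable def estError (c : κ → ℂ) (u : κ) : κ → ℂ := Pi.single u 1 - estCoeff c u • c

theorem sum_norm_sq_single (u : κ) : ∑ i, ‖(Pi.single u 1 : κ → ℂ) i‖ ^ 2 = 1 := by
  rw [Finset.sum_eq_single u]
  · simp
  · intro i _ hi; simp [Pi.single_eq_of_ne hi]
  · simp

theorem sum_single_mul (u : κ) (f : κ → ℂ) : ∑ i, (Pi.single u 1 : κ → ℂ) i * f i = f u := by
  rw [Finset.sum_eq_single u (fun i _ hi => by rw [Pi.single_eq_of_ne hi, zero_mul]) (by simp)]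
  simp

/-- The estimate is the orthogonal projection of the variable `u` onto the form `c`, so the energy
of the error is `1 - ‖c u‖ ^ 2 / power c`. -/
theorem sum_norm_sq_estError {c : κ → ℂ} {u : κ} (h : 0 < power c - ‖c u‖ ^ 2) :
    ∑ i, ‖estError c u i‖ ^ 2 = estVar c u := by
  have hp := power_pos h
  have e : ∀ i, ‖estError c u i‖ ^ 2 = ‖(Pi.single u 1 : κ → ℂ) i‖ ^ 2
      + ‖estCoeff c u‖ ^ 2 * ‖c i‖ ^ 2
      - 2 * ((Pi.single u 1 : κ → ℂ) i * (starRingEnd ℂ) (estCoeff c u * c i)).re := by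
    intro i
    simp only [estError, Pi.sub_apply, Pi.smul_apply, smul_eq_mul, ← Complex.normSq_eq_norm_sq]
    rw [Complex.normSq_sub, Complex.normSq_mul]
  simp_rw [e]
  rw [Finset.sum_sub_distrib, Finset.sum_add_distrib, sum_norm_sq_single, ← Finset.mul_sum,
    ← Finset.mul_sum, ← Complex.re_sum, sum_single_mul u (fun i => (starRingEnd ℂ) (estCoeff c u * c i))]
  have h2 : (starRingEnd ℂ) (estCoeff c u * c u) = ((‖c u‖ ^ 2 / power c : ℝ) : ℂ) := by
    rw [estCoeff, div_mul_eq_mul_div, mul_comm, Complex.mul_conj, Complex.normSq_eq_norm_sq,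
      ← Complex.ofReal_div, Complex.conj_ofReal]
  have h3 : ‖estCoeff c u‖ ^ 2 = ‖c u‖ ^ 2 / power c ^ 2 := by
    rw [estCoeff, norm_div, RCLike.norm_conj, Complex.norm_real, Real.norm_of_nonneg hp.le, div_pow]
  rw [h2, h3, Complex.ofReal_re, estVar]
  change 1 + ‖c u‖ ^ 2 / power c ^ 2 * power c - _ = _
  field_simp
  ring

/-- If the energies of the variable and of the estimation error are typical, the score is large. -/
theorem sum_score_ge {c : κ → ℂ} {u : κ} (h : 0 < power c - ‖c u‖ ^ 2) {n : ℕ} (x : Fin n → κ → ℂ)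
    {ε : ℝ}
    (h1 : |∑ j, ‖∑ i, (Pi.single u 1 : κ → ℂ) i * x j i‖ ^ 2
      - n * ∑ i, ‖(Pi.single u 1 : κ → ℂ) i‖ ^ 2| ≤ ε * n)
    (h2 : |∑ j, ‖∑ i, estError c u i * x j i‖ ^ 2 - n * ∑ i, ‖estError c u i‖ ^ 2| ≤ ε * n) :
    n * (-Real.log (estVar c u) - ε * (1 + 1 / estVar c u))
      ≤ ∑ j, score (estCoeff c u) (estVar c u) (x j u) (∑ i, c i * x j i) := by
  have hv := estVar_pos h
  rw [sum_norm_sq_single] at h1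
  rw [sum_norm_sq_estError h] at h2
  have e1 : ∀ j, ∑ i, (Pi.single u 1 : κ → ℂ) i * x j i = x j u := fun j =>
    sum_single_mul u (x j)
  have e2 : ∀ j, ∑ i, estError c u i * x j i = x j u - estCoeff c u * ∑ i, c i * x j i := fun j => by
    simp only [estError, Pi.sub_apply, Pi.smul_apply, smul_eq_mul, sub_mul, Finset.sum_sub_distrib,
      e1, Finset.mul_sum, mul_assoc]
  simp_rw [e1] at h1
  simp_rw [e2] at h2
  unfold score
  rw [Finset.sum_neg_distrib, Finset.sum_sub_distrib, Finset.sum_add_distrib, ← Finset.sum_div]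
  simp only [Finset.sum_const, Finset.card_univ, Fintype.card_fin, nsmul_eq_mul]
  have h1' := (abs_le.mp h1).1
  have h2' := (abs_le.mp h2).2
  have h3 : (∑ j, ‖x j u - estCoeff c u * ∑ i, c i * x j i‖ ^ 2) / estVar c u
      ≤ (n * estVar c u + ε * n) / estVar c u :=
    div_le_div_of_nonneg_right (by linarith) hv.le
  have h4 : (n * estVar c u + ε * n) / estVar c u = n + n * ε * (1 / estVar c u) := by
    field_simp
  nlinarith

end LinearEstimation

/-! ### Random codebooks and the two error events. -/

section RandomCode

open Classical in
/-- The unique element of a set of messages, if there is one. -/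
noncomputable def pick {m : ℕ} (hm : 0 < m) (S : Fin m → Prop) : Fin m :=
  if h : ∃ i, ∀ i', S i' ↔ i' = i then h.choose else ⟨0, hm⟩

theorem pick_eq {m : ℕ} (hm : 0 < m) {S : Fin m → Prop} {i : Fin m} (h : ∀ i', S i' ↔ i' = i) :
    pick hm S = i := by
  have h' : ∃ i, ∀ i', S i' ↔ i' = i := ⟨i, h⟩
  rw [pick, dif_pos h']
  exact (h _).mp ((h'.choose_spec _).mpr rfl)

/-- The indices of the letters of all codewords. -/
abbrev CodeIdx (n : ℕ) (L : Fin 3 → ℕ) : Type := (Fin 2 × (Σ t : Fin 3, Fin (L t))) × Fin n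

variable {n N : ℕ} {L : Fin 3 → ℕ}

/-- The scheme with codebooks `x` whose decoders compare scores to the thresholds `θ`. -/
noncomputable def codebookScheme (gd gc a b : ℂ) (hL : ∀ t, 0 < L t) (θ : Fin 3 → ℝ)
    (x : CodeIdx n L → ℂ) : Scheme n L where
  gd := gd
  gc := gc
  a := a
  b := b
  cb k t m j := x ((k, ⟨t, m⟩), j)
  decide k T y := pick (hL _) fun m => θ (testKind T) ≤
    ∑ j, score (estCoeff (testCoeff gd gc a b k T) (testIdx k T))
      (estVar (testCoeff gd gc a b k T) (testIdx k T))
      (x ((Scheme.testUser k T, ⟨testKind T, m⟩), j)) (y j)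
  measurable_decide k T := by
    -- The decision factors through the finitely many outcomes of the threshold comparisons.
    refine (measurable_of_countable (pick (hL _))).comp (measurable_pi_lambda _ fun m => ?_)
    refine measurableSet_setOfPred.mp (measurableSet_le measurable_const ?_)
    fun_prop

/-- The index of a variable that occurs when the messages are `v`. -/
def varIdx (hN : 2 * n ≤ N) (v : Fin 2 → (t : Fin 3) → Fin (L t)) (p : Fin n × (Fin 2 × Fin 5)) :
    CodeIdx n L ⊕ (Fin 2 × Fin N) :=
  if h : p.2.2.val < 3 then .inl ((p.2.1, ⟨⟨p.2.2.val, h⟩, v p.2.1 _⟩), p.1)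
  else if p.2.2 = 3 then .inr (p.2.1, ⟨p.1, by omega⟩) else .inr (p.2.1, ⟨n + p.1, by omega⟩)

/-- For fixed messages, the variables met by the tests sit at distinct coordinates of one i.i.d.
family, hence are themselves i.i.d. -/
theorem varIdx_injective (hN : 2 * n ≤ N) (v : Fin 2 → (t : Fin 3) → Fin (L t)) :
    Function.Injective (varIdx hN v) := by
  rintro ⟨j, l, t⟩ ⟨j', l', t'⟩ h
  unfold varIdx at h
  simp only at h
  have ht := t.isLt
  have ht' := t'.isLt
  have hj := j.isLt
  have hj' := j'.isLt
  have e3 : ∀ t : Fin 5, t = 3 ↔ t.val = 3 := fun t => Fin.ext_iff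
  split_ifs at h with h1 h2 h3 h4 h5 h6 h7 <;>
    simp only [Sum.inl.injEq, Sum.inr.injEq, Prod.mk.injEq, Sigma.mk.injEq,
      Fin.ext_iff, e3] at * <;> omega

/-- The variables that occur when the messages are `v`. -/
noncomputable def vars (hN : 2 * n ≤ N) (v : Fin 2 → (t : Fin 3) → Fin (L t))
    (ω : CodeIdx n L ⊕ (Fin 2 × Fin N) → ℂ) (j : Fin n) (i : Fin 2 × Fin 5) : ℂ :=
  if i.2 = 4 then (starRingEnd ℂ) (ω (varIdx hN v (j, i))) else ω (varIdx hN v (j, i))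

theorem measurePreserving_vars (hN : 2 * n ≤ N) (v : Fin 2 → (t : Fin 3) → Fin (L t)) :
    MeasurePreserving (vars hN v) (Measure.pi fun _ => stdComplexGaussian)
      (Measure.pi fun _ => Measure.pi fun _ => stdComplexGaussian) := by
  have h1 := measurePreserving_comp_injective stdComplexGaussian (varIdx_injective hN v)
  have h2 : MeasurePreserving (fun (x : Fin n × (Fin 2 × Fin 5) → ℂ) p =>
      if p.2.2 = 4 then (starRingEnd ℂ) (x p) else x p) (Measure.pi fun _ => stdComplexGaussian)
      (Measure.pi fun _ => stdComplexGaussian) := by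
    refine measurePreserving_pi _ _ (f := fun (p : Fin n × (Fin 2 × Fin 5)) (z : ℂ) =>
      if p.2.2 = 4 then (starRingEnd ℂ) z else z) fun p => ?_
    by_cases h : p.2.2 = 4
    · simp only [h, if_true]
      exact measurePreserving_conj_stdComplexGaussian
    · simp only [h, if_false]
      exact MeasurePreserving.id _
  exact (measurePreserving_curry stdComplexGaussian).comp (h2.comp h1)

/-- The letters of a codeword that is not sent are coordinates that no `varIdx` hits, so this
codeword is independent of the statistic. -/
theorem measure_wrong_codeword_le (hN : 2 * n ≤ N) (v : Fin 2 → (t : Fin 3) → Fin (L t))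
    (c : Fin 2 × Fin 5 → ℂ) (l : Fin 2) (t : Fin 3) (m : Fin (L t)) (hm : m ≠ v l t) (μ : ℂ) {σ : ℝ}
    (hσ : 0 < σ) (θ : ℝ) :
    (Measure.pi fun _ : CodeIdx n L ⊕ (Fin 2 × Fin N) => stdComplexGaussian)
      {ω | θ ≤ ∑ j, score μ σ (ω (.inl ((l, ⟨t, m⟩), j))) (∑ i, c i * vars hN v ω j i)}
      ≤ ENNReal.ofReal (Real.exp (-θ)) := by
  have he : Function.Injective fun j : Fin n =>
      (Sum.inl ((l, ⟨t, m⟩), j) : CodeIdx n L ⊕ (Fin 2 × Fin N)) := fun j j' h => by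
    simpa using h
  have hd : ∀ (j : Fin n) p, (Sum.inl ((l, ⟨t, m⟩), j) : CodeIdx n L ⊕ (Fin 2 × Fin N))
      ≠ varIdx hN v p := by
    rintro j ⟨j', l', t'⟩ h
    unfold varIdx at h
    split_ifs at h with h1
    simp only [Sum.inl.injEq, Prod.mk.injEq, Sigma.mk.injEq] at h
    obtain ⟨⟨rfl, rfl, h3⟩, -⟩ := h
    exact hm (eq_of_heq h3)
  have hU := measurePreserving_comp_injective stdComplexGaussian he
  have hI := indepFun_comp_of_disjoint stdComplexGaussian _ (varIdx hN v) hd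
  have hψ : Measurable fun (x : Fin n × (Fin 2 × Fin 5) → ℂ) (j : Fin n) =>
      ∑ i, c i * (if i.2 = 4 then (starRingEnd ℂ) (x (j, i)) else x (j, i)) := by
    refine measurable_pi_lambda _ fun j => Finset.measurable_sum _ fun i _ => ?_
    refine Measurable.const_mul ?_ _
    split_ifs
    · exact Complex.continuous_conj.measurable.comp (measurable_pi_apply _)
    · exact measurable_pi_apply _
  have hI' := hI.comp measurable_id hψ
  refine measure_score_ge_le hU (Y := fun ω j => ∑ i, c i * vars hN v ω j i) ?_ hI' μ hσ θ
  have := (measurePreserving_vars hN v).measurable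
  fun_prop

/-- The linear forms whose energies have to be typical. -/
noncomputable def typicalForms (gd gc a b : ℂ) : Set (Fin 2 × Fin 5 → ℂ) :=
  (Set.range (wordCoeff₁ a b) ∪ Set.range (wordCoeff₂ a b)) ∪
    ((Set.range fun u => Pi.single u 1) ∪
      Set.range fun p : Fin 2 × Fin 5 => estError (testCoeff gd gc a b p.1 p.2) (testIdx p.1 p.2))

theorem finite_typicalForms (gd gc a b : ℂ) : (typicalForms gd gc a b).Finite :=
  ((Set.finite_range _).union (Set.finite_range _)).union
    ((Set.finite_range _).union (Set.finite_range _))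

/-- The event that some energy is not typical. -/
def atypical (gd gc a b : ℂ) (ε : ℝ) (hN : 2 * n ≤ N) (v : Fin 2 → (t : Fin 3) → Fin (L t)) :
    Set (CodeIdx n L ⊕ (Fin 2 × Fin N) → ℂ) :=
  {ω | ∃ q ∈ typicalForms gd gc a b,
    ε * n ≤ |∑ j, ‖∑ i, q i * vars hN v ω j i‖ ^ 2 - n * ∑ i, ‖q i‖ ^ 2|}

/-- The event that a wrong codeword passes a test. -/
def confused (gd gc a b : ℂ) (θ : Fin 3 → ℝ) (hN : 2 * n ≤ N)
    (v : Fin 2 → (t : Fin 3) → Fin (L t)) : Set (CodeIdx n L ⊕ (Fin 2 × Fin N) → ℂ) :=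
  ⋃ p : Fin 2 × Fin 5, ⋃ m ∈ Finset.univ.erase (v (Scheme.testUser p.1 p.2) (testKind p.2)),
    {ω | θ (testKind p.2) ≤ ∑ j, score (estCoeff (testCoeff gd gc a b p.1 p.2) (testIdx p.1 p.2))
      (estVar (testCoeff gd gc a b p.1 p.2) (testIdx p.1 p.2))
      (ω (.inl ((Scheme.testUser p.1 p.2, ⟨testKind p.2, m⟩), j)))
      (∑ i, testCoeff gd gc a b p.1 p.2 i * vars hN v ω j i)}

/-- Union bound: each of the ten tests has at most `exp (n * (rate - 2 * δ))` wrong codewords, and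
each passes with probability at most `exp (-n * (rate - δ))`. -/
theorem measure_confused_le {gd gc a b : ℂ} (hpow : ∀ k T, 0 < power (testCoeff gd gc a b k T)
      - ‖testCoeff gd gc a b k T (testIdx k T)‖ ^ 2)
    {rate : Fin 3 → ℝ} {δ : ℝ} (hL : ∀ t, (L t : ℝ) - 1 ≤ Real.exp (n * (rate t - 2 * δ)))
    (hN : 2 * n ≤ N) (v : Fin 2 → (t : Fin 3) → Fin (L t)) :
    (Measure.pi fun _ => stdComplexGaussian)
      (confused gd gc a b (fun t => n * (rate t - δ)) hN v)
      ≤ ENNReal.ofReal (10 * Real.exp (-(n * δ))) := by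
  have hp : ∀ p : Fin 2 × Fin 5, (Measure.pi fun _ => stdComplexGaussian)
      (⋃ m ∈ Finset.univ.erase (v (Scheme.testUser p.1 p.2) (testKind p.2)),
      {ω : CodeIdx n L ⊕ (Fin 2 × Fin N) → ℂ | (n : ℝ) * (rate (testKind p.2) - δ) ≤
      ∑ j, score (estCoeff (testCoeff gd gc a b p.1 p.2) (testIdx p.1 p.2))
      (estVar (testCoeff gd gc a b p.1 p.2) (testIdx p.1 p.2))
      (ω (.inl ((Scheme.testUser p.1 p.2, ⟨testKind p.2, m⟩), j)))
      (∑ i, testCoeff gd gc a b p.1 p.2 i * vars hN v ω j i)}) ≤ ENNReal.ofReal (Real.exp (-(n * δ))) := by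
    intro p
    refine (measure_biUnion_finset_le _ _).trans ((Finset.sum_le_sum fun m hm =>
      measure_wrong_codeword_le hN v _ _ _ m (Finset.ne_of_mem_erase hm) _
        (estVar_pos (hpow p.1 p.2)) _).trans ?_)
    rw [Finset.sum_const, nsmul_eq_mul, Finset.card_erase_of_mem (Finset.mem_univ _),
      Finset.card_univ, Fintype.card_fin, ← ENNReal.ofReal_natCast,
      ← ENNReal.ofReal_mul (by positivity)]
    refine ENNReal.ofReal_le_ofReal ?_
    have h1 : 1 ≤ L (testKind p.2) := Nat.one_le_iff_ne_zero.mpr fun h =>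
      (h ▸ v (Scheme.testUser p.1 p.2) (testKind p.2)).elim0
    rw [Nat.cast_sub h1, Nat.cast_one]
    refine (mul_le_mul_of_nonneg_right (hL _) (Real.exp_pos _).le).trans (le_of_eq ?_)
    rw [← Real.exp_add]
    congr 1
    ring
  refine (measure_iUnion_fintype_le _ _).trans ((Finset.sum_le_sum fun p _ => hp p).trans ?_)
  rw [Finset.sum_const, nsmul_eq_mul, ENNReal.ofReal_mul (by norm_num)]
  simp

/-- Outside of the two error events, the code decodes correctly. -/
theorem dec_eq_of_typical {gd gc a b : ℂ} (hpow : ∀ k T, 0 < power (testCoeff gd gc a b k T)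
      - ‖testCoeff gd gc a b k T (testIdx k T)‖ ^ 2)
    {rate : Fin 3 → ℝ} {δ ε : ℝ} (hrate : ∀ k T, rate (testKind T)
      ≤ -Real.log (estVar (testCoeff gd gc a b k T) (testIdx k T)))
    (hε : ∀ k T, ε * (1 + 1 / estVar (testCoeff gd gc a b k T) (testIdx k T)) ≤ δ)
    (hab : ‖a‖ ^ 2 + ‖b‖ ^ 2 + ε ≤ 1) (hL : ∀ t, 0 < L t)
    (hN : 2 * n ≤ N) (v : Fin 2 → (t : Fin 3) → Fin (L t))
    (w : Fin 2 → Fin (∏ t, L t)) (hw : ∀ k, w k = finPiFinEquiv (v k))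
    {ω : CodeIdx n L ⊕ (Fin 2 × Fin N) → ℂ} (h1 : ω ∉ atypical gd gc a b ε hN v)
    (h2 : ω ∉ confused gd gc a b (fun t => n * (rate t - δ)) hN v) (k : Fin 2) :
    ((codebookScheme gd gc a b hL (fun t => n * (rate t - δ)) fun i => ω (.inl i)).code hN).dec k
      (fun i => ((codebookScheme gd gc a b hL (fun t => n * (rate t - δ))
        fun i => ω (.inl i)).code hN).output gd gc w (fun k i => ω (.inr (k, i))) i k) = w k := by
  set s := codebookScheme gd gc a b hL (fun t => n * (rate t - δ)) fun i => ω (.inl i) with hs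
  have htyp : ∀ q ∈ typicalForms gd gc a b,
      |∑ j, ‖∑ i, q i * vars hN v ω j i‖ ^ 2 - n * ∑ i, ‖q i‖ ^ 2| ≤ ε * n := by
    intro q hq
    by_contra hc
    exact h1 ⟨q, hq, (not_le.mp hc).le⟩
  have hconf : ∀ (k : Fin 2) (T : Fin 5) m, m ≠ v (Scheme.testUser k T) (testKind T) →
      ¬ (n * (rate (testKind T) - δ) ≤
        ∑ j, score (estCoeff (testCoeff gd gc a b k T) (testIdx k T))
        (estVar (testCoeff gd gc a b k T) (testIdx k T))
        (ω (.inl ((Scheme.testUser k T, ⟨testKind T, m⟩), j)))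
        (∑ i, testCoeff gd gc a b k T i * vars hN v ω j i)) := by
    intro k T m hm hc
    exact h2 (Set.mem_iUnion.mpr ⟨(k, T), Set.mem_iUnion₂.mpr
      ⟨m, Finset.mem_erase.mpr ⟨hm, Finset.mem_univ _⟩, hc⟩⟩)
  have hidx : ∀ (k : Fin 2) (T : Fin 5) (j : Fin n), vars hN v ω j (testIdx k T) = ω (.inl
      ((Scheme.testUser k T, ⟨testKind T, v (Scheme.testUser k T) (testKind T)⟩), j)) := by
    intro k T j
    have hlt : (testIdx k T).2.val < 3 := (testKind T).isLt
    have hne : (testIdx k T).2 ≠ 4 := fun h => by rw [h] at hlt; exact absurd hlt (by decide)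
    rw [vars, if_neg hne, varIdx, dif_pos hlt]
    rfl
  have x0 : ∀ (j : Fin n) (l : Fin 2), vars hN v ω j (l, 0) = s.cb l 0 (v l 0) j := fun _ _ => rfl
  have x1 : ∀ (j : Fin n) (l : Fin 2), vars hN v ω j (l, 1) = s.cb l 1 (v l 1) j := fun _ _ => rfl
  have x2 : ∀ (j : Fin n) (l : Fin 2), vars hN v ω j (l, 2) = s.cb l 2 (v l 2) j := fun _ _ => rfl
  refine s.dec_code_eq hN w (fun k i => ω (.inr (k, i))) v hw
    (fun l j => vars hN v ω j (l, 3)) (fun l j => vars hN v ω j (l, 4)) (fun _ _ => rfl)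
    (fun _ _ => rfl) (fun k => ?_) (fun k => ?_) (fun k T => ?_) k
  · have h := htyp (wordCoeff₁ a b k) (.inl (.inl ⟨k, rfl⟩))
    rw [sum_norm_sq_wordCoeff₁] at h
    have e : ∀ j, s.word₁ k (v k) j = ∑ i, wordCoeff₁ a b k i * vars hN v ω j i := fun j =>
      s.word₁_eq v k j _ (x0 j) (x1 j)
    simp_rw [e]
    have h' := (abs_le.mp h).2
    have : (n : ℝ) * (‖a‖ ^ 2 + ‖b‖ ^ 2 + ε) ≤ n * 1 := mul_le_mul_of_nonneg_left hab (by positivity)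
    linarith
  · have h := htyp (wordCoeff₂ a b k) (.inl (.inr ⟨k, rfl⟩))
    rw [sum_norm_sq_wordCoeff₂] at h
    have e : ∀ j, s.word₂ k (v k) (v (other k) 0) j = ∑ i, wordCoeff₂ a b k i * vars hN v ω j i :=
      fun j => s.word₂_eq v k j _ (x0 j) (x2 j)
    simp_rw [e]
    have h' := (abs_le.mp h).2
    have : (n : ℝ) * (‖a‖ ^ 2 + ‖b‖ ^ 2 + ε) ≤ n * 1 := mul_le_mul_of_nonneg_left hab (by positivity)
    linarith
  · have e : ∀ j, s.statistic v (fun l j => vars hN v ω j (l, 3)) (fun l j => vars hN v ω j (l, 4)) k T j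
        = ∑ i, testCoeff gd gc a b k T i * vars hN v ω j i := fun j =>
      s.statistic_eq v _ _ k T j _ (x0 j) (x1 j) (x2 j) (fun _ => rfl) (fun _ => rfl)
    refine pick_eq _ fun m => ?_
    simp_rw [e]
    refine ⟨fun h => ?_, ?_⟩
    · by_contra hm
      exact hconf k T m hm h
    · rintro rfl
      -- Typical energies cost the true codeword at most `ε * (1 + 1 / v) ≤ δ` per letter, so it
      -- stays above the threshold `n * (rate - δ)`.
      have h := sum_score_ge (hpow k T) (vars hN v ω) (ε := ε) (htyp _ (.inr (.inl ⟨_, rfl⟩)))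
        (htyp _ (.inr (.inr ⟨(k, T), rfl⟩)))
      simp only [hidx] at h
      refine le_trans ?_ h
      refine mul_le_mul_of_nonneg_left ?_ (by positivity)
      have := hrate k T
      have := hε k T
      linarith

end RandomCode

/-! ### Averaging over codebooks. -/

section Averaging

variable {n N : ℕ} {L : Fin 3 → ℕ}

/-- Codebooks and noise together are one family of independent variables. -/
theorem measurePreserving_codebook_noise (κ : Type*) [Fintype κ] (N : ℕ) :
    MeasurePreserving (fun (p : (κ → ℂ) × (Fin 2 → Fin N → ℂ)) (i : κ ⊕ (Fin 2 × Fin N)) =>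
      (Sum.elim p.1 (fun q => p.2 q.1 q.2) i : ℂ))
      ((Measure.pi fun _ => stdComplexGaussian).prod (noiseLaw N))
      (Measure.pi fun _ => stdComplexGaussian) := by
  have h1 := measurePreserving_sumPiEquivProdPi_symm (X := fun _ : κ ⊕ (Fin 2 × Fin N) => ℂ)
    (fun _ => stdComplexGaussian)
  have h2 : MeasurePreserving (MeasurableEquiv.curry (Fin 2) (Fin N) ℂ).symm (noiseLaw N)
      (Measure.pi fun _ => stdComplexGaussian) :=
    (measurePreserving_curry stdComplexGaussian).symm (MeasurableEquiv.curry (Fin 2) (Fin N) ℂ)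
  have h3 := h1.comp ((MeasurePreserving.id _).prod h2)
  convert h3 using 1
  funext p i
  rcases i with i | i <;> rfl

/-- Random coding: for every message pair, the probability of a bad event over codebooks and noise
jointly obeys the same bound. Hence so does its average over messages, and some fixed codebook does
at least as well as the mean over codebooks. -/
theorem exists_code_of_tests {gd gc a b : ℂ} (hpow : ∀ k T, 0 < power (testCoeff gd gc a b k T)
      - ‖testCoeff gd gc a b k T (testIdx k T)‖ ^ 2)
    {rate : Fin 3 → ℝ} {δ ε : ℝ} (hrate : ∀ k T, rate (testKind T)
      ≤ -Real.log (estVar (testCoeff gd gc a b k T) (testIdx k T)))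
    (hε : ∀ k T, ε * (1 + 1 / estVar (testCoeff gd gc a b k T) (testIdx k T)) ≤ δ)
    (hab : ‖a‖ ^ 2 + ‖b‖ ^ 2 + ε ≤ 1) (hL : ∀ t, 0 < L t)
    (hLr : ∀ t, (L t : ℝ) - 1 ≤ Real.exp (n * (rate t - 2 * δ)))
    (hN : 2 * n ≤ N) {η : ℝ≥0∞}
    (hη : (Measure.pi fun _ : Fin n => Measure.pi fun _ : Fin 2 × Fin 5 => stdComplexGaussian)
      {x | ∃ q ∈ typicalForms gd gc a b, ε * n ≤ |∑ j, ‖∑ i, q i * x j i‖ ^ 2 - n * ∑ i, ‖q i‖ ^ 2|}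
      ≤ η) :
    ∃ c : FeedbackCode N (fun _ => ∏ t, L t), c.PowerConstraint gd gc ∧
      c.errorProb gd gc ≤ η + ENNReal.ofReal (10 * Real.exp (-(n * δ))) := by
  set P : Measure (CodeIdx n L ⊕ (Fin 2 × Fin N) → ℂ) := Measure.pi fun _ => stdComplexGaussian
  set μ : Measure (CodeIdx n L → ℂ) := Measure.pi fun _ => stdComplexGaussian
  set Ψ : (CodeIdx n L → ℂ) × (Fin 2 → Fin N → ℂ) → (CodeIdx n L ⊕ (Fin 2 × Fin N) → ℂ) :=
    fun p i => Sum.elim p.1 (fun q => p.2 q.1 q.2) i with hΨdef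
  have hΨ : MeasurePreserving Ψ (μ.prod (noiseLaw N)) P :=
    measurePreserving_codebook_noise (CodeIdx n L) N
  let v : (Fin 2 → Fin (∏ t, L t)) → Fin 2 → (t : Fin 3) → Fin (L t) :=
    fun w k => finPiFinEquiv.symm (w k)
  -- The measurable hull has the same measure and allows Tonelli's theorem without proving the error
  -- events measurable.
  let B : (Fin 2 → Fin (∏ t, L t)) → Set (CodeIdx n L ⊕ (Fin 2 × Fin N) → ℂ) := fun w =>
    toMeasurable P (atypical gd gc a b ε hN (v w) ∪
      confused gd gc a b (fun t => n * (rate t - δ)) hN (v w))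
  have hBm : ∀ w, MeasurableSet (B w) := fun w => measurableSet_toMeasurable _ _
  have hB : ∀ w, P (B w) ≤ η + ENNReal.ofReal (10 * Real.exp (-(n * δ))) := by
    intro w
    rw [measure_toMeasurable]
    refine (measure_union_le _ _).trans (add_le_add ?_ (measure_confused_le hpow hLr hN (v w)))
    have h := measurePreserving_vars hN (v w)
    refine le_trans (le_of_eq ?_) hη
    rw [← h.map_eq, Measure.map_apply h.measurable]
    · rfl
    · have : {x : Fin n → Fin 2 × Fin 5 → ℂ | ∃ q ∈ typicalForms gd gc a b,
          ε * n ≤ |∑ j, ‖∑ i, q i * x j i‖ ^ 2 - n * ∑ i, ‖q i‖ ^ 2|}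
          = ⋃ q ∈ typicalForms gd gc a b,
          {x | ε * n ≤ |∑ j, ‖∑ i, q i * x j i‖ ^ 2 - n * ∑ i, ‖q i‖ ^ 2|} := by
        ext; simp
      rw [this]
      refine (finite_typicalForms gd gc a b).measurableSet_biUnion fun q _ => ?_
      exact measurableSet_le measurable_const (by fun_prop)
  set K : ℝ≥0∞ := ((∏ t, L t : ℕ) : ℝ≥0∞) * ((∏ t, L t : ℕ) : ℝ≥0∞) with hK
  have hKpos : ∏ t, L t ≠ 0 := (Finset.prod_pos fun t _ => hL t).ne'
  have hK0 : K ≠ 0 := mul_ne_zero (Nat.cast_ne_zero.mpr hKpos) (Nat.cast_ne_zero.mpr hKpos)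
  have hKt : K ≠ ∞ := ENNReal.mul_ne_top (ENNReal.natCast_ne_top _) (ENNReal.natCast_ne_top _)
  set f : (CodeIdx n L → ℂ) → ℝ≥0∞ := fun x =>
    K⁻¹ * ∑ w, noiseLaw N (Prod.mk x ⁻¹' (Ψ ⁻¹' B w)) with hf
  have hfm : ∀ w, Measurable fun x => noiseLaw N (Prod.mk x ⁻¹' (Ψ ⁻¹' B w)) := fun w =>
    measurable_measure_prodMk_left (hΨ.measurable (hBm w))
  have hint : ∫⁻ x, f x ∂μ ≤ η + ENNReal.ofReal (10 * Real.exp (-(n * δ))) := by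
    rw [hf, lintegral_const_mul _ (Finset.measurable_sum _ fun w _ => hfm w),
      lintegral_finsetSum _ fun w _ => hfm w]
    have : ∀ w, ∫⁻ x, noiseLaw N (Prod.mk x ⁻¹' (Ψ ⁻¹' B w)) ∂μ
        ≤ η + ENNReal.ofReal (10 * Real.exp (-(n * δ))) := fun w => by
      rw [← Measure.prod_apply (hΨ.measurable (hBm w)), hΨ.measure_preimage (hBm w).nullMeasurableSet]
      exact hB w
    refine (mul_le_mul_right (Finset.sum_le_sum fun w _ => this w) K⁻¹).trans (le_of_eq ?_)
    rw [Finset.sum_const, nsmul_eq_mul, ← mul_assoc]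
    have hc : (Finset.univ : Finset (Fin 2 → Fin (∏ t, L t))).card = (∏ t, L t) * ∏ t, L t := by
      simp [pow_two]
    rw [hc, Nat.cast_mul, ← hK, ENNReal.inv_mul_cancel hK0 hKt, one_mul]
  obtain ⟨x, hx⟩ := exists_le_lintegral (μ := μ) (f := f)
    ((Finset.measurable_sum _ fun w _ => hfm w).const_mul _).aemeasurable
  set s := codebookScheme gd gc a b hL (fun t => n * (rate t - δ)) x with hs
  refine ⟨s.code hN, s.powerConstraint_code hN hL, le_trans ?_ (hx.trans hint)⟩
  have hset : MeasurableSet {p : (Fin 2 → Fin (∏ t, L t)) × (Fin 2 → Fin N → ℂ) |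
      ∃ k, (s.code hN).dec k (fun i => (s.code hN).output gd gc p.1 p.2 i k) ≠ p.1 k} := by
    have : {p : (Fin 2 → Fin (∏ t, L t)) × (Fin 2 → Fin N → ℂ) |
      ∃ k, (s.code hN).dec k (fun i => (s.code hN).output gd gc p.1 p.2 i k) ≠ p.1 k}
        = ((s.code hN).correctSet gd gc)ᶜ := by
      ext p
      simp only [FeedbackCode.correctSet, Set.mem_ofPred_eq, Set.mem_compl_iff, not_forall, ne_eq]
    rw [this]
    exact ((s.code hN).measurableSet_correctSet gd gc).compl
  unfold FeedbackCode.errorProb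
  rw [← lintegral_indicator_one hset, FeedbackCode.lintegral_law _ (measurable_one.indicator hset)]
  refine mul_le_mul_right (Finset.sum_le_sum fun w _ => ?_) K⁻¹
  have hsec : MeasurableSet (Prod.mk w ⁻¹' {p : (Fin 2 → Fin (∏ t, L t)) × (Fin 2 → Fin N → ℂ) |
      ∃ k, (s.code hN).dec k (fun i => (s.code hN).output gd gc p.1 p.2 i k) ≠ p.1 k}) :=
    measurable_prodMk_left hset
  have e : ∫⁻ z, Set.indicator {p : (Fin 2 → Fin (∏ t, L t)) × (Fin 2 → Fin N → ℂ) |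
      ∃ k, (s.code hN).dec k (fun i => (s.code hN).output gd gc p.1 p.2 i k) ≠ p.1 k} 1 (w, z)
      ∂(noiseLaw N) = noiseLaw N (Prod.mk w ⁻¹' {p : (Fin 2 → Fin (∏ t, L t)) × (Fin 2 → Fin N → ℂ) |
      ∃ k, (s.code hN).dec k (fun i => (s.code hN).output gd gc p.1 p.2 i k) ≠ p.1 k}) := by
    rw [← lintegral_indicator_one hsec]
    rfl
  rw [e]
  refine measure_mono fun z hz => ?_
  by_contra hc
  obtain ⟨k, hk⟩ := hz
  have hc' : Ψ (x, z) ∉ atypical gd gc a b ε hN (v w) ∪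
      confused gd gc a b (fun t => n * (rate t - δ)) hN (v w) := fun h =>
    hc (subset_toMeasurable _ _ h)
  rw [Set.mem_union, not_or] at hc'
  exact hk (dec_eq_of_typical hpow hrate hε hab hL hN (v w) w
    (fun k => (Equiv.apply_symm_apply _ _).symm) hc'.1 hc'.2 k)

end Averaging

/-! ### Comparison of the scheme's rate with the outer bound. -/

section Rates

/-- Each of the two logarithms is bounded at its own best correlation: `ρ = 0` for the first, `ρ =
1` for the second. -/
theorem two_mul_log_mul_outerBound_le {S I : ℝ} (hS : 0 ≤ S) (hI : 0 ≤ I) :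
    2 * Real.log 2 * outerBound S I
      ≤ Real.log ((1 + S + I) / (1 + I) * (1 + (√S + √I) ^ 2)) := by
  have hl2 : 0 < Real.log 2 := Real.log_pos (by norm_num)
  have h : sSup (outerFun S I '' Icc 0 1)
      ≤ Real.log ((1 + S + I) / (1 + I) * (1 + (√S + √I) ^ 2)) / Real.log 2 := by
    refine csSup_le ⟨_, mem_image_of_mem _ (left_mem_Icc.mpr zero_le_one)⟩ ?_
    rintro _ ⟨ρ, ⟨h0, h1⟩, rfl⟩
    rw [Real.log_mul (by positivity) (by positivity), add_div]
    have hq0 : 0 ≤ 1 - ρ ^ 2 := by nlinarith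
    have hq1 : 1 - ρ ^ 2 ≤ 1 := by nlinarith
    refine add_le_add ?_ ?_
    · refine Real.logb_le_logb_of_le (by norm_num) (by positivity) ?_
      have : (1 - ρ ^ 2) * S / (1 + (1 - ρ ^ 2) * I) ≤ S / (1 + I) := by
        rw [div_le_div_iff₀ (by positivity) (by positivity)]
        nlinarith
      have e : (1 + S + I) / (1 + I) = 1 + S / (1 + I) := by field_simp; ring
      rw [e]; linarith
    · refine Real.logb_le_logb_of_le (by norm_num) (by positivity) ?_
      rw [add_sq, Real.sq_sqrt hS, Real.sq_sqrt hI, mul_assoc 2 (√S), ← Real.sqrt_mul hS]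
      nlinarith [Real.sqrt_nonneg (S * I)]
  rw [outerBound]
  rw [le_div_iff₀ hl2] at h
  linarith

/-- Here `3.415` is twice the gap `1.7075`. The rational `58 / 17 ≈ 3.412` lies between `log₂ (53 /
5) ≈ 3.406` and it. -/
theorem log_lt_gap : Real.log (53 / 5) < 3.415 * Real.log 2 := by
  have h : Real.log ((53 / 5 : ℝ) ^ 17) < Real.log ((2 : ℝ) ^ 58) :=
    Real.log_lt_log (by positivity) (by norm_num)
  rw [Real.log_pow, Real.log_pow] at h
  push_cast at h
  linarith [Real.log_pos (one_lt_two (α := ℝ))]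

/-- The case of large `INR`, with `x = √S` and `y = √I`. The constant is `10.388 = 53 / 5 * 49 /
50`; for `x ≥ 0` the quotient of the two forms peaks at about 10.05, near `x = 2.1 * y`. -/
theorem quartic_lt {x y : ℝ} (hy : 0 < y) :
    27 * (x ^ 2 + y ^ 2) * (x + y) ^ 2 < 10.388 * (3 * y ^ 2 + 2 * x ^ 2) ^ 2 := by
  nlinarith [sq_nonneg (x ^ 2 - 1.85 * x * y - y ^ 2 / 2), sq_nonneg (y * (x - 1.15 * y)),
    pow_pos hy 4, sq_nonneg (x * y)]

/-- The rates of the two-slot scheme come close to the outer bound. -/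
theorem exists_power_split {S I : ℝ} (hS : 0 ≤ S) (hI : 0 ≤ I) :
    ∃ A B : ℝ, 0 ≤ A ∧ 0 ≤ B ∧ A + B = 49 / 50 ∧
      2 * Real.log 2 * (outerBound S I - 1.7075) <
        Real.log ((1 + I * (A + B)) / (1 + I * B)) + 2 * Real.log ((1 + I * B + S * B) / (1 + I * B)) := by
  suffices h : ∃ B : ℝ, 0 ≤ B ∧ B ≤ 49 / 50 ∧ (1 + S + I) / (1 + I) * (1 + (√S + √I) ^ 2) ≤
      53 / 5 * ((1 + I * (49 / 50)) / (1 + I * B) * ((1 + I * B + S * B) / (1 + I * B)) ^ 2) by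
    obtain ⟨B, hB0, hB1, hle⟩ := h
    refine ⟨49 / 50 - B, B, by linarith, hB0, by ring, ?_⟩
    have h1 := two_mul_log_mul_outerBound_le hS hI
    have h2 := Real.log_le_log (by positivity) hle
    have e (X Y : ℝ) (hX : 0 < X) (hY : 0 < Y) :
        Real.log (53 / 5 * (X * Y ^ 2)) = Real.log (53 / 5) + (Real.log X + 2 * Real.log Y) := by
      rw [Real.log_mul (by norm_num) (by positivity), Real.log_mul hX.ne' (by positivity),
        Real.log_pow]
      norm_num
    rw [e _ _ (by positivity) (by positivity)] at h2
    rw [sub_add_cancel]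
    have := log_lt_gap
    linarith
  have hx := Real.sqrt_nonneg S
  have hy := Real.sqrt_nonneg I
  -- With weak interference all power goes to the private messages. Otherwise `B = 2 / I`: the
  -- private interference arrives at power 2, and together with the noise at power 3.
  by_cases hc : I * (49 / 50) ≤ 2
  · refine ⟨49 / 50, by norm_num, le_rfl, ?_⟩
    have h1 : (√S + √I) ^ 2 ≤ 2 * (S + I) := by
      have := sq_nonneg (√S - √I)
      nlinarith [Real.sq_sqrt hS, Real.sq_sqrt hI]
    have e : 53 / 5 * ((1 + I * (49 / 50)) / (1 + I * (49 / 50)) *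
        ((1 + I * (49 / 50) + S * (49 / 50)) / (1 + I * (49 / 50))) ^ 2)
        = 53 / 5 * (1 + I * (49 / 50) + S * (49 / 50)) ^ 2 / (1 + I * (49 / 50)) ^ 2 := by
      field_simp
    rw [e, div_mul_eq_mul_div, div_le_div_iff₀ (by positivity) (by positivity)]
    have h2 : (1 + S + I) * (1 + (√S + √I) ^ 2) ≤ 2 * (1 + S + I) ^ 2 := by nlinarith
    have h3 : (49 / 50 * (1 + S + I)) ^ 2 ≤ (1 + I * (49 / 50) + S * (49 / 50)) ^ 2 := by
      refine pow_le_pow_left₀ (by positivity) (by linarith) 2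
    have h4 : (1 + I * (49 / 50)) ^ 2 ≤ 3 * (1 + I) := by nlinarith
    calc (1 + S + I) * (1 + (√S + √I) ^ 2) * (1 + I * (49 / 50)) ^ 2
        ≤ 2 * (1 + S + I) ^ 2 * (3 * (1 + I)) := by gcongr
      _ = 6 * (1 + S + I) ^ 2 * (1 + I) := by ring
      _ ≤ 53 / 5 * (49 / 50 * (1 + S + I)) ^ 2 * (1 + I) := by
          have : 0 ≤ (1 + S + I) ^ 2 * (1 + I) := by positivity
          nlinarith
      _ ≤ 53 / 5 * (1 + I * (49 / 50) + S * (49 / 50)) ^ 2 * (1 + I) := by gcongr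
  · have hI0 : 0 < I := by nlinarith
    have hB : I * (2 / I) = 2 := by field_simp
    refine ⟨2 / I, by positivity, ?_, ?_⟩
    · rw [div_le_iff₀ hI0]; linarith
    · rw [hB]
      have hy0 : 0 < √I := Real.sqrt_pos.mpr hI0
      have hq := quartic_lt (x := √S) hy0
      rw [Real.sq_sqrt hS, Real.sq_sqrt hI] at hq
      have h1 : (1 + S + I) / (1 + I) ≤ (S + I) / I := by
        rw [div_le_div_iff₀ (by positivity) hI0]; nlinarith
      have h2 : I ≤ (√S + √I) ^ 2 := by nlinarith [Real.sq_sqrt hI]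
      have h3 : 1 + (√S + √I) ^ 2 ≤ (√S + √I) ^ 2 / I * (1 + I) := by
        rw [div_mul_eq_mul_div, le_div_iff₀ hI0]; linarith
      have h4 : 49 / 50 * (1 + I) ≤ 1 + I * (49 / 50) := by linarith
      calc (1 + S + I) / (1 + I) * (1 + (√S + √I) ^ 2)
          ≤ (S + I) / I * ((√S + √I) ^ 2 / I * (1 + I)) := by gcongr
        _ = (S + I) * (√S + √I) ^ 2 * ((1 + I) / I ^ 2) := by field_simp
        _ ≤ (10.388 / 27 * (3 * I + 2 * S) ^ 2) * ((1 + I) / I ^ 2) := by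
            refine mul_le_mul_of_nonneg_right ?_ (by positivity)
            linarith
        _ = 53 / 5 * (49 / 50 * (1 + I) / 3 * ((1 + 2 + S * (2 / I)) / 3) ^ 2) := by
            field_simp; ring
        _ ≤ 53 / 5 * ((1 + I * (49 / 50)) / (1 + 2) * ((1 + 2 + S * (2 / I)) / (1 + 2)) ^ 2) := by
            norm_num only
            gcongr

end Rates

/-! ### Signal and interference powers of the five tests. -/

section TestPowers

variable (gd gc a b : ℂ) (k : Fin 2)

theorem norm_conj_mul_add : ‖(starRingEnd ℂ) gd * gd + (starRingEnd ℂ) gc * gc‖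
    = ‖gd‖ ^ 2 + ‖gc‖ ^ 2 := by
  rw [mul_comm _ gd, mul_comm _ gc, Complex.mul_conj, Complex.mul_conj, Complex.normSq_eq_norm_sq,
    Complex.normSq_eq_norm_sq, ← Complex.ofReal_add, Complex.norm_real,
    Real.norm_of_nonneg (by positivity)]

theorem power_testCoeff_zero : power (testCoeff gd gc a b k 0)
    = 1 + ‖gc‖ ^ 2 * (‖a‖ ^ 2 + ‖b‖ ^ 2) := by
  simp [power, testCoeff, sum_norm_sq_pairCoeff, Fin.sum_univ_five, mul_pow]
  ring

theorem power_testCoeff_one : power (testCoeff gd gc a b k 1)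
    = (‖gd‖ ^ 2 + ‖gc‖ ^ 2) * (1 + (‖gd‖ ^ 2 + ‖gc‖ ^ 2) * (‖a‖ ^ 2 + ‖b‖ ^ 2)) := by
  simp [power, testCoeff, sum_norm_sq_pairCoeff, Fin.sum_univ_five, mul_pow, norm_conj_mul_add,
    norm_sgn]
  ring

theorem power_testCoeff_two : power (testCoeff gd gc a b k 2)
    = (‖gd‖ ^ 2 + ‖gc‖ ^ 2) * (1 + (‖gd‖ ^ 2 + ‖gc‖ ^ 2) * (‖a‖ ^ 2 + ‖b‖ ^ 2)) := by
  simp [power, testCoeff, sum_norm_sq_pairCoeff, Fin.sum_univ_five, mul_pow, norm_conj_mul_add,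
    norm_sgn]
  ring

theorem power_testCoeff_three : power (testCoeff gd gc a b k 3)
    = 1 + ‖gc‖ ^ 2 * ‖b‖ ^ 2 + ‖gd‖ ^ 2 * ‖b‖ ^ 2 := by
  simp [power, testCoeff, sum_norm_sq_pairCoeff, Fin.sum_univ_five, mul_pow]
  ring

theorem power_testCoeff_four : power (testCoeff gd gc a b k 4)
    = 1 + ‖gc‖ ^ 2 * ‖b‖ ^ 2 + ‖gd‖ ^ 2 * ‖b‖ ^ 2 := by
  simp [power, testCoeff, sum_norm_sq_pairCoeff, Fin.sum_univ_five, mul_pow]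
  ring

theorem testIdx_zero : testIdx k 0 = (other k, 0) := rfl
theorem testIdx_one : testIdx k 1 = (k, 0) := rfl
theorem testIdx_two : testIdx k 2 = (other k, 0) := rfl
theorem testIdx_three : testIdx k 3 = (k, 1) := rfl
theorem testIdx_four : testIdx k 4 = (k, 2) := rfl

/-- The rates of the three kinds of messages of the two-slot scheme. -/
noncomputable def schemeRate (S I A B : ℝ) (t : Fin 3) : ℝ :=
  if t = 0 then Real.log ((1 + I * (A + B)) / (1 + I * B))
  else Real.log ((1 + I * B + S * B) / (1 + I * B))

theorem testCoeff_signal (T : Fin 5) : ‖testCoeff gd gc a b k T (testIdx k T)‖ ^ 2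
    = ![‖gc‖ ^ 2 * ‖a‖ ^ 2, (‖gd‖ ^ 2 + ‖gc‖ ^ 2) ^ 2 * ‖a‖ ^ 2, (‖gd‖ ^ 2 + ‖gc‖ ^ 2) ^ 2 * ‖a‖ ^ 2,
      ‖gd‖ ^ 2 * ‖b‖ ^ 2, ‖gd‖ ^ 2 * ‖b‖ ^ 2] T := by
  fin_cases T
  · simp [testCoeff, testIdx_zero, pairCoeff, other_ne, mul_pow]
  · simp [testCoeff, testIdx_one, pairCoeff, mul_pow, norm_conj_mul_add]
  · simp [testCoeff, testIdx_two, pairCoeff, other_ne, mul_pow, norm_conj_mul_add]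
  · simp [testCoeff, testIdx_three, pairCoeff, mul_pow]
  · simp [testCoeff, testIdx_four, pairCoeff, mul_pow]

/-- The bottleneck for the common rate is the transmitter's test 0, which has gain `INR` only. The
receivers' tests 1 and 2 have the same form with gain `SNR + INR`, and the private tests hold with
equality. -/
theorem noise_pos_and_schemeRate_le (hg : 0 < ‖gd‖ ^ 2 + ‖gc‖ ^ 2) (T : Fin 5) :
    0 < power (testCoeff gd gc a b k T) - ‖testCoeff gd gc a b k T (testIdx k T)‖ ^ 2 ∧
      schemeRate (‖gd‖ ^ 2) (‖gc‖ ^ 2) (‖a‖ ^ 2) (‖b‖ ^ 2) (testKind T)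
        ≤ -Real.log (estVar (testCoeff gd gc a b k T) (testIdx k T)) := by
  have hsig := testCoeff_signal gd gc a b k
  set S := ‖gd‖ ^ 2
  set I := ‖gc‖ ^ 2
  set A := ‖a‖ ^ 2
  set B := ‖b‖ ^ 2
  have hS : 0 ≤ S := sq_nonneg _
  have hI : 0 ≤ I := sq_nonneg _
  have hA : 0 ≤ A := sq_nonneg _
  have hB : 0 ≤ B := sq_nonneg _
  have hcommon : ((S + I) * (1 + (S + I) * (A + B)) - (S + I) ^ 2 * A)
      = (S + I) * (1 + (S + I) * B) := by ring
  -- The function `t ↦ (1 + t * (A + B)) / (1 + t * B)` is increasing, and `I ≤ S + I`.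
  have hr : (1 + I * (A + B)) / (1 + I * B)
      ≤ (S + I) * (1 + (S + I) * (A + B)) / ((S + I) * (1 + (S + I) * B)) := by
    rw [mul_div_mul_left _ _ hg.ne', div_le_div_iff₀ (by positivity) (by positivity)]
    nlinarith [mul_nonneg hS hA]
  have hk0 : testKind 0 = 0 := rfl
  have hk1 : testKind 1 = 0 := rfl
  have hk2 : testKind 2 = 0 := rfl
  have hk3 : testKind 3 = 1 := rfl
  have hk4 : testKind 4 = 2 := rfl
  rw [estVar, ← Real.log_inv, inv_div, hsig T]
  match T with
  | 0 =>
    have e : 1 + I * (A + B) - I * A = 1 + I * B := by ring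
    rw [power_testCoeff_zero]
    simp only [Matrix.cons_val, hk0, schemeRate, if_true]
    rw [e]
    exact ⟨by positivity, le_rfl⟩
  | 1 =>
    rw [power_testCoeff_one]
    simp only [Matrix.cons_val, hk1, schemeRate, if_true]
    rw [hcommon]
    exact ⟨by positivity, Real.log_le_log (by positivity) hr⟩
  | 2 =>
    rw [power_testCoeff_two]
    simp only [Matrix.cons_val, hk2, schemeRate, if_true]
    rw [hcommon]
    exact ⟨by positivity, Real.log_le_log (by positivity) hr⟩
  | 3 =>
    rw [power_testCoeff_three]
    simp only [Matrix.cons_val, hk3, schemeRate, one_ne_zero, if_false]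
    rw [add_sub_cancel_right]
    exact ⟨by positivity, le_rfl⟩
  | 4 =>
    have h20 : (2 : Fin 3) ≠ 0 := by decide
    rw [power_testCoeff_four]
    simp only [Matrix.cons_val, hk4, schemeRate, h20, if_false]
    rw [add_sub_cancel_right]
    exact ⟨by positivity, le_rfl⟩

end TestPowers

/-! ### From the scheme to achievable rates. -/

section Achievability

/-- The code that sends nothing. -/
def silentCode (N : ℕ) {M : Fin 2 → ℕ} (hM : ∀ k, 0 < M k) : FeedbackCode N M where
  enc _ _ _ _ := 0
  measurable_enc _ _ _ := measurable_const
  dec k _ := ⟨0, hM k⟩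
  measurable_dec _ := measurable_const

theorem powerConstraint_silentCode (N : ℕ) {M : Fin 2 → ℕ} (hM : ∀ k, 0 < M k) (gd gc : ℂ) :
    (silentCode N hM).PowerConstraint gd gc := by
  intro k
  simp [FeedbackCode.input, silentCode]

variable {gd gc : ℂ}

theorem achievable_zero : Achievable gd gc (fun _ => 0) := by
  refine ⟨fun _ => le_rfl, fun _ _ => 1, fun N => silentCode N (fun _ => one_pos), ?_,
    fun N => powerConstraint_silentCode N _ gd gc, ?_⟩
  · simp
  · have h (N : ℕ) : (silentCode N (M := fun _ => 1) (fun _ => one_pos)).errorProb gd gc = 0 := by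
      rw [FeedbackCode.errorProb]
      refine measure_mono_null (t := ∅) ?_ measure_empty
      rintro p ⟨k, hk⟩
      exact hk (Subsingleton.elim (α := Fin 1) _ _)
    simp only [h]
    exact tendsto_const_nhds

/-- Codes of small block lengths do not matter for achievability. -/
theorem achievable_of_eventually {R : Fin 2 → ℝ} (hR : ∀ k, 0 ≤ R k) {e : ℕ → ℝ≥0∞}
    (he : Tendsto e atTop (𝓝 0))
    (h : ∀ᶠ N : ℕ in atTop, ∃ (M : Fin 2 → ℕ) (c : FeedbackCode N M),
      (∀ k, (2 : ℝ) ^ ((N : ℝ) * R k) ≤ M k) ∧ c.PowerConstraint gd gc ∧ c.errorProb gd gc ≤ e N) :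
    Achievable gd gc R := by
  obtain ⟨N₀, hN₀⟩ := eventually_atTop.mp h
  -- Below `N₀` only the message count and the power constraint matter, so a silent code with enough
  -- messages will do.
  have h' (N : ℕ) : ∃ (M : Fin 2 → ℕ) (c : FeedbackCode N M),
      (∀ k, (2 : ℝ) ^ ((N : ℝ) * R k) ≤ M k) ∧ c.PowerConstraint gd gc ∧
        (N₀ ≤ N → c.errorProb gd gc ≤ e N) := by
    by_cases hN : N₀ ≤ N
    · obtain ⟨M, c, h1, h2, h3⟩ := hN₀ N hN
      exact ⟨M, c, h1, h2, fun _ => h3⟩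
    · exact ⟨fun k => ⌈(2 : ℝ) ^ ((N : ℝ) * R k)⌉₊,
        silentCode N (fun k => Nat.ceil_pos.mpr (by positivity)), fun k => Nat.le_ceil _,
        powerConstraint_silentCode N _ gd gc, fun h => absurd h hN⟩
  choose M c h1 h2 h3 using h'
  refine ⟨hR, M, c, h1, h2, ?_⟩
  refine tendsto_of_tendsto_of_tendsto_of_le_of_le' tendsto_const_nhds he
    (Eventually.of_forall fun _ => zero_le) ?_
  filter_upwards [eventually_ge_atTop N₀] with N hN using h3 N hN

/-- The codewords use power `49 / 50`. The spare `1 / 50` absorbs the fluctuation `ε` of their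
energy, so that typical codewords are not clamped. -/
theorem exists_slack {A B δ : ℝ} {V : Fin 2 → Fin 5 → ℝ} (hV : ∀ k T, 0 < V k T) (hδ : 0 < δ)
    (hAB : A + B = 49 / 50) :
    ∃ ε : ℝ, 0 < ε ∧ A + B + ε ≤ 1 ∧ ∀ k T, ε * (1 + 1 / V k T) ≤ δ := by
  set K : ℝ := 1 + ∑ k, ∑ T, (1 + 1 / V k T) with hK
  have hterm (k T) : 0 ≤ 1 + 1 / V k T := by have := hV k T; positivity
  have hK1 : 1 ≤ K := by
    have : 0 ≤ ∑ k, ∑ T, (1 + 1 / V k T) :=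
      Finset.sum_nonneg fun k _ => Finset.sum_nonneg fun T _ => hterm k T
    linarith
  have hKT (k T) : 1 + 1 / V k T ≤ K := by
    have h1 := Finset.single_le_sum (f := fun T => 1 + 1 / V k T) (fun T _ => hterm k T)
      (Finset.mem_univ T)
    have h2 := Finset.single_le_sum (f := fun k => ∑ T, (1 + 1 / V k T))
      (fun k _ => Finset.sum_nonneg fun T _ => hterm k T) (Finset.mem_univ k)
    linarith
  have hm : 0 < min δ (1 / 50) := lt_min hδ (by norm_num)
  refine ⟨min δ (1 / 50) / K, by positivity, ?_, fun k T => ?_⟩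
  · have : min δ (1 / 50) / K ≤ 1 / 50 := (div_le_self hm.le hK1).trans (min_le_right _ _)
    linarith
  · calc min δ (1 / 50) / K * (1 + 1 / V k T) ≤ min δ (1 / 50) / K * K := by
          gcongr; exact hKT k T
      _ = min δ (1 / 50) := div_mul_cancel₀ _ (by positivity)
      _ ≤ δ := min_le_left _ _

/-- The two-slot scheme achieves every symmetric rate at most half its total rate. -/
theorem achievable_of_two_mul_lt {a b : ℂ} (hg : 0 < ‖gd‖ ^ 2 + ‖gc‖ ^ 2)
    (hab : ‖a‖ ^ 2 + ‖b‖ ^ 2 = 49 / 50) {R : ℝ} (hR : 0 ≤ R)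
    (hlt : 2 * R * Real.log 2 < ∑ t, schemeRate (‖gd‖ ^ 2) (‖gc‖ ^ 2) (‖a‖ ^ 2) (‖b‖ ^ 2) t) :
    Achievable gd gc (fun _ => R) := by
  set rate := schemeRate (‖gd‖ ^ 2) (‖gc‖ ^ 2) (‖a‖ ^ 2) (‖b‖ ^ 2)
  -- The three kinds of messages lose `2 * δ` each, together half of the slack `12 * δ`. The other
  -- half pays for the rounding of the block length.
  set δ := ((∑ t, rate t) - 2 * R * Real.log 2) / 12 with hδdef
  have hδ : 0 < δ := by rw [hδdef]; linarith
  have hpow k T := (noise_pos_and_schemeRate_le gd gc a b k hg T).1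
  have hrate k T := (noise_pos_and_schemeRate_le gd gc a b k hg T).2
  obtain ⟨ε, hε, habε, hεV⟩ := exists_slack (fun k T => estVar_pos (hpow k T)) hδ hab
  obtain ⟨C, hC, hCn⟩ := exists_measure_energy_le_of_finite (finite_typicalForms gd gc a b) hε
  have hhalf : Tendsto (fun N : ℕ => ((N / 2 : ℕ) : ℝ)) atTop atTop :=
    tendsto_natCast_atTop_atTop.comp (Nat.tendsto_div_const_atTop two_ne_zero)
  refine achievable_of_eventually (fun _ => hR)
    (e := fun N => ENNReal.ofReal (C / (N / 2 : ℕ))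
      + ENNReal.ofReal (10 * Real.exp (-((N / 2 : ℕ) * δ)))) ?_ ?_
  · have h1 := ENNReal.tendsto_ofReal ((tendsto_const_nhds (x := C)).div_atTop hhalf)
    have h2 := ENNReal.tendsto_ofReal ((Real.tendsto_exp_neg_atTop_nhds_zero.comp
      (hhalf.atTop_mul_const hδ)).const_mul 10)
    simpa using h1.add h2
  -- An odd `N` wastes one channel use. Its cost `R * log 2` is covered as soon as `6 * δ * n`
  -- exceeds it.
  · filter_upwards [hhalf.eventually_ge_atTop (R * Real.log 2 / (6 * δ)),
      hhalf.eventually_ge_atTop 1] with N hN1 hN2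
    set n := N / 2
    have hn : 0 < n := by exact_mod_cast (zero_lt_one.trans_le hN2)
    have hNn : (N : ℝ) ≤ 2 * n + 1 := by
      have : N ≤ 2 * n + 1 := by omega
      exact_mod_cast this
    -- The maximum with 0 handles kinds whose rate is below `2 * δ`: they get a single message,
    -- hence no wrong codewords.
    let L (t : Fin 3) : ℕ := ⌈Real.exp (n * max 0 (rate t - 2 * δ))⌉₊
    have hL (t) : 0 < L t := Nat.ceil_pos.mpr (Real.exp_pos _)
    have hLr (t) : (L t : ℝ) - 1 ≤ Real.exp (n * (rate t - 2 * δ)) := by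
      rcases le_total 0 (rate t - 2 * δ) with h | h
      · have := Nat.ceil_lt_add_one (Real.exp_pos (n * max 0 (rate t - 2 * δ))).le
        rw [max_eq_right h] at this
        simp only [L, max_eq_right h]
        linarith
      · simp only [L, max_eq_left h, mul_zero, Real.exp_zero, Nat.ceil_one, Nat.cast_one, sub_self]
        positivity
    obtain ⟨c, hc1, hc2⟩ := exists_code_of_tests hpow hrate hεV habε hL hLr
      (by omega : 2 * n ≤ N) (hCn n hn)
    refine ⟨_, c, fun k => ?_, hc1, hc2⟩
    have hsum : Real.log 2 * (N * R) ≤ ∑ t, n * (rate t - 2 * δ) := by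
      rw [← Finset.mul_sum, Finset.sum_sub_distrib]
      have e : (∑ t, rate t) - ∑ _t : Fin 3, 2 * δ = 2 * R * Real.log 2 + 6 * δ := by
        simp only [Finset.sum_const, Finset.card_univ, Fintype.card_fin, nsmul_eq_mul]
        rw [hδdef]
        push_cast
        ring
      rw [e]
      rw [div_le_iff₀ (by positivity)] at hN1
      have : N * (R * Real.log 2) ≤ (2 * n + 1) * (R * Real.log 2) :=
        mul_le_mul_of_nonneg_right hNn (mul_nonneg hR (Real.log_nonneg (by norm_num)))
      linarith
    calc (2 : ℝ) ^ ((N : ℝ) * R) = Real.exp (Real.log 2 * (N * R)) :=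
          Real.rpow_def_of_pos two_pos _
      _ ≤ Real.exp (∑ t, n * (rate t - 2 * δ)) := Real.exp_le_exp.mpr hsum
      _ = ∏ t, Real.exp (n * (rate t - 2 * δ)) := Real.exp_sum _ _
      _ ≤ ∏ t, (L t : ℝ) := by
          refine Finset.prod_le_prod (fun t _ => (Real.exp_pos _).le) fun t _ => ?_
          refine le_trans (Real.exp_le_exp.mpr ?_) (Nat.le_ceil _)
          gcongr
          exact le_max_right _ _
      _ = ((∏ t, L t : ℕ) : ℝ) := by push_cast; rfl

theorem achievable_of_le_outerBound {R : ℝ} (hR : 0 ≤ R)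
    (h : R ≤ outerBound (‖gd‖ ^ 2) (‖gc‖ ^ 2) - 1.7075) : Achievable gd gc (fun _ => R) := by
  have hl2 : 0 < Real.log 2 := Real.log_pos (by norm_num)
  have hS := sq_nonneg ‖gd‖
  have hI := sq_nonneg ‖gc‖
  -- If both gains vanish, the outer bound is at most 0 and no `R ≥ 0` satisfies `h`.
  have hg : 0 < ‖gd‖ ^ 2 + ‖gc‖ ^ 2 := by
    by_contra h0
    have hS0 : ‖gd‖ ^ 2 = 0 := by linarith
    have hI0 : ‖gc‖ ^ 2 = 0 := by linarith
    have hb := two_mul_log_mul_outerBound_le hS hI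
    rw [hS0, hI0] at hb h
    norm_num at hb
    nlinarith
  obtain ⟨A, B, hA, hB, hAB, hlt⟩ := exists_power_split hS hI
  have hnorm {x : ℝ} (hx : 0 ≤ x) : ‖((√x : ℝ) : ℂ)‖ ^ 2 = x := by
    rw [Complex.norm_real, Real.norm_of_nonneg (Real.sqrt_nonneg x), Real.sq_sqrt hx]
  refine achievable_of_two_mul_lt (a := (√A : ℝ)) (b := (√B : ℝ)) hg ?_ hR ?_
  · rw [hnorm hA, hnorm hB, hAB]
  · rw [hnorm hA, hnorm hB, Fin.sum_univ_three]
    have h10 : (1 : Fin 3) ≠ 0 := by decide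
    have h20 : (2 : Fin 3) ≠ 0 := by decide
    simp only [schemeRate, if_true, h10, h20, if_false]
    nlinarith

end Achievability

end GaussianIFC

theorem theorem4 (SNR INR : ℝ) (gd gc : ℂ) (hSNR : SNR = ‖gd‖ ^ 2) (hINR : INR = ‖gc‖ ^ 2) :
    (∀ R : ℝ, 0 ≤ R → R ≤ GaussianIFC.outerBound SNR INR - 1.7075 →
      GaussianIFC.Achievable gd gc (fun _ => R)) ∧
    (GaussianIFC.symRates gd gc).Nonempty ∧ BddAbove (GaussianIFC.symRates gd gc) ∧
    GaussianIFC.outerBound SNR INR - 1.7075 ≤ GaussianIFC.symCapacity gd gc ∧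
    GaussianIFC.symCapacity gd gc ≤ GaussianIFC.outerBound SNR INR := by
  subst hSNR hINR
  have hach {R : ℝ} (h : GaussianIFC.Achievable gd gc (fun _ => R)) :
      R ∈ GaussianIFC.symRates gd gc := subset_closure h
  have hzero := hach GaussianIFC.achievable_zero
  have hbdd : BddAbove (GaussianIFC.symRates gd gc) :=
    ⟨_, fun _ => GaussianIFC.le_outerBound_of_mem_symRates⟩
  refine ⟨fun R => GaussianIFC.achievable_of_le_outerBound, ⟨0, hzero⟩, hbdd, ?_,
    csSup_le ⟨0, hzero⟩ fun _ => GaussianIFC.le_outerBound_of_mem_symRates⟩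
  -- If the lower bound is negative, the rate 0 already exceeds it.
  rcases le_total 0 (GaussianIFC.outerBound (‖gd‖ ^ 2) (‖gc‖ ^ 2) - 1.7075) with h | h
  · exact le_csSup hbdd (hach (GaussianIFC.achievable_of_le_outerBound h le_rfl))
  · exact h.trans (le_csSup hbdd hzero)
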